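/- **Setting.** Let $k\ge 0$, $N\ge 1$, $N_1,\dots,N_k\ge 1$ be integers, and for $1\le i\le k$ let $H_i$ be a complex $N\times N_i$ matrix and $T_i$ a complex $N_i\times N_i$ matrix. Put $N_0=N$ and $M=N_0+N_1+\dots+N_k$. The *free deterministic equivalent* of the random matrix model $\Phi_N=\sum_i H_iU_iT_iU_i^*H_i^*$ ($U_i$ independent Haar unitaries of size $N_i$) is $$\Phi=\sum_{i=1}^k h_it_ih_i^*,$$ where $h_i,t_i$ are elements of a unital $C^*$-algebra $\mathcal A$ with a tracial state $\tau$ (for instance a tracial $W^*$-probability space) and pairwise orthogonal non-zero projections $p_0,\dots,p_k\in\mathcal A$ with $\sum_i p_i=1$, such that, with $\tau^{(i)}=\tau(p_i)^{-1}\tau$ on $p_i\mathcal Ap_i$: * $\tau(p_i)=N_i/M$ for all $i$; * $h_i=p_0h_ip_i$, $t_i=p_it_ip_i$, $\tau^{(i)}(t_i^m)=\frac1{N_i}\mathrm{Tr}(T_i^m)$ for all $m\ge1$, and for all $m\geq 1$ and $i_1,\dots,i_m$ $$\tau^{(0)}(h_{i_1}h_{i_1}^*\cdots h_{i_m}h_{i_m}^*)=\tfrac1N\mathrm{Tr}(H_{i_1}H_{i_1}^*\cdots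 H_{i_m}H_{i_m}^*),$$ $$\tau^{(i_1)}(h_{i_1}^*h_{i_2}h_{i_2}^*\cdots h_{i_m}h_{i_m}^*h_{i_1})=\tfrac1{N_{i_1}}\mathrm{Tr}(H_{i_1}^*H_{i_2}H_{i_2}^*\cdots H_{i_m}H_{i_m}^*H_{i_1});$$ * $\{h_1,\dots,h_k\},t_1,\dots,t_k$ are free with amalgamation over $\mathcal D=\langle p_0,\dots,p_k\rangle$ with respect to the conditional expectation $\mathbf F(a)=\sum_i p_i\,\tau(p_i)^{-1}\tau(p_ia)$; that is, the algebras $\langle\mathcal D,h_1,h_1^*,\dots,h_k,h_k^*\rangle,\langle\mathcal D,t_1\rangle,\dots,\langle\mathcal D,t_k\rangle$ are free over $\mathcal D$. Consider $\Phi$ as an element of the compressed space $(p_0\mathcal Ap_0,\tau^{(0)})$. For $z$ in its resolvent set there, let $$G(z)=\tau^{(0)}\big((zp_0-\Phi)^{-1}\big),\qquad f_j(z)=\frac{N}{N_j}\,\tau^{(0)}\big((zp_0-\Phi)^{-1}h_jh_j^*\big),\quad 1\le j\le k.$$ Let $R_{T_i}(w)=\sum_{m\ge1}\kappa_m(T_i)w^{m-1}$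 be the R-transform of $T_i$ with respect to $\frac1{N_i}\mathrm{Tr}$, where the free cumulants $\kappa_m$ are determined by $\frac1{N_i}\mathrm{Tr}(T_i^m)=\sum_{\pi\in NC(m)}\prod_{V\in\pi}\kappa_{|V|}(T_i)$ for $m\ge1$, with $NC(m)$ the set of non-crossing partitions of $\{1,\dots,m\}$. **Statement.** 1. There are $\rho,\delta>0$ such that all series $R_{T_i}(w)$ converge for $|w|<\delta$ and such that every $z\in\mathbb C$ with $|z|>\rho$ lies in the resolvent set of $\Phi$, $|f_j(z)|<\delta$ for all $j$, the matrix $zI_N-\sum_iR_{T_i}(f_i(z))H_iH_i^*$ is invertible, and $$G(z)=\frac1N\mathrm{Tr}\Big[\Big(zI_N-\sum_{i=1}^kH_iH_i^*R_{T_i}(f_i(z))\Big)^{-1}\Big],$$ where the $f_j(z)$ solve the system $$f_j(z)=\frac1{N_j}\mathrm{Tr}\Big[\Big(zI_N-\sum_{i=1}^kH_iH_i^*R_{T_i}(f_i(z))\Big)^{-1}H_jH_j^*\Big],\qquad 1\le j\le k,$$ and $(f_1(z),\dots,f_k(z))$ is the only solution of this system (with invertible matrix) whose entries have modulus less than $\delta$.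 2. These equations persist under analytic continuation: let $\Omega\subseteq\mathbb C$ be a connected open subset of the resolvent set of $\Phi$ that contains $\{|z|>\rho'\}$ for some $\rho'$, and let $r_1,\dots,r_k$ be holomorphic on $\Omega$ with $r_i(z)=R_{T_i}(f_i(z))$ for $|z|>\rho'$. Then for all $z\in\Omega$ the matrix $zI_N-\sum_ir_i(z)H_iH_i^*$ is invertible, and the formulas for $G(z)$ and $f_j(z)$ in 1 hold with $r_i(z)$ in place of $R_{T_i}(f_i(z))$. 3. The equations are equivalent to the deterministic equivalent equations of Couillet, Debbah and Hoydis, which do not use the R-transform, namely the system $$e_j=\frac1N\mathrm{Tr}\Big[H_jH_j^*\Big(\sum_i\bar e_iH_iH_i^*-zI_N\Big)^{-1}\Big],\qquad \bar e_j=\frac1N\mathrm{Tr}\Big[T_j\Big(e_jT_j+\big(\tfrac{N_j}N-e_j\bar e_j\big)I_{N_j}\Big)^{-1}\Big]\qquad(1\le j\le k)$$ (all inverses being required to exist) in the unknowns $e_j,\bar e_j\in\mathbb C$ (here $\bar e_j$ is a second unknown, not a complex conjugate): for every $K>0$ there is $\delta'>0$ such that for all $z\in\mathbb C$ and all $e_j,\bar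 e_j$ with $|e_j|<\delta'$, $|\bar e_j|<K$, this system holds if and only if the numbers $f_j=-\frac N{N_j}e_j$ solve the system in 1 (with invertible matrix) and $\bar e_j=R_{T_j}(f_j)$ for all $j$. Moreover $\rho$ in 1 can be chosen such that, for $|z|>\rho$, $e_j=-\frac{N_j}Nf_j(z)$ and $\bar e_j=R_{T_j}(f_j(z))$ solve this system and $G(z)=-\frac1N\mathrm{Tr}\big[(\sum_i\bar e_iH_iH_i^*-zI_N)^{-1}\big]$. -/

import Mathlib

open scoped ComplexOrder

noncomputable section

namespace FreeDetEquiv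

/-! ### Scalar free cumulants and the R-transform -/

/-- A partition of `{0, …, n - 1}` is non-crossing if `a < b < c < d` with `a, c` in a block `V` and
`b, d` in a block `W` forces `V = W`. -/
def IsNonCrossing {n : ℕ} (π : Finpartition (Finset.univ : Finset (Fin n))) : Prop :=
  ∀ a b c d : Fin n, a < b → b < c → c < d →
    ∀ V ∈ π.parts, ∀ W ∈ π.parts, a ∈ V → c ∈ V → b ∈ W → d ∈ W → V = W

open Classical in
/-- The free cumulants `κ n` of a moment sequence `m`, defined recursively by the moment-cumulant
formula `m n = ∑ π ∈ NC(n), ∏ V ∈ π, κ |V|`: all non-crossing partitions but the one-block partition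
are moved to the other side. (Only the values at `n ≥ 1` are meaningful; see
`sum_nonCrossing_freeCumulant`.) -/
def freeCumulant (m : ℕ → ℂ) (n : ℕ) : ℂ :=
  m n - ∑ π : Finpartition (Finset.univ : Finset (Fin n)),
    if IsNonCrossing π ∧ π.parts ≠ {Finset.univ} then
      ∏ V ∈ π.parts, if _hV : V.card < n then freeCumulant m V.card else 0
    else 0
termination_by n

open Classical in
/-- The moment-cumulant formula. -/
theorem sum_nonCrossing_freeCumulant (m : ℕ → ℂ) (n : ℕ) (hn : 0 < n) :
    m n = ∑ π : Finpartition (Finset.univ : Finset (Fin n)),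
      if IsNonCrossing π then ∏ V ∈ π.parts, freeCumulant m V.card else 0 := by
  have hne : (Finset.univ : Finset (Fin n)) ≠ ∅ := by
    have : Nonempty (Fin n) := ⟨⟨0, hn⟩⟩
    exact Finset.univ_nonempty.ne_empty
  set P : Finpartition (Finset.univ : Finset (Fin n)) := Finpartition.indiscrete hne with hP
  have hPp : P.parts = {Finset.univ} := rfl
  have hPn : IsNonCrossing P := by
    intro a b c d _ _ _ V hV W hW _ _ _ _
    rw [hPp, Finset.mem_singleton] at hV hW
    rw [hV, hW]
  have huniq : ∀ π : Finpartition (Finset.univ : Finset (Fin n)),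
      π.parts = {Finset.univ} → π = P := fun π h => Finpartition.ext (h.trans hPp.symm)
  have hcard : ∀ π : Finpartition (Finset.univ : Finset (Fin n)), π ≠ P →
      ∀ V ∈ π.parts, V.card < n := by
    intro π hπ V hV
    by_contra hlt
    have hVu : V = Finset.univ :=
      Finset.eq_univ_of_card V (le_antisymm (Finset.card_le_univ V) (by simpa using hlt))
    refine hπ (huniq π (Finset.eq_singleton_iff_unique_mem.2 ⟨hVu ▸ hV, fun W hW => ?_⟩))
    obtain ⟨x, hx⟩ := π.nonempty_of_mem_parts hW
    exact (π.eq_of_mem_parts hW hV hx (hVu ▸ Finset.mem_univ x)).trans hVu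
  have key := freeCumulant.eq_1 m n
  rw [← Finset.add_sum_erase _ _ (Finset.mem_univ P)] at key ⊢
  rw [if_neg (fun h => h.2 hPp), zero_add] at key
  rw [if_pos hPn, hPp, Finset.prod_singleton, Finset.card_univ, Fintype.card_fin, key, sub_add]
  rw [eq_comm, sub_eq_self, sub_eq_zero]
  refine Finset.sum_congr rfl fun π hπ => ?_
  have hπP : π ≠ P := (Finset.mem_erase.1 hπ).1
  by_cases hc : IsNonCrossing π
  · rw [if_pos ⟨hc, fun h => hπP (huniq π h)⟩, if_pos hc]
    exact Finset.prod_congr rfl fun V hV => dif_pos (hcard π hπP V hV)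
  · rw [if_neg (fun h => hc h.1), if_neg hc]

/-- The moments of a square matrix with respect to the normalized trace. -/
def matrixMoment {n : ℕ} (T : Matrix (Fin n) (Fin n) ℂ) (m : ℕ) : ℂ :=
  (n : ℂ)⁻¹ * (T ^ m).trace

/-- The coefficient of `w ^ m` in the R-transform of a matrix `T`, that is the free cumulant of order
`m + 1` of `T` with respect to the normalized trace. -/
def rCoeff {n : ℕ} (T : Matrix (Fin n) (Fin n) ℂ) (m : ℕ) : ℂ :=
  freeCumulant (matrixMoment T) (m + 1)

/-- The R-transform `R_T(w) = ∑_{m ≥ 1} κ_m(T) w ^ (m - 1)`. -/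
def rTransform {n : ℕ} (T : Matrix (Fin n) (Fin n) ℂ) (w : ℂ) : ℂ :=
  ∑' m : ℕ, rCoeff T m * w ^ m

/-! ### Rectangular probability spaces -/

section Spaces

variable {A : Type*} [CStarAlgebra A]

/-- A tracial state on a unital C*-algebra. -/
structure IsTracialState (τ : A →ₗ[ℂ] ℂ) : Prop where
  map_one : τ 1 = 1
  nonneg : ∀ a, 0 ≤ τ (star a * a)
  trace : ∀ a b, τ (a * b) = τ (b * a)

/-- A rectangular probability space: a tracial state together with pairwise orthogonal, non-trivial
projections adding up to one. -/
structure IsRectangularSpace {ι : Type*} [Fintype ι] (τ : A →ₗ[ℂ] ℂ) (p : ι → A) : Prop where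
  tracial : IsTracialState τ
  proj : ∀ i, IsStarProjection (p i)
  ne_zero : ∀ i, p i ≠ 0
  orthogonal : ∀ i j, i ≠ j → p i * p j = 0
  sum_eq_one : ∑ i, p i = 1

/-- The normalized trace `a ↦ τ(q)⁻¹ τ(a)` of the compressed space `q A q`. -/
def compressedTrace (τ : A →ₗ[ℂ] ℂ) (q a : A) : ℂ := (τ q)⁻¹ * τ a

/-- The conditional expectation `F(a) = ∑ i, p_i τ(p_i)⁻¹ τ(p_i a)` onto the algebra spanned by the
projections `p_i`. -/
def condExp {ι : Type*} [Fintype ι] (τ : A →ₗ[ℂ] ℂ) (p : ι → A) (a : A) : A :=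
  ∑ i, ((τ (p i))⁻¹ * τ (p i * a)) • p i

/-- Freeness with amalgamation of a family of subalgebras, with respect to `F : A → A`:
`F (a₁ ⋯ aₙ) = 0` for every non-empty word of `F`-centered elements of the subalgebras
in which neighbouring letters are taken from different subalgebras. -/
def IsFreeWithAmalgamation {κ : Type*} (F : A → A) (S : κ → Subalgebra ℂ A) : Prop :=
  ∀ l : List (κ × A), l ≠ [] → (∀ x ∈ l, x.2 ∈ S x.1 ∧ F x.2 = 0) →
    l.IsChain (fun x y => x.1 ≠ y.1) → F (l.map Prod.snd).prod = 0

/-- The family of subalgebras `⟨D, h₁, h₁*, …, h_k, h_k*⟩, ⟨D, t₁⟩, …, ⟨D, t_k⟩`, where `D` is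
generated by the projections `p`. -/
def modelSubalgebras {ι : Type*} {k : ℕ} (p : ι → A) (h t : Fin k → A) :
    Option (Fin k) → Subalgebra ℂ A
  | none => Algebra.adjoin ℂ (Set.range p ∪ Set.range h ∪ Set.range fun i => star (h i))
  | some i => Algebra.adjoin ℂ (Set.range p ∪ {t i})

open Matrix in
/-- The ingredients `h_i`, `t_i` of the free deterministic equivalent of
`∑ i, H_i U_i T_i U_i* H_i*`, where `H_i` is `N × n_i`, `T_i` is `n_i × n_i` and the `U_i` are
independent Haar unitaries: simple elements of a `(p_0, …, p_k)`-rectangular probability space with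
`τ(p_i) = n_i / (N + ∑ j, n_j)`, whose distributions are those of the `T_i` and of the `H_i H_i*`,
and such that `{h_1, …, h_k}, t_1, …, t_k` are free with amalgamation over `⟨p_0, …, p_k⟩`. -/
structure IsFreeDeterministicEquivalent {k N : ℕ} {n : Fin k → ℕ}
    (H : (i : Fin k) → Matrix (Fin N) (Fin (n i)) ℂ)
    (T : (i : Fin k) → Matrix (Fin (n i)) (Fin (n i)) ℂ)
    (τ : A →ₗ[ℂ] ℂ) (p : Fin (k + 1) → A) (h t : Fin k → A) : Prop where
  rectangular : IsRectangularSpace τ p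
  trace_proj : ∀ i : Fin k, τ (p i.succ) = (n i : ℂ) / ((N : ℂ) + ∑ j, (n j : ℂ))
  h_simple : ∀ i, p 0 * h i * p i.succ = h i
  t_simple : ∀ i, p i.succ * t i * p i.succ = t i
  t_moments : ∀ i, ∀ m : ℕ, 1 ≤ m →
    compressedTrace τ (p i.succ) (t i ^ m) = (n i : ℂ)⁻¹ * (T i ^ m).trace
  h_moments : ∀ l : List (Fin k), l ≠ [] →
    compressedTrace τ (p 0) (l.map fun i => h i * star (h i)).prod =
      (N : ℂ)⁻¹ * (l.map fun i => H i * (H i)ᴴ).prod.trace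
  h_moments' : ∀ (i : Fin k) (l : List (Fin k)),
    compressedTrace τ (p i.succ) (star (h i) * (l.map fun j => h j * star (h j)).prod * h i) =
      (n i : ℂ)⁻¹ * ((H i)ᴴ * (l.map fun j => H j * (H j)ᴴ).prod * H i).trace
  free : IsFreeWithAmalgamation (condExp τ p) (modelSubalgebras p h t)

/-- The free deterministic equivalent `Φ = ∑ i, h_i t_i h_i*`. -/
def freeModel {k : ℕ} (h t : Fin k → A) : A := ∑ i, h i * t i * star (h i)

/-! ### Resolvents and Cauchy transforms in the compressed space `q A q` -/

/-- `y` is the inverse of `x` in the compressed algebra `q A q`, whose unit is `q`. -/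
def IsCornerInv (q x y : A) : Prop := q * y * q = y ∧ x * y = q ∧ y * x = q

theorem IsCornerInv.unique {q x y y' : A} (hq : q * q = q) (hy : IsCornerInv q x y)
    (hy' : IsCornerInv q x y') : y = y' := by
  obtain ⟨h1, _, h3⟩ := hy
  obtain ⟨h1', h2', _⟩ := hy'
  calc y = y * q := by rw [← h1, mul_assoc _ q q, hq]
    _ = y * x * y' := by rw [← h2', mul_assoc]
    _ = y' := by rw [h3, ← h1', ← mul_assoc, ← mul_assoc, hq]

open Classical in
/-- The inverse of `x` in `q A q` (zero if there is none). -/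
def cornerInv (q x : A) : A := if hx : ∃ y, IsCornerInv q x y then hx.choose else 0

/-- The resolvent set of `a`, considered as an element of `q A q`. -/
def cornerResolventSet (q a : A) : Set ℂ := {z | ∃ y, IsCornerInv q (z • q - a) y}

/-- The scalar Cauchy transform `G_a(z) = τ^{(q)}((z - a)⁻¹)` of `a`, considered as an element of the
compressed probability space `q A q`. -/
def cauchyTransform (τ : A →ₗ[ℂ] ℂ) (q a : A) (z : ℂ) : ℂ :=
  compressedTrace τ q (cornerInv q (z • q - a))

/-- The functions `f_j(z) = (N / n_j) τ^{(0)}((z - Φ)⁻¹ h_j h_j*)`. -/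
def fTransform {k : ℕ} (N : ℕ) (n : Fin k → ℕ) (τ : A →ₗ[ℂ] ℂ) (p : Fin (k + 1) → A)
    (h t : Fin k → A) (j : Fin k) (z : ℂ) : ℂ :=
  (N : ℂ) / (n j : ℂ) *
    compressedTrace τ (p 0) (cornerInv (p 0) (z • p 0 - freeModel h t) * (h j * star (h j)))

end Spaces

/-! ### The deterministic equivalent equations -/

section Equations

open Matrix

variable {k N : ℕ} {n : Fin k → ℕ}

/-- The matrix `z I_N - ∑ i, r_i H_i H_i*`. -/
def equivMatrix (H : (i : Fin k) → Matrix (Fin N) (Fin (n i)) ℂ) (r : Fin k → ℂ) (z : ℂ) :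
    Matrix (Fin N) (Fin N) ℂ :=
  z • (1 : Matrix (Fin N) (Fin N) ℂ) - ∑ i, r i • (H i * (H i)ᴴ)

/-- The system of equations
`f_j = (1 / n_j) Tr[(z I_N - ∑ i, R_{T_i}(f_i) H_i H_i*)⁻¹ H_j H_j*]`, for `j = 1, …, k`,
including the invertibility of the matrix. -/
def SolvesSystem (H : (i : Fin k) → Matrix (Fin N) (Fin (n i)) ℂ)
    (T : (i : Fin k) → Matrix (Fin (n i)) (Fin (n i)) ℂ) (z : ℂ) (f : Fin k → ℂ) : Prop :=
  IsUnit (equivMatrix H (fun i => rTransform (T i) (f i)) z) ∧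
  ∀ j, f j = (n j : ℂ)⁻¹ *
    ((equivMatrix H (fun i => rTransform (T i) (f i)) z)⁻¹ * (H j * (H j)ᴴ)).trace

/-- The deterministic equivalent equations in the form without R-transforms: in the unknowns
`e_j, e'_j` (`j = 1, …, k`),
`e_j = (1 / N) Tr[H_j H_j* (∑ i, e'_i H_i H_i* - z I_N)⁻¹]`,
`e'_j = (1 / N) Tr[T_j (e_j T_j + (n_j / N - e_j e'_j) I)⁻¹]`,
including the invertibility of the matrices. -/
def SolvesClassicalSystem (H : (i : Fin k) → Matrix (Fin N) (Fin (n i)) ℂ)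
    (T : (i : Fin k) → Matrix (Fin (n i)) (Fin (n i)) ℂ) (z : ℂ) (e e' : Fin k → ℂ) : Prop :=
  IsUnit ((∑ i, e' i • (H i * (H i)ᴴ)) - z • (1 : Matrix (Fin N) (Fin N) ℂ)) ∧
  (∀ j, e j = (N : ℂ)⁻¹ * ((H j * (H j)ᴴ) *
    ((∑ i, e' i • (H i * (H i)ᴴ)) - z • (1 : Matrix (Fin N) (Fin N) ℂ))⁻¹).trace) ∧
  ∀ j, IsUnit (e j • T j + ((n j : ℂ) / N - e j * e' j) • (1 : Matrix (Fin (n j)) (Fin (n j)) ℂ)) ∧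
    e' j = (N : ℂ)⁻¹ * (T j * (e j • T j +
      ((n j : ℂ) / N - e j * e' j) • (1 : Matrix (Fin (n j)) (Fin (n j)) ℂ))⁻¹).trace

end Equations

end FreeDetEquiv

end

/-! The R-transform enters as a centring condition. For small g the number r = R_T(g) solves r =
tr(T X) with X = (1 - g (T - r))⁻¹, and then tr X = 1, so X (T - r) has trace zero. Given small g_i,
put r_i = R_{T_i}(g_i), h = ∑ h_i, Q = (z - ∑ r_i h_i h_i*)⁻¹, F = ∑ g_i p_i, d_i = (1 - g_i (t_i -
r_i))⁻¹ (t_i - r_i) p_i, d = ∑ d_i and b = h* Q h - F. The d_i are centred by the choice of r_i, and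
b is centred if g solves the system. A Woodbury formula gives (z - Φ)⁻¹ = Q + Q h (1 - d b)⁻¹ d h*
Q. The Neumann series of the correction consists of alternating words in centred letters, so
freeness makes its trace vanish against every element of the algebra of the h_i h_i*. On that
algebra Q has matrix traces by the moment hypotheses. This is `resolvent_trace`, carried by
`woodbury_identity` and `trace_alternating`.

For large z the system is a contraction on small tuples (`exists_unique_solution`). Its solution g
satisfies the trace identity, and testing that identity on h_j h_j* shows g_j = f_j(z).

The centring property of R_T is derived from the combinatorial definition. Non-crossing partitions
are sorted by the successive points of the block of the first point. The resulting recursion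
(`exists_freeCumulant_recursion`) bounds the free cumulants geometrically and yields M(z) = 1 + f
R(f) for f = z M(z), where M is the moment series (`momentSeries_eq`). The equation for r is solved
by a contraction, and its solution is identified with R_T(g) (`rSeries_spec`).

For the continuation, every entry of the matrix inverse is N times a trace of the resolvent of Φ
against a fixed element (`exists_trace_represent`), hence extends holomorphically to Ω. The identity
theorem carries "left inverse" over to Ω, so invertibility comes out as a conclusion. The system
without R-transforms is the same one with R eliminated: its second equation is the fixed-point
equation for r after the substitution f = -(N/n) e. -/

namespace FreeDetEquiv

/-! ### Non-crossing partitions of finite sets of natural numbers -/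

section NonCrossing

open Finset

/-- `π` is a non-crossing partition of `S`, and no element of the barrier `B` lies strictly between
two elements of the same block. -/
structure IsNCPartition (B S : Finset ℕ) (π : Finset (Finset ℕ)) : Prop where
  empty_notMem : ∅ ∉ π
  subset : ∀ V ∈ π, V ⊆ S
  cover : ∀ x ∈ S, ∃ V ∈ π, x ∈ V
  eq_of_mem : ∀ V ∈ π, ∀ W ∈ π, ∀ x ∈ V, x ∈ W → V = W
  nonCrossing : ∀ a b c d, a < b → b < c → c < d →
    ∀ V ∈ π, ∀ W ∈ π, a ∈ V → c ∈ V → b ∈ W → d ∈ W → V = W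
  barrier : ∀ V ∈ π, ∀ a ∈ V, ∀ c ∈ V, ∀ b ∈ B, a < b → b < c → False

open Classical in
/-- The finite set of non-crossing partitions of `S` with barrier `B`. -/
noncomputable def ncPartitions (B S : Finset ℕ) : Finset (Finset (Finset ℕ)) :=
  S.powerset.powerset.filter (IsNCPartition B S)

theorem mem_ncPartitions {B S : Finset ℕ} {π : Finset (Finset ℕ)} :
    π ∈ ncPartitions B S ↔ IsNCPartition B S π := by
  classical
  simp only [ncPartitions, mem_filter, mem_powerset, and_iff_right_iff_imp]
  intro h V hV
  exact mem_powerset.2 (h.subset V hV)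

/-- The sum of the products of the `κ |V|` over all non-crossing partitions of `S` with
barrier `B`. -/
noncomputable def ncSum (κ : ℕ → ℂ) (B S : Finset ℕ) : ℂ :=
  ∑ π ∈ ncPartitions B S, ∏ V ∈ π, κ V.card

/-- A barrier point constrains a block only if it lies strictly between two points of S. -/
theorem ncSum_congr_barrier (κ : ℕ → ℂ) {B B' S : Finset ℕ}
    (h : ∀ a ∈ S, ∀ c ∈ S, ∀ b, a < b → b < c → (b ∈ B ↔ b ∈ B')) :
    ncSum κ B S = ncSum κ B' S := by
  have : ncPartitions B S = ncPartitions B' S := by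
    ext π
    rw [mem_ncPartitions, mem_ncPartitions]
    constructor
    · rintro ⟨h1, h2, h3, h4, h5, h6⟩
      exact ⟨h1, h2, h3, h4, h5, fun V hV a ha c hc b hb hab hbc =>
        h6 V hV a ha c hc b ((h a (h2 V hV ha) c (h2 V hV hc) b hab hbc).2 hb) hab hbc⟩
    · rintro ⟨h1, h2, h3, h4, h5, h6⟩
      exact ⟨h1, h2, h3, h4, h5, fun V hV a ha c hc b hb hab hbc =>
        h6 V hV a ha c hc b ((h a (h2 V hV ha) c (h2 V hV hc) b hab hbc).1 hb) hab hbc⟩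
  rw [ncSum, this, ncSum]

theorem ncSum_empty (κ : ℕ → ℂ) (B : Finset ℕ) : ncSum κ B ∅ = 1 := by
  have : ncPartitions B ∅ = {∅} := by
    ext π
    rw [mem_ncPartitions, mem_singleton]
    constructor
    · intro h
      refine eq_empty_of_forall_notMem fun V hV => ?_
      have := subset_empty.1 (h.subset V hV)
      exact h.empty_notMem (this ▸ hV)
    · rintro rfl
      constructor <;> simp
  simp [ncSum, this]

/-- The barrier point y separates the two sets, so each block lies on one side of it, and blocks on
different sides cannot cross. A partition of the union is therefore a pair of partitions. -/
theorem ncSum_union (κ : ℕ → ℂ) {B S₁ S₂ : Finset ℕ} {y : ℕ} (hy : y ∈ B)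
    (h₁ : ∀ x ∈ S₁, x < y) (h₂ : ∀ x ∈ S₂, y < x) :
    ncSum κ B (S₁ ∪ S₂) = ncSum κ B S₁ * ncSum κ B S₂ := by
  classical
  rw [ncSum, ncSum, ncSum, sum_mul_sum, ← sum_product']
  symm
  have hdisj : ∀ π₁ ∈ ncPartitions B S₁, ∀ π₂ ∈ ncPartitions B S₂, ∀ V ∈ π₁, ∀ W ∈ π₂,
      ∀ x ∈ V, x ∉ W := by
    intro π₁ hπ₁ π₂ hπ₂ V hV W hW x hx hx'
    rw [mem_ncPartitions] at hπ₁ hπ₂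
    have := h₁ x (hπ₁.subset V hV hx)
    have := h₂ x (hπ₂.subset W hW hx')
    omega
  refine sum_bij' (fun q _ => q.1 ∪ q.2)
    (fun π _ => (π.filter (· ⊆ S₁), π.filter (· ⊆ S₂))) ?_ ?_ ?_ ?_ ?_
  · rintro ⟨π₁, π₂⟩ hq
    rw [mem_product] at hq
    have hd := hdisj _ hq.1 _ hq.2
    simp only [mem_ncPartitions] at hq ⊢
    obtain ⟨hA, hB⟩ := hq
    refine ⟨?_, ?_, ?_, ?_, ?_, ?_⟩
    · rw [mem_union, not_or]; exact ⟨hA.empty_notMem, hB.empty_notMem⟩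
    · intro V hV
      rcases mem_union.1 hV with hV | hV
      · exact (hA.subset V hV).trans subset_union_left
      · exact (hB.subset V hV).trans subset_union_right
    · intro x hx
      rcases mem_union.1 hx with hx | hx
      · obtain ⟨V, hV, hxV⟩ := hA.cover x hx
        exact ⟨V, mem_union_left _ hV, hxV⟩
      · obtain ⟨V, hV, hxV⟩ := hB.cover x hx
        exact ⟨V, mem_union_right _ hV, hxV⟩
    · intro V hV W hW x hxV hxW
      rcases mem_union.1 hV with hV | hV <;> rcases mem_union.1 hW with hW | hW
      · exact hA.eq_of_mem V hV W hW x hxV hxW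
      · exact absurd hxW (hd V hV W hW x hxV)
      · exact absurd hxV (hd W hW V hV x hxW)
      · exact hB.eq_of_mem V hV W hW x hxV hxW
    · intro a b c d hab hbc hcd V hV W hW haV hcV hbW hdW
      rcases mem_union.1 hV with hV | hV <;> rcases mem_union.1 hW with hW | hW
      · exact hA.nonCrossing a b c d hab hbc hcd V hV W hW haV hcV hbW hdW
      · have := h₁ c (hA.subset V hV hcV)
        have := h₂ b (hB.subset W hW hbW)
        omega
      · have := h₂ a (hB.subset V hV haV)
        have := h₁ b (hA.subset W hW hbW)
        omega
      · exact hB.nonCrossing a b c d hab hbc hcd V hV W hW haV hcV hbW hdW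
    · intro V hV
      rcases mem_union.1 hV with hV | hV
      · exact hA.barrier V hV
      · exact hB.barrier V hV
  · intro π hπ
    rw [mem_ncPartitions] at hπ
    have hsub : ∀ V ∈ π, V ⊆ S₁ ∨ V ⊆ S₂ := by
      intro V hV
      by_contra hcon
      rw [not_or, not_subset, not_subset] at hcon
      obtain ⟨⟨u, hu, hu1⟩, v, hv, hv1⟩ := hcon
      have hu2 : u ∈ S₂ := (mem_union.1 (hπ.subset V hV hu)).resolve_left hu1
      have hv2 : v ∈ S₁ := (mem_union.1 (hπ.subset V hV hv)).resolve_right hv1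
      exact hπ.barrier V hV v hv u hu y hy (h₁ v hv2) (h₂ u hu2)
    rw [mem_product, mem_ncPartitions, mem_ncPartitions]
    constructor
    · refine ⟨fun h => hπ.empty_notMem (mem_filter.1 h).1, fun V hV => (mem_filter.1 hV).2, ?_,
        fun V hV W hW => hπ.eq_of_mem V (mem_filter.1 hV).1 W (mem_filter.1 hW).1,
        fun a b c d hab hbc hcd V hV W hW => hπ.nonCrossing a b c d hab hbc hcd
          V (mem_filter.1 hV).1 W (mem_filter.1 hW).1,
        fun V hV => hπ.barrier V (mem_filter.1 hV).1⟩
      intro x hx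
      obtain ⟨V, hV, hxV⟩ := hπ.cover x (mem_union_left _ hx)
      refine ⟨V, mem_filter.2 ⟨hV, (hsub V hV).resolve_right fun h => ?_⟩, hxV⟩
      have := h₁ x hx
      have := h₂ x (h hxV)
      omega
    · refine ⟨fun h => hπ.empty_notMem (mem_filter.1 h).1, fun V hV => (mem_filter.1 hV).2, ?_,
        fun V hV W hW => hπ.eq_of_mem V (mem_filter.1 hV).1 W (mem_filter.1 hW).1,
        fun a b c d hab hbc hcd V hV W hW => hπ.nonCrossing a b c d hab hbc hcd
          V (mem_filter.1 hV).1 W (mem_filter.1 hW).1,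
        fun V hV => hπ.barrier V (mem_filter.1 hV).1⟩
      intro x hx
      obtain ⟨V, hV, hxV⟩ := hπ.cover x (mem_union_right _ hx)
      refine ⟨V, mem_filter.2 ⟨hV, (hsub V hV).resolve_left fun h => ?_⟩, hxV⟩
      have := h₂ x hx
      have := h₁ x (h hxV)
      omega
  · rintro ⟨π₁, π₂⟩ hq
    rw [mem_product, mem_ncPartitions, mem_ncPartitions] at hq
    obtain ⟨hA, hB⟩ := hq
    have key : ∀ V, V ⊆ S₁ → V ⊆ S₂ → V = ∅ := fun V hV hV' =>
      eq_empty_of_forall_notMem fun x hx => by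
        have := h₁ x (hV hx)
        have := h₂ x (hV' hx)
        omega
    have e1 := hA.subset
    have e2 := hB.subset
    have e3 := hA.empty_notMem
    have e4 := hB.empty_notMem
    ext V
    · simp only [mem_filter, mem_union]
      constructor
      · rintro ⟨hV | hV, hS⟩
        · exact hV
        · exact absurd (key V hS (e2 V hV) ▸ hV) e4
      · exact fun hV => ⟨Or.inl hV, e1 V hV⟩
    · simp only [mem_filter, mem_union]
      constructor
      · rintro ⟨hV | hV, hS⟩
        · exact absurd (key V (e1 V hV) hS ▸ hV) e3
        · exact hV
      · exact fun hV => ⟨Or.inr hV, e2 V hV⟩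
  · intro π hπ
    rw [mem_ncPartitions] at hπ
    ext V
    simp only [mem_filter, mem_union]
    constructor
    · rintro (h | h) <;> exact h.1
    · intro hV
      by_contra hcon
      rw [← and_or_left, not_and, not_or, not_subset, not_subset] at hcon
      obtain ⟨⟨u, hu, hu1⟩, v, hv, hv1⟩ := hcon hV
      have hu2 : u ∈ S₂ := (mem_union.1 (hπ.subset V hV hu)).resolve_left hu1
      have hv2 : v ∈ S₁ := (mem_union.1 (hπ.subset V hV hv)).resolve_right hv1
      exact hπ.barrier V hV v hv u hu y hy (h₁ v hv2) (h₂ u hu2)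
  · rintro ⟨π₁, π₂⟩ hq
    rw [mem_product] at hq
    refine (prod_union (disjoint_left.2 fun V hV hV' => ?_)).symm
    have h0 : V ≠ ∅ := fun h0 => (mem_ncPartitions.1 hq.1).empty_notMem (h0 ▸ hV)
    obtain ⟨x, hx⟩ := nonempty_iff_ne_empty.2 h0
    exact hdisj _ hq.1 _ hq.2 V hV V hV' x hx hx

/-- Partitions are sorted by the block {a} ∪ V of the minimum a. Since a lies below everything,
another block crosses this one exactly when a point of V lies strictly between two of its points.
This is the barrier condition on the remaining partition, and the reason for carrying barriers at
all. -/
theorem ncSum_insert (κ : ℕ → ℂ) {S : Finset ℕ} {a : ℕ} (ha : ∀ x ∈ S, a < x) :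
    ncSum κ ∅ (insert a S) = ∑ V ∈ S.powerset, κ (1 + V.card) * ncSum κ V (S \ V) := by
  classical
  have haS : a ∉ S := fun h => lt_irrefl a (ha a h)
  simp only [ncSum, mul_sum]
  rw [sum_sigma']
  symm
  have hnot : ∀ V ∈ S.powerset, ∀ π ∈ ncPartitions V (S \ V), ∀ W ∈ π, a ∉ W := by
    intro V hV π hπ W hW haW
    exact haS (mem_sdiff.1 ((mem_ncPartitions.1 hπ).subset W hW haW)).1
  refine sum_bij (fun q _ => insert (insert a q.1) q.2) ?_ ?_ ?_ ?_
  · rintro ⟨V, π⟩ hq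
    rw [mem_sigma] at hq
    obtain ⟨hV, hπ'⟩ := hq
    have hn := hnot V hV π hπ'
    have hπ := mem_ncPartitions.1 hπ'
    rw [mem_powerset] at hV
    dsimp only at hπ hn ⊢
    have hVW : ∀ W ∈ π, ∀ x ∈ insert a V, x ∉ W := by
      intro W hW x hx hxW
      rcases mem_insert.1 hx with rfl | hx
      · exact hn W hW hxW
      · exact (mem_sdiff.1 (hπ.subset W hW hxW)).2 hx
    rw [mem_ncPartitions]
    refine ⟨?_, ?_, ?_, ?_, ?_, by simp⟩
    · rw [mem_insert, not_or]
      exact ⟨(insert_ne_empty a V).symm, hπ.empty_notMem⟩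
    · intro W hW
      rcases mem_insert.1 hW with rfl | hW
      · exact insert_subset_insert _ hV
      · exact (hπ.subset W hW).trans (sdiff_subset.trans (subset_insert _ _))
    · intro x hx
      by_cases hxV : x ∈ insert a V
      · exact ⟨_, mem_insert_self _ _, hxV⟩
      · rw [mem_insert, not_or] at hxV
        obtain ⟨W, hW, hxW⟩ := hπ.cover x
          (mem_sdiff.2 ⟨(mem_insert.1 hx).resolve_left hxV.1, hxV.2⟩)
        exact ⟨W, mem_insert_of_mem hW, hxW⟩
    · intro W hW U hU x hxW hxU
      rcases mem_insert.1 hW with rfl | hW <;> rcases mem_insert.1 hU with rfl | hU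
      · rfl
      · exact absurd hxU (hVW U hU x hxW)
      · exact absurd hxW (hVW W hW x hxU)
      · exact hπ.eq_of_mem W hW U hU x hxW hxU
    · intro u v x w huv hvx hxw W hW U hU hu hx hv hw
      rcases mem_insert.1 hW with rfl | hW' <;> rcases mem_insert.1 hU with rfl | hU'
      · rfl
      · have hxV : x ∈ V := by
          rcases mem_insert.1 hx with rfl | hx
          · have := ha v (mem_sdiff.1 (hπ.subset U hU' hv)).1
            omega
          · exact hx
        exact (hπ.barrier U hU' v hv w hw x hxV hvx hxw).elim
      · have hvV : v ∈ V := by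
          rcases mem_insert.1 hv with rfl | hv
          · have := ha u (mem_sdiff.1 (hπ.subset W hW' hu)).1
            omega
          · exact hv
        exact (hπ.barrier W hW' u hu x hx v hvV huv hvx).elim
      · exact hπ.nonCrossing u v x w huv hvx hxw W hW' U hU' hu hx hv hw
  · rintro ⟨V, π⟩ hq ⟨V', π'⟩ hq' heq
    rw [mem_sigma] at hq hq'
    dsimp only at hq hq' heq
    have hn := hnot V hq.1 π hq.2
    have hn' := hnot V' hq'.1 π' hq'.2
    have hins : insert a V = insert a V' := by
      have : insert a V ∈ insert (insert a V') π' := heq ▸ mem_insert_self _ _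
      exact (mem_insert.1 this).resolve_right fun h => hn' _ h (mem_insert_self _ _)
    have haV : a ∉ V := fun h => haS (mem_powerset.1 hq.1 h)
    have haV' : a ∉ V' := fun h => haS (mem_powerset.1 hq'.1 h)
    have hVV : V = V' := by
      rw [← erase_insert haV, hins, erase_insert haV']
    subst hVV
    have hππ : π = π' := by
      rw [← erase_insert (fun h => hn _ h (mem_insert_self a V)), heq,
        erase_insert (fun h => hn' _ h (mem_insert_self a V))]
    rw [hππ]
  · intro π hπ
    rw [mem_ncPartitions] at hπ
    obtain ⟨W, hW, haW⟩ := hπ.cover a (mem_insert_self _ _)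
    have hWi : insert a (W.erase a) = W := insert_erase haW
    have hWS : W.erase a ⊆ S := fun x hx =>
      (mem_insert.1 (hπ.subset W hW (mem_of_mem_erase hx))).resolve_left (ne_of_mem_erase hx)
    refine ⟨⟨W.erase a, π.erase W⟩, ?_, ?_⟩
    · rw [mem_sigma, mem_powerset, mem_ncPartitions]
      refine ⟨hWS, fun h => hπ.empty_notMem (mem_of_mem_erase h), ?_, ?_,
        fun V hV U hU => hπ.eq_of_mem V (mem_of_mem_erase hV) U (mem_of_mem_erase hU),
        fun u v x w huv hvx hxw V hV U hU => hπ.nonCrossing u v x w huv hvx hxw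
          V (mem_of_mem_erase hV) U (mem_of_mem_erase hU), ?_⟩
      · intro V hV x hx
        have hxW : x ∉ W := fun hxW => ne_of_mem_erase hV
          (hπ.eq_of_mem V (mem_of_mem_erase hV) W hW x hx hxW)
        have hxa : x ≠ a := fun h => hxW (h ▸ haW)
        exact mem_sdiff.2 ⟨(mem_insert.1 (hπ.subset V (mem_of_mem_erase hV) hx)).resolve_left hxa,
          fun h => hxW (mem_of_mem_erase h)⟩
      · intro x hx
        rw [mem_sdiff] at hx
        obtain ⟨V, hV, hxV⟩ := hπ.cover x (mem_insert_of_mem hx.1)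
        refine ⟨V, mem_erase.2 ⟨?_, hV⟩, hxV⟩
        rintro rfl
        exact hx.2 (mem_erase.2 ⟨fun h => haS (h ▸ hx.1), hxV⟩)
      · intro V hV u hu x hx v hv huv hvx
        have hVW := hπ.subset V (mem_of_mem_erase hV)
        have hau : a < u := by
          rcases mem_insert.1 (hVW hu) with h | h
          · exact absurd (hπ.eq_of_mem V (mem_of_mem_erase hV) W hW u hu (h ▸ haW))
              (ne_of_mem_erase hV)
          · exact ha u h
        exact ne_of_mem_erase hV (hπ.nonCrossing a u v x hau huv hvx W hW V (mem_of_mem_erase hV)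
          haW (mem_of_mem_erase hv) hu hx).symm
    · dsimp only
      rw [hWi, insert_erase hW]
  · rintro ⟨V, π⟩ hq
    rw [mem_sigma] at hq
    have hn := hnot V hq.1 π hq.2
    dsimp only at hn hq ⊢
    rw [prod_insert (fun h => hn _ h (mem_insert_self a V)),
      card_insert_of_notMem (fun h => haS (mem_powerset.1 hq.1 h)), add_comm]

/-- The sum over the non-crossing partitions of `[a, b)` preceded by `s` points of one block. -/
noncomputable def ncTail (κ : ℕ → ℂ) (s a b : ℕ) : ℂ :=
  ∑ V ∈ (Ico a b).powerset, κ (s + V.card) * ncSum κ V (Ico a b \ V)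

theorem ncSum_Ico (κ : ℕ → ℂ) {a b : ℕ} (h : a < b) :
    ncSum κ ∅ (Ico a b) = ncTail κ 1 (a + 1) b := by
  have : Ico a b = insert a (Ico (a + 1) b) := by
    ext x; simp only [mem_insert, mem_Ico]; omega
  rw [this, ncSum_insert κ (by intro x hx; rw [mem_Ico] at hx; omega), ncTail]

/-- Either no point of the interval joins the initial block, or there is a first point y that does.
In the latter case the points before y are enclosed by the block and partitioned on their own, and y
becomes the next point of the initial block. -/
theorem ncTail_eq (κ : ℕ → ℂ) (s a b : ℕ) :
    ncTail κ s a b = κ s * ncSum κ ∅ (Ico a b) +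
      ∑ y ∈ Ico a b, ncSum κ ∅ (Ico a y) * ncTail κ (s + 1) (y + 1) b := by
  classical
  rw [ncTail, ← add_sum_erase _ _ (empty_mem_powerset (Ico a b)), card_empty, add_zero, sdiff_empty]
  congr 1
  simp only [ncTail, mul_sum]
  rw [sum_sigma']
  symm
  refine sum_bij (fun q _ => insert q.1 q.2) ?_ ?_ ?_ ?_
  · rintro ⟨y, V⟩ hq
    simp only [mem_sigma, mem_Ico, mem_powerset, mem_erase, insert_ne_empty, ne_eq, not_false_eq_true,
      true_and] at hq ⊢
    refine insert_subset (mem_Ico.2 hq.1) (hq.2.trans ?_)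
    intro x hx; rw [mem_Ico] at hx ⊢; omega
  · rintro ⟨y, V⟩ hq ⟨y', V'⟩ hq' heq
    simp only [mem_sigma, mem_Ico, mem_powerset] at hq hq' heq
    have hlt : ∀ x ∈ V, y < x := fun x hx => by have := mem_Ico.1 (hq.2 hx); omega
    have hlt' : ∀ x ∈ V', y' < x := fun x hx => by have := mem_Ico.1 (hq'.2 hx); omega
    have hyy : y = y' := by
      have h1 : y ∈ insert y' V' := heq ▸ mem_insert_self _ _
      have h2 : y' ∈ insert y V := heq ▸ mem_insert_self _ _
      rcases mem_insert.1 h1 with h1 | h1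
      · exact h1
      · rcases mem_insert.1 h2 with h2 | h2
        · exact h2.symm
        · have := hlt _ h2; have := hlt' _ h1; omega
    subst hyy
    have : V = V' := by
      rw [← erase_insert (fun h => lt_irrefl y (hlt y h)), heq,
        erase_insert (fun h => lt_irrefl y (hlt' y h))]
    rw [this]
  · intro V hV
    rw [mem_erase, mem_powerset] at hV
    have hne := nonempty_iff_ne_empty.2 hV.1
    refine ⟨⟨V.min' hne, V.erase (V.min' hne)⟩, ?_, insert_erase (min'_mem V hne)⟩
    simp only [mem_sigma, mem_powerset]
    refine ⟨hV.2 (min'_mem V hne), fun x hx => ?_⟩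
    have h1 := min'_lt_of_mem_erase_min' V hne hx
    have h2 := mem_Ico.1 (hV.2 (mem_of_mem_erase hx))
    rw [mem_Ico]; omega
  · rintro ⟨y, V⟩ hq
    simp only [mem_sigma, mem_Ico, mem_powerset] at hq ⊢
    have hlt : ∀ x ∈ V, y < x := fun x hx => by have := mem_Ico.1 (hq.2 hx); omega
    have hset : Ico a b \ insert y V = Ico a y ∪ (Ico (y + 1) b \ V) := by
      ext x
      simp only [mem_sdiff, mem_Ico, mem_insert, mem_union, not_or]
      constructor
      · rintro ⟨h1, h2, h3⟩
        by_cases hxy : x < y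
        · exact Or.inl ⟨h1.1, hxy⟩
        · exact Or.inr ⟨⟨by omega, h1.2⟩, h3⟩
      · rintro (h | h)
        · exact ⟨by omega, by omega, fun hx => by have := hlt x hx; omega⟩
        · exact ⟨by omega, by omega, h.2⟩
    -- On the left of y no barrier point lies below y, so the barrier is void there. On the right y
    -- lies below all points, so only V remains as a barrier.
    rw [hset, ncSum_union κ (mem_insert_self y V) (by intro x hx; exact (mem_Ico.1 hx).2)
      (by intro x hx; have := mem_Ico.1 (mem_sdiff.1 hx).1; omega),
      card_insert_of_notMem (fun h => lt_irrefl y (hlt y h)),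
      ncSum_congr_barrier κ (B := insert y V) (B' := ∅) (S := Ico a y),
      ncSum_congr_barrier κ (B := insert y V) (B' := V) (S := Ico (y + 1) b \ V)]
    · rw [show s + 1 + V.card = s + (V.card + 1) by ring]; ring
    · intro u hu w hw v huv hvw
      have := mem_Ico.1 (mem_sdiff.1 hu).1
      rw [mem_insert, or_iff_right]; omega
    · intro u hu w hw v huv hvw
      have := mem_Ico.1 hw
      simp only [mem_insert, notMem_empty, iff_false, not_or]
      exact ⟨by omega, fun h => by have := hlt v h; omega⟩

/-- The two statements are proved together because each sum reduces to shorter instances of both. -/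
theorem ncTail_translate (κ : ℕ → ℂ) (L : ℕ) : ∀ a,
    ncSum κ ∅ (Ico a (a + L)) = ncSum κ ∅ (Ico 0 L) ∧
      ∀ s, ncTail κ s a (a + L) = ncTail κ s 0 L := by
  induction L using Nat.strong_induction_on with
  | _ L ih =>
    have hm : ∀ a, ncSum κ ∅ (Ico a (a + L)) = ncSum κ ∅ (Ico 0 L) := by
      intro a
      rcases Nat.eq_zero_or_pos L with rfl | hL
      · simp
      · rw [ncSum_Ico κ (by omega), ncSum_Ico κ hL]
        obtain ⟨L', rfl⟩ : ∃ L', L = L' + 1 := ⟨L - 1, by omega⟩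
        rw [show a + (L' + 1) = a + 1 + L' by ring, (ih L' (by omega) (a + 1)).2 1,
          show 0 + 1 = 1 by rfl, add_comm L' 1, (ih L' (by omega) 1).2 1]
    intro a
    refine ⟨hm a, fun s => ?_⟩
    rw [ncTail_eq, ncTail_eq, hm a]
    congr 1
    rw [sum_Ico_eq_sum_range, sum_Ico_eq_sum_range, Nat.add_sub_cancel_left, Nat.sub_zero]
    refine sum_congr rfl fun y hy => ?_
    rw [mem_range] at hy
    have h1 := (ih y hy a).1
    have h2 := (ih (L - (y + 1)) (by omega) (a + y + 1)).2 (s + 1)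
    have h3 := (ih (L - (y + 1)) (by omega) (y + 1)).2 (s + 1)
    rw [show a + y + 1 + (L - (y + 1)) = a + L by omega] at h2
    rw [show y + 1 + (L - (y + 1)) = L by omega] at h3
    rw [zero_add, h1, h2, h3]

theorem ncTail_recursion (κ : ℕ → ℂ) (s L : ℕ) :
    ncTail κ s 0 (L + 1) = κ s * ncSum κ ∅ (Ico 0 (L + 1)) +
      ∑ q ∈ antidiagonal L, ncSum κ ∅ (Ico 0 q.1) * ncTail κ (s + 1) 0 q.2 := by
  rw [ncTail_eq, Nat.sum_antidiagonal_eq_sum_range_succ_mk, sum_Ico_eq_sum_range, Nat.sub_zero]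
  congr 1
  refine sum_congr rfl fun y hy => ?_
  rw [mem_range] at hy
  have h := (ncTail_translate κ (L - y) (y + 1)).2 (s + 1)
  rw [show y + 1 + (L - y) = L + 1 by omega] at h
  rw [zero_add, h]

theorem ncSum_range_succ (κ : ℕ → ℂ) (L : ℕ) :
    ncSum κ ∅ (Ico 0 (L + 1)) = ncTail κ 1 0 L := by
  rw [ncSum_Ico κ (Nat.succ_pos L), zero_add, Nat.succ_eq_one_add, (ncTail_translate κ L 1).2 1]

-- This links the definition of free cumulants over `Fin n` with partitions of finite sets of
-- naturals. The latter are used because the recursion needs subintervals and complements of blocks.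
open Classical in
theorem ncSum_eq_sum_finpartition (κ : ℕ → ℂ) (n : ℕ) :
    ncSum κ ∅ (Ico 0 n) = ∑ π : Finpartition (univ : Finset (Fin n)),
      if IsNonCrossing π then ∏ V ∈ π.parts, κ V.card else 0 := by
  rw [← sum_filter, ncSum]
  symm
  set e : Finset (Fin n) ↪ Finset ℕ := (mapEmbedding Fin.valEmbedding).toEmbedding with he
  have hmem : ∀ (V : Finset (Fin n)) (x : Fin n), (x : ℕ) ∈ e V ↔ x ∈ V := by
    intro V x
    simp [he, Fin.val_inj]
  have hmem' : ∀ (V : Finset (Fin n)) (x : ℕ), x ∈ e V → ∃ y ∈ V, (y : ℕ) = x := by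
    intro V x hx
    simpa [he] using hx
  refine sum_bij (fun π _ => π.parts.map e) ?_ ?_ ?_ ?_
  · intro π hπ
    rw [mem_filter] at hπ
    rw [mem_ncPartitions]
    refine ⟨?_, ?_, ?_, ?_, ?_, by simp⟩
    · intro h
      obtain ⟨V, hV, hV0⟩ := mem_map.1 h
      obtain ⟨x, hx⟩ := π.nonempty_of_mem_parts hV
      have := (hmem V x).2 hx
      rw [hV0] at this
      simp at this
    · intro V hV x hx
      obtain ⟨V, hV, rfl⟩ := mem_map.1 hV
      obtain ⟨y, hy, rfl⟩ := hmem' V x hx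
      simp
    · intro x hx
      rw [mem_Ico] at hx
      obtain ⟨V, hV, hxV⟩ := π.exists_mem (mem_univ (⟨x, hx.2⟩ : Fin n))
      exact ⟨e V, mem_map_of_mem e hV, (hmem V ⟨x, hx.2⟩).2 hxV⟩
    · intro V hV W hW x hxV hxW
      obtain ⟨V, hV', rfl⟩ := mem_map.1 hV
      obtain ⟨W, hW', rfl⟩ := mem_map.1 hW
      obtain ⟨y, hy, rfl⟩ := hmem' V x hxV
      rw [π.eq_of_mem_parts hV' hW' hy ((hmem W y).1 hxW)]
    · intro a b c d hab hbc hcd V hV W hW ha hc hb hd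
      obtain ⟨V, hV', rfl⟩ := mem_map.1 hV
      obtain ⟨W, hW', rfl⟩ := mem_map.1 hW
      obtain ⟨a, ha', rfl⟩ := hmem' V a ha
      obtain ⟨b, hb', rfl⟩ := hmem' W b hb
      obtain ⟨c, hc', rfl⟩ := hmem' V c hc
      obtain ⟨d, hd', rfl⟩ := hmem' W d hd
      rw [hπ.2 a b c d hab hbc hcd V hV' W hW' ha' hc' hb' hd']
  · intro π _ π' _ h
    exact Finpartition.ext (map_injective e h)
  · intro π hπ
    rw [mem_ncPartitions] at hπ
    have hpre : ∀ V ∈ π, ∃ V', e V' = V := by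
      intro V hV
      refine ⟨univ.filter fun x : Fin n => (x : ℕ) ∈ V, ?_⟩
      ext x
      constructor
      · intro hx
        obtain ⟨y, hy, rfl⟩ := hmem' _ x hx
        exact (mem_filter.1 hy).2
      · intro hx
        have hxn := (mem_Ico.1 (hπ.subset V hV hx)).2
        exact (hmem _ ⟨x, hxn⟩).2 (mem_filter.2 ⟨mem_univ _, hx⟩)
    set Q : Finset (Finset (Fin n)) := univ.filter fun V => e V ∈ π with hQ
    have hQmem : ∀ V, V ∈ Q ↔ e V ∈ π := fun V => by simp [hQ]
    have hQmap : Q.map e = π := by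
      ext V
      rw [mem_map]
      constructor
      · rintro ⟨V, hV, rfl⟩
        exact (hQmem V).1 hV
      · intro hV
        obtain ⟨V, rfl⟩ := hpre V hV
        exact ⟨V, (hQmem V).2 hV, rfl⟩
    have hunique : ∀ x ∈ (univ : Finset (Fin n)), ∃! V ∈ Q, x ∈ V := by
      intro x _
      obtain ⟨V, hV, hx⟩ := hπ.cover x (by simp)
      obtain ⟨V, rfl⟩ := hpre V hV
      refine ⟨V, ⟨(hQmem V).2 hV, (hmem V x).1 hx⟩, ?_⟩
      rintro W ⟨hW, hxW⟩
      exact e.injective (hπ.eq_of_mem _ ((hQmem W).1 hW) _ hV x ((hmem W x).2 hxW) hx)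
    have hempty : ∅ ∉ Q := fun h => hπ.empty_notMem (by
      have := (hQmem ∅).1 h
      simpa [he] using this)
    refine ⟨Finpartition.ofExistsUnique Q (fun _ _ => subset_univ _) hunique hempty, ?_, hQmap⟩
    rw [mem_filter]
    refine ⟨mem_univ _, ?_⟩
    intro a b c d hab hbc hcd V hV W hW ha hc hb hd
    exact e.injective (hπ.nonCrossing a b c d hab hbc hcd _ ((hQmem V).1 hV) _ ((hQmem W).1 hW)
      ((hmem V a).2 ha) ((hmem V c).2 hc) ((hmem W b).2 hb) ((hmem W d).2 hd))
  · intro π _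
    rw [prod_map]
    refine prod_congr rfl fun V _ => ?_
    simp [he]

/-- The recursion of the free cumulants of a moment sequence: the auxiliary `w s L` are the sums
over the non-crossing partitions of `L` points preceded by `s` points of one block. -/
theorem exists_freeCumulant_recursion (m : ℕ → ℂ) (hm : m 0 = 1) :
    ∃ w : ℕ → ℕ → ℂ, (∀ L, w 1 L = m (L + 1)) ∧ (∀ s, w s 0 = freeCumulant m s) ∧
      ∀ s L, w s (L + 1) = freeCumulant m s * m (L + 1) +
        ∑ q ∈ antidiagonal L, m q.1 * w (s + 1) q.2 := by
  have hM : ∀ n, ncSum (freeCumulant m) ∅ (Ico 0 n) = m n := by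
    intro n
    rcases Nat.eq_zero_or_pos n with rfl | hn
    · rw [hm, Ico_self, ncSum_empty]
    · rw [ncSum_eq_sum_finpartition, ← sum_nonCrossing_freeCumulant m n hn]
  refine ⟨fun s L => ncTail (freeCumulant m) s 0 L, fun L => ?_, fun s => ?_, fun s L => ?_⟩
  · exact (ncSum_range_succ _ L).symm.trans (hM _)
  · exact (ncTail_eq _ s 0 0).trans (by simp [ncSum_empty])
  · simp only [ncTail_recursion, hM]

end NonCrossing

end FreeDetEquiv

namespace FreeDetEquiv

/-! ### The functional equation of the R-transform -/

section Analysis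

open Finset Filter Topology

/-- Banach's fixed point theorem on a closed ball. It is applied to the scalar equation for the
R-transform and to the system for the tuple of the f_j. -/
theorem exists_fixedPoint_of_lipschitz {E : Type*} [NormedAddCommGroup E] [CompleteSpace E]
    (F : E → E) {K : ℝ} (hK : 0 ≤ K) (hF : ∀ x, ‖x‖ ≤ K → ‖F x‖ ≤ K)
    (hL : ∀ x y, ‖x‖ ≤ K → ‖y‖ ≤ K → ‖F x - F y‖ ≤ 1 / 2 * ‖x - y‖) :
    ∃ x, ‖x‖ ≤ K ∧ F x = x := by
  have hmaps : Set.MapsTo F (Metric.closedBall 0 K) (Metric.closedBall 0 K) := by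
    intro x hx
    rw [mem_closedBall_zero_iff] at hx ⊢
    exact hF x hx
  have hcon : ContractingWith (1 / 2) (hmaps.restrict F _ _) := by
    refine ⟨by norm_num, LipschitzWith.of_dist_le_mul ?_⟩
    rintro ⟨x, hx⟩ ⟨y, hy⟩
    rw [mem_closedBall_zero_iff] at hx hy
    simpa [Subtype.dist_eq, dist_eq_norm] using hL x y hx hy
  obtain ⟨x, hx, hfix, _⟩ := hcon.exists_fixedPoint' Metric.isClosed_closedBall.isComplete hmaps
    (Metric.mem_closedBall_self hK) (edist_ne_top _ _)
  exact ⟨x, mem_closedBall_zero_iff.1 hx, hfix⟩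

/-- After division by (3c)^(L+1) this is a partial sum of 1/3 + 1/9 + … = 1/2. The ratio 3 is chosen
to produce the factor 1/2. -/
theorem sum_antidiagonal_geometric_le {c : ℝ} (hc : 0 ≤ c) (L : ℕ) :
    ∑ q ∈ antidiagonal L, c ^ (q.1 + 1) * (3 * c) ^ q.2 ≤ (3 * c) ^ (L + 1) / 2 := by
  induction L with
  | zero => simp; linarith
  | succ L ih =>
    rw [Nat.sum_antidiagonal_succ]
    have : ∑ q ∈ antidiagonal L, c ^ (q.1 + 1 + 1) * (3 * c) ^ q.2
        = c * ∑ q ∈ antidiagonal L, c ^ (q.1 + 1) * (3 * c) ^ q.2 := by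
      rw [mul_sum]
      exact sum_congr rfl fun q _ => by ring
    rw [this]
    have h1 := mul_le_mul_of_nonneg_left ih hc
    have h2 : (3 * c) ^ (L + 1 + 1) = 3 * (c * (3 * c) ^ (L + 1)) := by ring
    rw [h2]
    simp only [zero_add, pow_one]
    linarith

variable {m : ℕ → ℂ} {w : ℕ → ℕ → ℂ} {κ : ℕ → ℂ} {c : ℝ}

/-- Since m 0 = 1, the recursion can be solved for the row s + 1 in terms of the row s. The known
terms use up half of the claimed bound and the rest of the convolution the other half. Each row
costs a factor 4 · 3c = 12c. At L = 0 this bounds the cumulants. -/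
theorem norm_recursion_le (hc : 0 < c) (hm0 : m 0 = 1) (hmc : ∀ i, ‖m i‖ ≤ c ^ i)
    (hw1 : ∀ L, w 1 L = m (L + 1)) (hw0 : ∀ s, w s 0 = κ s)
    (hw : ∀ s L, w s (L + 1) = κ s * m (L + 1) + ∑ q ∈ antidiagonal L, m q.1 * w (s + 1) q.2)
    (s L : ℕ) : ‖w (s + 1) L‖ ≤ c * (12 * c) ^ s * (3 * c) ^ L := by
  induction s generalizing L with
  | zero =>
    rw [hw1]
    refine (hmc _).trans ?_
    rw [pow_zero, mul_one, pow_succ']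
    gcongr
    linarith
  | succ s ih =>
    set K := c * (12 * c) ^ s with hK
    have hK0 : 0 < K := by positivity
    have hfirst : ∀ L, ‖w (s + 1) (L + 1) - κ (s + 1) * m (L + 1)‖ ≤ 2 * K * (3 * c) ^ (L + 1) := by
      intro L
      refine (norm_sub_le _ _).trans ?_
      have h1 := ih (L + 1)
      -- The value at L = 0 is the cumulant, so the induction hypothesis bounds it as well.
      have h2 := ih 0
      rw [hw0, pow_zero, mul_one] at h2
      have h3 : ‖κ (s + 1) * m (L + 1)‖ ≤ K * (3 * c) ^ (L + 1) := by
        rw [norm_mul]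
        gcongr
        refine (hmc _).trans ?_
        gcongr
        linarith
      linarith
    have hgoal : c * (12 * c) ^ (s + 1) = 4 * (3 * c) * K := by rw [hK]; ring
    rw [hgoal]
    induction L using Nat.strong_induction_on with
    | _ L ihL =>
      rcases L with _ | L
      · have h := hw (s + 1) 0
        simp only [Nat.antidiagonal_zero, sum_singleton, hm0, one_mul] at h
        have h' : w (s + 1 + 1) 0 = w (s + 1) (0 + 1) - κ (s + 1) * m (0 + 1) := by
          rw [h]; ring
        rw [h']
        refine (hfirst 0).trans ?_
        simp only [zero_add, pow_one, pow_zero, mul_one]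
        nlinarith [mul_pos hK0 hc]
      · have h := hw (s + 1) (L + 1)
        rw [Nat.sum_antidiagonal_succ] at h
        simp only [hm0, one_mul] at h
        -- The term with q.1 = 0 of the convolution is the unknown itself. The remaining terms
        -- involve the same row at smaller arguments only.
        have h' : w (s + 1 + 1) (L + 1) = (w (s + 1) (L + 1 + 1) - κ (s + 1) * m (L + 1 + 1)) -
            ∑ q ∈ antidiagonal L, m (q.1 + 1) * w (s + 1 + 1) q.2 := by
          rw [h]; ring
        rw [h']
        refine (norm_sub_le _ _).trans ?_
        have hs : ‖∑ q ∈ antidiagonal L, m (q.1 + 1) * w (s + 1 + 1) q.2‖ ≤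
            4 * (3 * c) * K * ((3 * c) ^ (L + 1) / 2) := by
          refine (norm_sum_le _ _).trans ?_
          refine le_trans ?_ (mul_le_mul_of_nonneg_left (sum_antidiagonal_geometric_le hc.le L)
            (by positivity))
          rw [mul_sum]
          refine sum_le_sum fun q hq => ?_
          rw [HasAntidiagonal.mem_antidiagonal] at hq
          have h1 := ihL q.2 (by omega)
          rw [norm_mul]
          calc ‖m (q.1 + 1)‖ * ‖w (s + 1 + 1) q.2‖
              ≤ c ^ (q.1 + 1) * (4 * (3 * c) * K * (3 * c) ^ q.2) := by
                gcongr
                exact hmc _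
            _ = _ := by ring
        have h1 := hfirst (L + 1)
        have h2 : 2 * K * (3 * c) ^ (L + 1 + 1) = 2 * (3 * c) * K * (3 * c) ^ (L + 1) := by ring
        linarith

theorem summable_of_norm_le_geometric {a : ℕ → ℂ} {z : ℂ} {C D : ℝ} (hD : 0 ≤ D)
    (ha : ∀ L, ‖a L‖ ≤ C * D ^ L) (hz : ‖z‖ * D ≤ 1 / 2) :
    Summable (fun L => ‖a L * z ^ L‖) ∧ ‖∑' L, a L * z ^ L‖ ≤ 2 * C := by
  have hb : ∀ L, ‖a L * z ^ L‖ ≤ C * (1 / 2) ^ L := by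
    intro L
    have hC : 0 ≤ C := by simpa using (norm_nonneg _).trans (ha 0)
    rw [norm_mul, norm_pow]
    calc ‖a L‖ * ‖z‖ ^ L ≤ C * D ^ L * ‖z‖ ^ L := by gcongr; exact ha L
      _ = C * (‖z‖ * D) ^ L := by rw [mul_pow]; ring
      _ ≤ _ := by gcongr
  have hg : HasSum (fun L : ℕ => C * (1 / 2 : ℝ) ^ L) (C * 2) :=
    hasSum_geometric_two.mul_left C
  refine ⟨Summable.of_nonneg_of_le (fun _ => norm_nonneg _) hb hg.summable, ?_⟩
  have := tsum_of_norm_bounded hg hb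
  linarith

/-- With W_s the generating function of the row s + 1, the recursion reads W_s = κ_{s+1} M + f
W_{s+1}, because f = z M. Iterating from M = 1 + z W_0 produces the partial sums of f R(f) and a
remainder z f^S W_S, which tends to zero by the bound on the rows. -/
theorem momentSeries_eq (hc : 0 < c) (hm0 : m 0 = 1) (hmc : ∀ i, ‖m i‖ ≤ c ^ i)
    (hw1 : ∀ L, w 1 L = m (L + 1)) (hw0 : ∀ s, w s 0 = κ s)
    (hw : ∀ s L, w s (L + 1) = κ s * m (L + 1) + ∑ q ∈ antidiagonal L, m q.1 * w (s + 1) q.2)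
    {f z : ℂ} (hf : ‖f‖ * (12 * c) < 1) (hz : ‖z‖ * (3 * c) ≤ 1 / 2)
    (hfz : z * ∑' i, m i * z ^ i = f) :
    Summable (fun i => κ (i + 1) * f ^ i) ∧
      ∑' i, m i * z ^ i = 1 + f * ∑' i, κ (i + 1) * f ^ i := by
  have hb := norm_recursion_le hc hm0 hmc hw1 hw0 hw
  have hr : Summable fun i : ℕ => c * (‖f‖ * (12 * c)) ^ i :=
    (summable_geometric_of_lt_one (by positivity) hf).mul_left c
  have hκ : Summable (fun i => κ (i + 1) * f ^ i) := by
    refine Summable.of_norm_bounded hr fun i => ?_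
    have := hb i 0
    rw [hw0, pow_zero, mul_one] at this
    rw [norm_mul, norm_pow, mul_pow]
    calc ‖κ (i + 1)‖ * ‖f‖ ^ i ≤ c * (12 * c) ^ i * ‖f‖ ^ i := by gcongr
      _ = _ := by ring
  refine ⟨hκ, ?_⟩
  have hms := summable_of_norm_le_geometric (a := m) (C := 1) (D := 3 * c) (by positivity)
    (fun L => by
      rw [one_mul]
      exact (hmc L).trans (pow_le_pow_left₀ hc.le (by linarith) L)) hz
  have hws : ∀ s, _ := fun s =>
    summable_of_norm_le_geometric (a := w (s + 1)) (D := 3 * c) (by positivity) (hb s) hz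
  set M := ∑' i, m i * z ^ i with hM
  set W : ℕ → ℂ := fun s => ∑' L, w (s + 1) L * z ^ L with hW
  have hM1 : M = 1 + z * W 0 := by
    rw [hM, hms.1.of_norm.tsum_eq_zero_add, hm0, pow_zero, mul_one, hW, ← tsum_mul_left]
    congr 1
    refine tsum_congr fun L => ?_
    rw [zero_add, hw1, pow_succ]; ring
  have hWs : ∀ s, W s = κ (s + 1) * M + f * W (s + 1) := by
    intro s
    have h1 : W s = κ (s + 1) + ∑' L, w (s + 1) (L + 1) * z ^ (L + 1) := by
      simp only [hW]
      rw [(hws s).1.of_norm.tsum_eq_zero_add, hw0, pow_zero, mul_one]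
    have h2 : ∀ L, w (s + 1) (L + 1) * z ^ (L + 1) = κ (s + 1) * (m (L + 1) * z ^ (L + 1)) +
        z * ∑ q ∈ antidiagonal L, (m q.1 * z ^ q.1) * (w (s + 1 + 1) q.2 * z ^ q.2) := by
      intro L
      rw [hw, add_mul, mul_sum, sum_mul, mul_assoc]
      congr 1
      refine sum_congr rfl fun q hq => ?_
      rw [HasAntidiagonal.mem_antidiagonal] at hq
      rw [← hq, pow_succ, pow_add]; ring
    have h3 : Summable fun L => κ (s + 1) * (m (L + 1) * z ^ (L + 1)) :=
      ((summable_nat_add_iff 1).2 hms.1.of_norm).mul_left _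
    have h4 : Summable fun L => z * ∑ q ∈ antidiagonal L,
        (m q.1 * z ^ q.1) * (w (s + 1 + 1) q.2 * z ^ q.2) :=
      (summable_norm_sum_mul_antidiagonal_of_summable_norm hms.1 (hws (s + 1)).1).of_norm.mul_left _
    have h5 : M * W (s + 1) = ∑' L, ∑ q ∈ antidiagonal L,
        (m q.1 * z ^ q.1) * (w (s + 1 + 1) q.2 * z ^ q.2) :=
      tsum_mul_tsum_eq_tsum_sum_antidiagonal_of_summable_norm hms.1 (hws (s + 1)).1
    have h6 : M = 1 + ∑' L, m (L + 1) * z ^ (L + 1) := by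
      rw [hM, hms.1.of_norm.tsum_eq_zero_add, hm0, pow_zero, mul_one]
    rw [h1, tsum_congr h2, h3.tsum_add h4, tsum_mul_left, tsum_mul_left, ← h5, ← hfz]
    linear_combination (-κ (s + 1)) * h6
  -- Each step turns z f^S κ_{S+1} M into κ_{S+1} f^{S+1}, again by z M = f.
  have hpart : ∀ S, M - 1 = f * ∑ i ∈ range S, κ (i + 1) * f ^ i + z * f ^ S * W S := by
    intro S
    induction S with
    | zero => rw [hM1]; simp
    | succ S ih =>
      rw [ih, hWs S, sum_range_succ]
      linear_combination (κ (S + 1) * f ^ S) * hfz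
  have hlim : Tendsto (fun S => f * ∑ i ∈ range S, κ (i + 1) * f ^ i + z * f ^ S * W S) atTop
      (𝓝 (f * ∑' i, κ (i + 1) * f ^ i + 0)) := by
    refine (hκ.hasSum.tendsto_sum_nat.const_mul f).add ?_
    refine squeeze_zero_norm (a := fun S => ‖z‖ * 2 * (c * (‖f‖ * (12 * c)) ^ S)) (fun S => ?_) ?_
    · rw [norm_mul, norm_mul, norm_pow]
      calc ‖z‖ * ‖f‖ ^ S * ‖W S‖ ≤ ‖z‖ * ‖f‖ ^ S * (2 * (c * (12 * c) ^ S)) := by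
            gcongr
            exact (hws S).2
        _ = _ := by rw [mul_pow]; ring
    · simpa using hr.tendsto_atTop_zero.const_mul (‖z‖ * 2)
  have := tendsto_nhds_unique (tendsto_const_nhds.congr hpart) hlim
  rw [add_zero] at this
  linear_combination this

end Analysis

/-! ### The R-transform as the solution of a fixed-point equation in a Banach algebra -/

section BanachAlgebra

variable {B : Type*} [NormedRing B] [NormedAlgebra ℂ B] [CompleteSpace B]

-- The bound is ‖1‖ + 1 rather than 2 because the unit is not assumed to have norm one.
omit [NormedAlgebra ℂ B] in
theorem isUnit_one_sub_of_norm_le_half {x : B} (hx : ‖x‖ ≤ 1 / 2) :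
    IsUnit (1 - x) ∧ ‖Ring.inverse (1 - x)‖ ≤ ‖(1 : B)‖ + 1 := by
  have hx1 : ‖x‖ < 1 := by linarith
  refine ⟨(Units.oneSub x hx1).isUnit, ?_⟩
  rw [NormedRing.inverse_one_sub x hx1]
  refine (tsum_geometric_le_of_norm_lt_one x hx1).trans ?_
  have : (1 - ‖x‖)⁻¹ ≤ 2 := inv_le_of_inv_le₀ (by norm_num) (by linarith)
  linarith

/-- The element `(1 + f r) 1 - f T`. -/
def cumulantPencil (T : B) (f r : ℂ) : B := (1 + f * r) • (1 : B) - f • T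

omit [NormedAlgebra ℂ B] [CompleteSpace B] in
theorem norm_inverse_sub_inverse_le {x y : B} (hx : IsUnit x) (hy : IsUnit y) :
    ‖Ring.inverse x - Ring.inverse y‖ ≤ ‖Ring.inverse x‖ * ‖y - x‖ * ‖Ring.inverse y‖ := by
  have : Ring.inverse x - Ring.inverse y = Ring.inverse x * (y - x) * Ring.inverse y := by
    rw [mul_sub, sub_mul, mul_assoc, Ring.mul_inverse_cancel _ hy, Ring.inverse_mul_cancel _ hx,
      mul_one, one_mul]
  rw [this]
  exact norm_mul₃_le

/-- Uniform estimates for the map `r ↦ φ(T ((1 + f r) - f T)⁻¹)`. -/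
theorem cumulantPencil_estimates (φ : B →L[ℂ] ℂ) (T : B) {K : ℝ} (hK : 0 ≤ K) :
    ∃ δ > (0 : ℝ), ∃ L ≥ (0 : ℝ), ∀ f r : ℂ, ‖f‖ < δ → ‖r‖ ≤ K →
      IsUnit (cumulantPencil T f r) ∧ ‖f * r‖ ≤ 1 / 2 ∧
      ‖φ (T * Ring.inverse (cumulantPencil T f r))‖ ≤ ‖φ‖ * ‖T‖ * (‖(1 : B)‖ + 1) ∧
      ∀ f' r' : ℂ, ‖f'‖ < δ → ‖r'‖ ≤ K →
        ‖φ (T * Ring.inverse (cumulantPencil T f r)) -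
          φ (T * Ring.inverse (cumulantPencil T f' r'))‖ ≤ 1 / 2 * ‖r - r'‖ + L * ‖f - f'‖ := by
  set E := ‖(1 : B)‖ + 1 with hE
  have hE1 : 1 ≤ E := by rw [hE]; linarith [norm_nonneg (1 : B)]
  set C := ‖φ‖ * ‖T‖ * E ^ 2 with hC
  have hC0 : 0 ≤ C := by positivity
  set Q := ‖T‖ + K * E + 1 with hQ
  have hQ0 : 0 < Q := by positivity
  -- The first bound keeps the pencil within 1/2 of the identity, so that the Neumann series
  -- applies. The second makes the Lipschitz constant in r at most 1/2.
  set δ := min (1 / (2 * Q * E)) (1 / (2 * (C * E + 1))) with hδ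
  have hδ1 : δ * (2 * Q * E) ≤ 1 := by
    have : δ ≤ 1 / (2 * Q * E) := min_le_left _ _
    rwa [le_div_iff₀ (by positivity)] at this
  have hδ2 : δ * (2 * (C * E + 1)) ≤ 1 := by
    have : δ ≤ 1 / (2 * (C * E + 1)) := min_le_right _ _
    rwa [le_div_iff₀ (by positivity)] at this
  have hδ0 : 0 < δ := lt_min (by positivity) (by positivity)
  have hpen : ∀ f r : ℂ, ‖f‖ < δ → ‖r‖ ≤ K → IsUnit (cumulantPencil T f r) ∧ ‖f * r‖ ≤ 1 / 2 ∧
      ‖Ring.inverse (cumulantPencil T f r)‖ ≤ E := by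
    intro f r hf hr
    have hrw : cumulantPencil T f r = 1 - (f • T - (f * r) • (1 : B)) := by
      rw [cumulantPencil, add_smul, one_smul]; abel
    have hfQ : ‖f‖ * Q ≤ 1 / 2 := by
      have h1 : ‖f‖ * Q ≤ δ * Q := by gcongr
      have h2 : δ * Q ≤ δ * Q * E := le_mul_of_one_le_right (by positivity) hE1
      linarith
    have hn : ‖f • T - (f * r) • (1 : B)‖ ≤ 1 / 2 := by
      refine (norm_sub_le _ _).trans ?_
      rw [norm_smul, norm_smul, norm_mul]
      have h1 : ‖f‖ * ‖r‖ * ‖(1 : B)‖ ≤ ‖f‖ * (K * E) := by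
        rw [mul_assoc]
        gcongr
        rw [hE]; linarith
      have h2 : ‖f‖ * ‖T‖ + ‖f‖ * (K * E) ≤ ‖f‖ * Q := by
        rw [hQ]; nlinarith [norm_nonneg f]
      linarith
    rw [hrw]
    refine ⟨(isUnit_one_sub_of_norm_le_half hn).1, ?_, (isUnit_one_sub_of_norm_le_half hn).2⟩
    rw [norm_mul]
    refine le_trans ?_ hfQ
    gcongr
    refine hr.trans ?_
    have : K ≤ K * E := le_mul_of_one_le_right hK hE1
    rw [hQ]; linarith [norm_nonneg T]
  refine ⟨δ, hδ0, C * Q, by positivity, fun f r hf hr => ?_⟩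
  obtain ⟨h1, h2, h3⟩ := hpen f r hf hr
  refine ⟨h1, h2, ?_, fun f' r' hf' hr' => ?_⟩
  · refine (φ.le_opNorm _).trans ?_
    rw [mul_assoc]
    gcongr
    exact (norm_mul_le _ _).trans (by gcongr)
  · obtain ⟨h1', h2', h3'⟩ := hpen f' r' hf' hr'
    rw [← map_sub, ← mul_sub]
    -- The variable r enters the pencil only through f r, so the dependence on r carries a small
    -- factor f'.
    have hdiff : ‖cumulantPencil T f' r' - cumulantPencil T f r‖ ≤
        ‖f'‖ * E * ‖r - r'‖ + Q * ‖f - f'‖ := by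
      have : cumulantPencil T f' r' - cumulantPencil T f r =
          (f - f') • T - ((f - f') * r + f' * (r - r')) • (1 : B) := by
        simp only [cumulantPencil]
        module
      rw [this]
      refine (norm_sub_le _ _).trans ?_
      rw [norm_smul, norm_smul]
      have h4 : ‖(f - f') * r + f' * (r - r')‖ ≤ ‖f - f'‖ * K + ‖f'‖ * ‖r - r'‖ := by
        refine (norm_add_le _ _).trans ?_
        rw [norm_mul, norm_mul]
        gcongr
      have h5 : ‖(f - f') * r + f' * (r - r')‖ * ‖(1 : B)‖ ≤
          (‖f - f'‖ * K + ‖f'‖ * ‖r - r'‖) * E := by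
        gcongr
        rw [hE]; linarith
      rw [hQ]
      nlinarith [norm_nonneg (f - f')]
    have h6 : ‖Ring.inverse (cumulantPencil T f r) - Ring.inverse (cumulantPencil T f' r')‖ ≤
        E * (‖f'‖ * E * ‖r - r'‖ + Q * ‖f - f'‖) * E :=
      (norm_inverse_sub_inverse_le h1 h1').trans (by gcongr)
    calc _ ≤ ‖φ‖ * (‖T‖ * (E * (‖f'‖ * E * ‖r - r'‖ + Q * ‖f - f'‖) * E)) :=
          (φ.le_opNorm _).trans (by gcongr; exact (norm_mul_le _ _).trans (by gcongr))
      _ = (C * E * ‖f'‖) * ‖r - r'‖ + C * Q * ‖f - f'‖ := by rw [hC]; ring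
      _ ≤ _ := by
        gcongr
        have : C * E * ‖f'‖ ≤ C * E * δ := by gcongr
        nlinarith

/-- The R-transform series of `T` with respect to `φ`. -/
noncomputable def rSeries (φ : B →L[ℂ] ℂ) (T : B) (f : ℂ) : ℂ :=
  ∑' i : ℕ, freeCumulant (fun j => φ (T ^ j)) (i + 1) * f ^ i

-- Applying φ to pencil · X = 1 gives (1 + f r) φ(X) - f r = 1, that is (1 + f r)(φ(X) - 1) = 0.
omit [CompleteSpace B] in
theorem functional_inverse_cumulantPencil {φ : B →L[ℂ] ℂ} (hφ : φ 1 = 1) {T : B} {f r : ℂ}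
    (hu : IsUnit (cumulantPencil T f r)) (hfr : 1 + f * r ≠ 0)
    (hr : φ (T * Ring.inverse (cumulantPencil T f r)) = r) :
    φ (Ring.inverse (cumulantPencil T f r)) = 1 := by
  have h := Ring.mul_inverse_cancel _ hu
  set X := Ring.inverse (cumulantPencil T f r) with hX
  rw [cumulantPencil, sub_mul, smul_mul_assoc, smul_mul_assoc, one_mul] at h
  have h' := congrArg φ h
  rw [map_sub, map_smul, map_smul, hr, hφ, smul_eq_mul, smul_eq_mul] at h'
  have : (1 + f * r) * (φ X - 1) = 0 := by linear_combination h'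
  exact sub_eq_zero.1 ((mul_eq_zero.1 this).resolve_left hfr)

/-- A solution `r` of `r = φ(T ((1 + f r) - f T)⁻¹)` is the value of the R-transform at `f`. -/
theorem exists_rSeries_eq_of_fixed {φ : B →L[ℂ] ℂ} (hφ : φ 1 = 1) (T : B) :
    ∃ δ > (0 : ℝ), ∀ f r : ℂ, ‖f‖ < δ → ‖f * r‖ ≤ 1 / 2 → IsUnit (cumulantPencil T f r) →
      φ (T * Ring.inverse (cumulantPencil T f r)) = r →
      (Summable fun i : ℕ => freeCumulant (fun j => φ (T ^ j)) (i + 1) * f ^ i) ∧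
        r = rSeries φ T f := by
  set m : ℕ → ℂ := fun j => φ (T ^ j) with hm
  have hm0 : m 0 = 1 := by simp [hm, hφ]
  obtain ⟨w, hw1, hw0, hw⟩ := exists_freeCumulant_recursion m hm0
  -- The added ones ensure c ≥ 1, so that ‖φ‖ ‖T‖^j ≤ c^j for j ≥ 1.
  set c : ℝ := (‖φ‖ + 1) * (‖T‖ + 1) with hc
  have hc1 : 1 ≤ c := by
    rw [hc]; nlinarith [norm_nonneg φ, norm_nonneg T, mul_nonneg (norm_nonneg φ) (norm_nonneg T)]
  have hTc : ‖T‖ ≤ c := by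
    rw [hc]; nlinarith [norm_nonneg φ, norm_nonneg T, mul_nonneg (norm_nonneg φ) (norm_nonneg T)]
  have hc0 : 0 < c := by linarith
  have hmc : ∀ i, ‖m i‖ ≤ c ^ i := by
    intro i
    rcases i with _ | i
    · simp [hm0]
    · refine (φ.le_opNorm _).trans ?_
      calc ‖φ‖ * ‖T ^ (i + 1)‖ ≤ (‖φ‖ + 1) ^ (i + 1) * (‖T‖ + 1) ^ (i + 1) := by
            gcongr
            · refine le_trans (by linarith) (le_self_pow₀ (by linarith [norm_nonneg φ]) (by omega))
            · refine (norm_pow_le' T (by omega)).trans ?_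
              gcongr
              linarith
        _ = _ := by rw [hc, mul_pow]
  -- The number 13 serves two conditions: 12c ‖f‖ < 1, and 3c ‖z‖ ≤ 6c ‖f‖ ≤ 1/2 for the z below.
  refine ⟨1 / (13 * c), by positivity, fun f r hf hfr hu hr => ?_⟩
  rw [lt_div_iff₀ (by positivity)] at hf
  have hne : 1 + f * r ≠ 0 := by
    intro h
    have : f * r = -1 := by linear_combination h
    rw [this] at hfr
    norm_num at hfr
  have hge : 1 / 2 ≤ ‖1 + f * r‖ := by
    have := norm_sub_le_norm_add (1 : ℂ) (f * r)
    rw [norm_one] at this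
    linarith
  -- The pencil is (1 + f r)(1 - z T), so φ(X) = 1 says that the moment series at z equals 1 + f r,
  -- and hence z M(z) = f.
  set z : ℂ := f / (1 + f * r) with hz
  have hzn : ‖z‖ ≤ 2 * ‖f‖ := by
    rw [hz, norm_div, div_le_iff₀ (by linarith)]
    nlinarith [norm_nonneg f]
  have hzc : ‖z‖ * (3 * c) ≤ 1 / 2 := by nlinarith [norm_nonneg f]
  have hzT : ‖z • T‖ < 1 := by
    rw [norm_smul]
    have : ‖z‖ * ‖T‖ ≤ ‖z‖ * c := by gcongr
    nlinarith [norm_nonneg z]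
  have hsum : HasSum (fun i => m i * z ^ i) (φ (Ring.inverse (1 - z • T))) := by
    have h1 : HasSum (fun i : ℕ => (z • T) ^ i) (Ring.inverse (1 - z • T)) := by
      rw [NormedRing.inverse_one_sub _ hzT]
      exact (summable_geometric_of_norm_lt_one hzT).hasSum
    have h2 := φ.hasSum h1
    refine h2.congr_fun ?_ |> fun h => h
    intro i
    simp [hm, smul_pow, mul_comm]
  have hpen : cumulantPencil T f r = (1 + f * r) • (1 - z • T) := by
    rw [cumulantPencil, smul_sub, smul_smul, hz, mul_div_cancel₀ _ hne]
  have hinv : Ring.inverse (1 - z • T) = (1 + f * r) • Ring.inverse (cumulantPencil T f r) := by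
    have hu' : IsUnit (1 - z • T) := (Units.oneSub _ hzT).isUnit
    have h3 : (1 - z • T) * ((1 + f * r) • Ring.inverse (cumulantPencil T f r)) = 1 := by
      rw [mul_smul_comm, ← smul_mul_assoc, ← hpen, Ring.mul_inverse_cancel _ hu]
    calc Ring.inverse (1 - z • T) = Ring.inverse (1 - z • T) *
          ((1 - z • T) * ((1 + f * r) • Ring.inverse (cumulantPencil T f r))) := by rw [h3, mul_one]
      _ = _ := by rw [← mul_assoc, Ring.inverse_mul_cancel _ hu', one_mul]
  have hMz : ∑' i, m i * z ^ i = 1 + f * r := by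
    rw [hsum.tsum_eq, hinv, map_smul, functional_inverse_cumulantPencil hφ hu hne hr, smul_eq_mul,
      mul_one]
  have hzM : z * ∑' i, m i * z ^ i = f := by rw [hMz, hz, div_mul_cancel₀ _ hne]
  obtain ⟨hκ, hM⟩ := momentSeries_eq hc0 hm0 hmc hw1 hw0 hw (by nlinarith [norm_nonneg f]) hzc hzM
  refine ⟨hκ, ?_⟩
  rw [hMz] at hM
  -- At f = 0 the identity f r = f R(f) carries no information. There the pencil is 1, and both
  -- sides are the first moment.
  by_cases hf0 : f = 0
  · have h1 : r = m 1 := by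
      rw [← hr, hf0]
      simp [cumulantPencil, hm]
    rw [rSeries, hf0, tsum_eq_single 0 (fun i hi => by simp [hi])]
    rw [pow_zero, mul_one, ← hw0, hw1, h1]
  · exact mul_left_cancel₀ hf0 (by rw [rSeries]; linear_combination hM)

/-- The R-transform near zero: convergence, the functional equation, a Lipschitz bound. -/
theorem rSeries_spec {φ : B →L[ℂ] ℂ} (hφ : φ 1 = 1) (T : B) :
    ∃ K ≥ (0 : ℝ), ∃ δ > (0 : ℝ), ∃ L ≥ (0 : ℝ), ∀ f : ℂ, ‖f‖ < δ →
      (Summable fun i : ℕ => freeCumulant (fun j => φ (T ^ j)) (i + 1) * f ^ i) ∧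
      ‖rSeries φ T f‖ ≤ K ∧ IsUnit (cumulantPencil T f (rSeries φ T f)) ∧
      ‖f * rSeries φ T f‖ ≤ 1 / 2 ∧
      φ (T * Ring.inverse (cumulantPencil T f (rSeries φ T f))) = rSeries φ T f ∧
      ∀ f' : ℂ, ‖f'‖ < δ → ‖rSeries φ T f - rSeries φ T f'‖ ≤ L * ‖f - f'‖ := by
  set K := ‖φ‖ * ‖T‖ * (‖(1 : B)‖ + 1) with hK
  have hK0 : 0 ≤ K := by positivity
  obtain ⟨δ₁, hδ₁, L, hL, h₁⟩ := cumulantPencil_estimates φ T hK0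
  obtain ⟨δ₂, hδ₂, h₂⟩ := exists_rSeries_eq_of_fixed hφ T
  have main : ∀ f : ℂ, ‖f‖ < min δ₁ δ₂ →
      (Summable fun i : ℕ => freeCumulant (fun j => φ (T ^ j)) (i + 1) * f ^ i) ∧
      ‖rSeries φ T f‖ ≤ K ∧ IsUnit (cumulantPencil T f (rSeries φ T f)) ∧
      ‖f * rSeries φ T f‖ ≤ 1 / 2 ∧
      φ (T * Ring.inverse (cumulantPencil T f (rSeries φ T f))) = rSeries φ T f := by
    intro f hf
    have hf1 := hf.trans_le (min_le_left _ _)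
    have hf2 := hf.trans_le (min_le_right _ _)
    obtain ⟨r, hr, hfix⟩ := exists_fixedPoint_of_lipschitz
      (fun r => φ (T * Ring.inverse (cumulantPencil T f r))) hK0
      (fun r hr => (h₁ f r hf1 hr).2.2.1)
      (fun r r' hr hr' => by simpa using (h₁ f r hf1 hr).2.2.2 f r' hf1 hr')
    obtain ⟨hu, hfr, -, -⟩ := h₁ f r hf1 hr
    obtain ⟨hs, hrR⟩ := h₂ f r hf2 hfr hu hfix
    rw [← hrR]
    exact ⟨hs, hr, hu, hfr, hfix⟩
  -- The estimate has ‖R(f) - R(f')‖ on both sides, with factor 1/2 on the right. Absorbing it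
  -- doubles L.
  refine ⟨K, hK0, min δ₁ δ₂, lt_min hδ₁ hδ₂, 2 * L, by positivity, fun f hf => ?_⟩
  obtain ⟨a1, a2, a3, a4, a5⟩ := main f hf
  refine ⟨a1, a2, a3, a4, a5, fun f' hf' => ?_⟩
  obtain ⟨b1, b2, b3, b4, b5⟩ := main f' hf'
  have := (h₁ f _ (hf.trans_le (min_le_left _ _)) a2).2.2.2 f' _
    (hf'.trans_le (min_le_left _ _)) b2
  rw [a5, b5] at this
  linarith

/-- For bounded `r` and small `f`, the functional equation characterizes the R-transform. -/
theorem eq_rSeries_iff {φ : B →L[ℂ] ℂ} (hφ : φ 1 = 1) (T : B) (K : ℝ) :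
    ∃ δ > (0 : ℝ), ∀ f r : ℂ, ‖f‖ < δ → ‖r‖ < K → IsUnit (cumulantPencil T f r) ∧
      (r = φ (T * Ring.inverse (cumulantPencil T f r)) ↔ r = rSeries φ T f) := by
  obtain ⟨K₀, hK₀, δ₀, hδ₀, _, _, h₀⟩ := rSeries_spec hφ T
  obtain ⟨δ₁, hδ₁, L, hL, h₁⟩ := cumulantPencil_estimates φ T (le_max_of_le_left hK₀ : 0 ≤ max K₀ K)
  obtain ⟨δ₂, hδ₂, h₂⟩ := exists_rSeries_eq_of_fixed hφ T
  refine ⟨min δ₀ (min δ₁ δ₂), by positivity, fun f r hf hr => ?_⟩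
  rw [lt_min_iff, lt_min_iff] at hf
  obtain ⟨hu, hfr, -, -⟩ := h₁ f r hf.2.1 (hr.le.trans (le_max_right _ _))
  refine ⟨hu, fun h => (h₂ f r hf.2.2 hfr hu h.symm).2, fun h => ?_⟩
  rw [h]
  exact (h₀ f hf.1).2.2.2.2.1.symm

end BanachAlgebra

end FreeDetEquiv

namespace FreeDetEquiv

/-! ### The matrix equations -/

section MatrixEquations

open Matrix Filter Topology

attribute [local instance] Matrix.linftyOpNormedRing Matrix.linftyOpNormedAlgebra

/-- The topology of the operator norm on matrices. -/
@[reducible] noncomputable def matrixTopology (n : ℕ) :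
    TopologicalSpace (Matrix (Fin n) (Fin n) ℂ) :=
  (Matrix.linftyOpNormedRing :
    NormedRing (Matrix (Fin n) (Fin n) ℂ)).toMetricSpace.toPseudoMetricSpace.toUniformSpace.toTopologicalSpace

attribute [local instance] matrixTopology

theorem exists_pos_forall_le {ι : Type*} [Finite ι] {δ : ι → ℝ} (h : ∀ i, 0 < δ i) :
    ∃ ε > (0 : ℝ), ∀ i, ε ≤ δ i := by
  have h1 : ∀ᶠ ε : ℝ in 𝓝[>] 0, ∀ i, ε ≤ δ i := by
    rw [eventually_all]
    exact fun i => eventually_nhdsWithin_of_eventually_nhds (eventually_le_nhds (h i))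
  obtain ⟨ε, h2, h3⟩ := (h1.and self_mem_nhdsWithin).exists
  exact ⟨ε, h3, h2⟩

theorem isUnit_smul_one_sub {B : Type*} [NormedRing B] [NormedAlgebra ℂ B] [CompleteSpace B]
    {z : ℂ} {X : B} (hz : z ≠ 0) (h : 2 * ‖X‖ ≤ ‖z‖) :
    IsUnit (z • (1 : B) - X) ∧ ‖Ring.inverse (z • (1 : B) - X)‖ ≤ (‖(1 : B)‖ + 1) / ‖z‖ := by
  have hz0 : 0 < ‖z‖ := norm_pos_iff.2 hz
  have hn : ‖z⁻¹ • X‖ ≤ 1 / 2 := by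
    rw [norm_smul, norm_inv, inv_mul_le_iff₀ hz0]
    linarith
  obtain ⟨hu, hb⟩ := isUnit_one_sub_of_norm_le_half hn
  have hrw : z • (1 : B) - X = z • (1 - z⁻¹ • X) := by
    rw [smul_sub, smul_smul, mul_inv_cancel₀ hz, one_smul]
  have hr : (z • (1 : B) - X) * (z⁻¹ • Ring.inverse (1 - z⁻¹ • X)) = 1 := by
    rw [hrw, smul_mul_smul_comm, mul_inv_cancel₀ hz, one_smul, Ring.mul_inverse_cancel _ hu]
  have hl : (z⁻¹ • Ring.inverse (1 - z⁻¹ • X)) * (z • (1 : B) - X) = 1 := by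
    rw [hrw, smul_mul_smul_comm, inv_mul_cancel₀ hz, one_smul, Ring.inverse_mul_cancel _ hu]
  have hinv : Ring.inverse (z • (1 : B) - X) = z⁻¹ • Ring.inverse (1 - z⁻¹ • X) :=
    Ring.inverse_unit (⟨_, _, hr, hl⟩ : Bˣ)
  refine ⟨(⟨_, _, hr, hl⟩ : Bˣ).isUnit, ?_⟩
  rw [hinv, norm_smul, norm_inv, div_eq_inv_mul]
  gcongr

/-- The normalized trace of matrices as a continuous linear functional. -/
noncomputable def normTrace (n : ℕ) : Matrix (Fin n) (Fin n) ℂ →L[ℂ] ℂ :=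
  LinearMap.toContinuousLinearMap ((n : ℂ)⁻¹ • Matrix.traceLinearMap (Fin n) ℂ ℂ)

theorem normTrace_apply {n : ℕ} (X : Matrix (Fin n) (Fin n) ℂ) :
    normTrace n X = (n : ℂ)⁻¹ * X.trace := rfl

theorem normTrace_one {n : ℕ} (hn : 0 < n) : normTrace n 1 = 1 := by
  have : (n : ℂ) ≠ 0 := by exact_mod_cast hn.ne'
  rw [normTrace_apply, Matrix.trace_one, Fintype.card_fin, inv_mul_cancel₀ this]

theorem rTransform_eq_rSeries {n : ℕ} (T : Matrix (Fin n) (Fin n) ℂ) (w : ℂ) :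
    rTransform T w = rSeries (normTrace n) T w := rfl

variable {k N : ℕ} {n : Fin k → ℕ}

theorem rTransform_spec (hn : ∀ i, 0 < n i) (T : (i : Fin k) → Matrix (Fin (n i)) (Fin (n i)) ℂ) :
    ∃ K ≥ (0 : ℝ), ∃ δ > (0 : ℝ), ∃ L ≥ (0 : ℝ), ∀ i, ∀ f : ℂ, ‖f‖ < δ →
      (Summable fun m : ℕ => rCoeff (T i) m * f ^ m) ∧
      ‖rTransform (T i) f‖ ≤ K ∧ IsUnit (cumulantPencil (T i) f (rTransform (T i) f)) ∧
      normTrace (n i) (T i * Ring.inverse (cumulantPencil (T i) f (rTransform (T i) f))) =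
        rTransform (T i) f ∧
      normTrace (n i) (Ring.inverse (cumulantPencil (T i) f (rTransform (T i) f))) = 1 ∧
      ∀ f' : ℂ, ‖f'‖ < δ → ‖rTransform (T i) f - rTransform (T i) f'‖ ≤ L * ‖f - f'‖ := by
  have h := fun i => rSeries_spec (normTrace_one (hn i)) (T i)
  choose K hK δ hδ L hL h using h
  obtain ⟨ε, hε, hεδ⟩ := exists_pos_forall_le hδ
  refine ⟨∑ i, K i, Finset.sum_nonneg fun i _ => hK i, ε, hε, ∑ i, L i,
    Finset.sum_nonneg fun i _ => hL i, fun i f hf => ?_⟩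
  obtain ⟨h1, h2, h3, h4, h5, h6⟩ := h i f (hf.trans_le (hεδ i))
  have hne : 1 + f * rTransform (T i) f ≠ 0 := by
    intro h0
    rw [← rTransform_eq_rSeries, show f * rTransform (T i) f = -1 by linear_combination h0] at h4
    norm_num at h4
  refine ⟨h1, h2.trans (Finset.single_le_sum (fun i _ => hK i) (Finset.mem_univ i)), h3, h5,
    functional_inverse_cumulantPencil (normTrace_one (hn i)) h3 hne h5, fun f' hf' => (h6 f' (hf'.trans_le (hεδ i))).trans ?_⟩
  gcongr
  exact Finset.single_le_sum (fun i _ => hL i) (Finset.mem_univ i)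

/-- The resolvent is of size 1/‖z‖, so for large z the right-hand side of the system is a
contraction of the δ-ball into the ε-ball. Two radii are kept because uniqueness is wanted for all
entries below δ, while the comparison with the free model needs the solution as small as ε. -/
theorem exists_unique_solution (H : (i : Fin k) → Matrix (Fin N) (Fin (n i)) ℂ)
    (T : (i : Fin k) → Matrix (Fin (n i)) (Fin (n i)) ℂ) {K δ L : ℝ} (hK : 0 ≤ K) (hL : 0 ≤ L)
    (hR : ∀ i, ∀ f : ℂ, ‖f‖ < δ → ‖rTransform (T i) f‖ ≤ K ∧
      ∀ f' : ℂ, ‖f'‖ < δ → ‖rTransform (T i) f - rTransform (T i) f'‖ ≤ L * ‖f - f'‖)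
    {ε : ℝ} (hε : 0 < ε) (hεδ : ε < δ) :
    ∃ ρ > (0 : ℝ), ∀ z : ℂ, ρ < ‖z‖ →
      (∃ g : Fin k → ℂ, (∀ j, ‖g j‖ ≤ ε) ∧ SolvesSystem H T z g) ∧
      ∀ g g' : Fin k → ℂ, (∀ j, ‖g j‖ < δ) → (∀ j, ‖g' j‖ < δ) →
        SolvesSystem H T z g → SolvesSystem H T z g' → g = g' := by
  set E : ℝ := ‖(1 : Matrix (Fin N) (Fin N) ℂ)‖ + 1 with hE
  have hE0 : 0 ≤ E := by positivity
  set C : ℝ := ∑ i, ‖H i * (H i)ᴴ‖ with hC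
  have hC0 : 0 ≤ C := Finset.sum_nonneg fun i _ => norm_nonneg _
  set ψ : Fin k → Matrix (Fin N) (Fin N) ℂ →L[ℂ] ℂ := fun j =>
    LinearMap.toContinuousLinearMap (((n j : ℂ)⁻¹ • Matrix.traceLinearMap (Fin N) ℂ ℂ) ∘ₗ
      LinearMap.mulRight ℂ (H j * (H j)ᴴ)) with hψ
  set D : ℝ := ∑ j, ‖ψ j‖ with hD
  have hD0 : 0 ≤ D := Finset.sum_nonneg fun i _ => norm_nonneg _
  have hDj : ∀ j, ‖ψ j‖ ≤ D := fun j =>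
    Finset.single_le_sum (fun i _ => norm_nonneg (ψ i)) (Finset.mem_univ j)
  -- The summands serve, in order: ‖z‖ > 1, invertibility of the matrix, values in the ε-ball, and
  -- the contraction factor 1/2.
  refine ⟨1 + 2 * (K * C) + D * E / ε + 2 * (D * (E ^ 2 * (L * C))), by positivity,
    fun z hz => ?_⟩
  have p1 : 0 ≤ K * C := by positivity
  have p2 : 0 ≤ D * E / ε := by positivity
  have p3 : 0 ≤ D * (E ^ 2 * (L * C)) := by positivity
  have hz1 : 1 < ‖z‖ := by linarith
  have hz0 : z ≠ 0 := norm_pos_iff.1 (by linarith)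
  have hZ : ∀ g : Fin k → ℂ, (∀ j, ‖g j‖ < δ) →
      IsUnit (equivMatrix H (fun i => rTransform (T i) (g i)) z) ∧
      ‖Ring.inverse (equivMatrix H (fun i => rTransform (T i) (g i)) z)‖ ≤ E / ‖z‖ := by
    intro g hg
    refine isUnit_smul_one_sub hz0 ?_
    have : ‖∑ i, rTransform (T i) (g i) • (H i * (H i)ᴴ)‖ ≤ K * C := by
      refine (norm_sum_le _ _).trans ?_
      rw [hC, Finset.mul_sum]
      refine Finset.sum_le_sum fun i _ => ?_
      rw [norm_smul]
      gcongr
      exact (hR i _ (hg i)).1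
    linarith
  set Ψ : (Fin k → ℂ) → Fin k → ℂ := fun g j =>
    ψ j (Ring.inverse (equivMatrix H (fun i => rTransform (T i) (g i)) z)) with hΨ
  have hbound : ∀ g, (∀ j, ‖g j‖ < δ) → ‖Ψ g‖ ≤ ε := by
    intro g hg
    rw [pi_norm_le_iff_of_nonneg hε.le]
    intro j
    calc ‖Ψ g j‖ ≤ ‖ψ j‖ * ‖Ring.inverse (equivMatrix H (fun i => rTransform (T i) (g i)) z)‖ :=
          (ψ j).le_opNorm _
      _ ≤ D * (E / ‖z‖) := by
          gcongr
          · exact hDj j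
          · exact (hZ g hg).2
      _ ≤ ε := by
          rw [← mul_div_assoc, div_le_iff₀ (by linarith), ← div_le_iff₀' hε]
          linarith
  have hlip : ∀ g g', (∀ j, ‖g j‖ < δ) → (∀ j, ‖g' j‖ < δ) →
      ‖Ψ g - Ψ g'‖ ≤ 1 / 2 * ‖g - g'‖ := by
    intro g g' hg hg'
    rw [pi_norm_le_iff_of_nonneg (by positivity)]
    intro j
    have hdiff : ‖equivMatrix H (fun i => rTransform (T i) (g' i)) z -
        equivMatrix H (fun i => rTransform (T i) (g i)) z‖ ≤ L * C * ‖g - g'‖ := by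
      have : equivMatrix H (fun i => rTransform (T i) (g' i)) z -
          equivMatrix H (fun i => rTransform (T i) (g i)) z =
          ∑ i, (rTransform (T i) (g i) - rTransform (T i) (g' i)) • (H i * (H i)ᴴ) := by
        simp only [equivMatrix, sub_smul, Finset.sum_sub_distrib]
        abel
      rw [this]
      refine (norm_sum_le _ _).trans ?_
      rw [hC, Finset.mul_sum, Finset.sum_mul]
      refine Finset.sum_le_sum fun i _ => ?_
      rw [norm_smul]
      calc _ ≤ L * ‖g i - g' i‖ * ‖H i * (H i)ᴴ‖ := by
            gcongr
            exact (hR i _ (hg i)).2 _ (hg' i)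
        _ ≤ L * ‖g - g'‖ * ‖H i * (H i)ᴴ‖ := by
            gcongr
            exact norm_le_pi_norm (g - g') i
        _ = _ := by ring
    have hinv := (norm_inverse_sub_inverse_le (hZ g hg).1 (hZ g' hg').1).trans
      (mul_le_mul (mul_le_mul (hZ g hg).2 hdiff (norm_nonneg _) (by positivity)) (hZ g' hg').2
        (norm_nonneg _) (by positivity))
    calc ‖(Ψ g - Ψ g') j‖ = ‖ψ j (Ring.inverse (equivMatrix H (fun i => rTransform (T i) (g i)) z) -
          Ring.inverse (equivMatrix H (fun i => rTransform (T i) (g' i)) z))‖ := by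
          rw [map_sub]; rfl
      _ ≤ D * (E / ‖z‖ * (L * C * ‖g - g'‖) * (E / ‖z‖)) :=
          ((ψ j).le_opNorm _).trans (mul_le_mul (hDj j) hinv (norm_nonneg _) hD0)
      _ = D * (E ^ 2 * (L * C)) / ‖z‖ / ‖z‖ * ‖g - g'‖ := by ring
      _ ≤ 1 / 2 * ‖g - g'‖ := by
          refine mul_le_mul_of_nonneg_right ?_ (norm_nonneg _)
          rw [div_div, div_le_iff₀ (by positivity)]
          -- The Lipschitz constant decays like ‖z‖⁻². Since ‖z‖ > 1, a bound on ‖z‖ itself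
          -- suffices.
          nlinarith
  have hsol : ∀ g, SolvesSystem H T z g ↔
      IsUnit (equivMatrix H (fun i => rTransform (T i) (g i)) z) ∧ Ψ g = g := by
    intro g
    rw [SolvesSystem, funext_iff]
    refine and_congr_right fun _ => forall_congr' fun j => ?_
    rw [eq_comm, Matrix.nonsing_inv_eq_ringInverse]
    exact Iff.rfl
  constructor
  · have hball : ∀ g : Fin k → ℂ, ‖g‖ ≤ ε → ∀ j, ‖g j‖ < δ := fun g hg j =>
      ((norm_le_pi_norm g j).trans hg).trans_lt hεδ
    obtain ⟨g, hg, hfix⟩ := exists_fixedPoint_of_lipschitz Ψ hε.le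
      (fun g hg => hbound g (hball g hg)) (fun g g' hg hg' => hlip g g' (hball g hg) (hball g' hg'))
    exact ⟨g, fun j => (norm_le_pi_norm g j).trans hg,
      (hsol g).2 ⟨(hZ g (hball g hg)).1, hfix⟩⟩
  · intro g g' hg hg' hs hs'
    have h1 := hlip g g' hg hg'
    rw [((hsol g).1 hs).2, ((hsol g').1 hs').2] at h1
    have h2 : ‖g - g'‖ = 0 := le_antisymm (by linarith) (norm_nonneg _)
    exact sub_eq_zero.1 (norm_eq_zero.1 h2)

theorem inverse_smul {R : Type*} [Ring R] [Algebra ℂ R] {c : ℂ} (hc : c ≠ 0) {x : R}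
    (hx : IsUnit x) : IsUnit (c • x) ∧ Ring.inverse (c • x) = c⁻¹ • Ring.inverse x := by
  have hr : (c • x) * (c⁻¹ • Ring.inverse x) = 1 := by
    rw [smul_mul_smul_comm, mul_inv_cancel₀ hc, one_smul, Ring.mul_inverse_cancel _ hx]
  have hl : (c⁻¹ • Ring.inverse x) * (c • x) = 1 := by
    rw [smul_mul_smul_comm, inv_mul_cancel₀ hc, one_smul, Ring.inverse_mul_cancel _ hx]
  exact ⟨(⟨_, _, hr, hl⟩ : Rˣ).isUnit, Ring.inverse_unit (⟨_, _, hr, hl⟩ : Rˣ)⟩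

theorem inverse_neg_eq {R : Type*} [Ring R] (x : R) : Ring.inverse (-x) = -Ring.inverse x := by
  by_cases h : IsUnit x
  · obtain ⟨u, rfl⟩ := h
    rw [← Units.val_neg, Ring.inverse_unit, Ring.inverse_unit, inv_neg, Units.val_neg]
  · rw [Ring.inverse_non_unit _ h, Ring.inverse_non_unit _ (by rwa [IsUnit.neg_iff]), neg_zero]

theorem classical_resolvent_eq_neg (H : (i : Fin k) → Matrix (Fin N) (Fin (n i)) ℂ) (r : Fin k → ℂ)
    (z : ℂ) : (∑ i, r i • (H i * (H i)ᴴ)) - z • (1 : Matrix (Fin N) (Fin N) ℂ) =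
      -equivMatrix H r z := by
  rw [equivMatrix, neg_sub]

/-- With f = -(N/n) e, the matrix inverted in the second classical equation is a multiple of the
pencil of the R-transform, and e' plays the role of r. -/
theorem classical_second_eq {N n : ℕ} (hN : 0 < N) (hn : 0 < n) (T : Matrix (Fin n) (Fin n) ℂ)
    (e e' : ℂ) :
    e • T + ((n : ℂ) / N - e * e') • (1 : Matrix (Fin n) (Fin n) ℂ) =
      ((n : ℂ) / N) • cumulantPencil T (-((N : ℂ) / n) * e) e' := by
  have hN' : (N : ℂ) ≠ 0 := by exact_mod_cast hN.ne'
  have hn' : (n : ℂ) ≠ 0 := by exact_mod_cast hn.ne'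
  rw [cumulantPencil, smul_sub, smul_smul, smul_smul,
    show (n : ℂ) / N * (1 + -(N / n) * e * e') = n / N - e * e' by field_simp; ring,
    show (n : ℂ) / N * (-(N / n) * e) = -e by field_simp]
  module

theorem classical_second_iff {N n : ℕ} (hN : 0 < N) (hn : 0 < n) (T : Matrix (Fin n) (Fin n) ℂ)
    (e e' : ℂ) (hu : IsUnit (cumulantPencil T (-((N : ℂ) / n) * e) e')) :
    (IsUnit (e • T + ((n : ℂ) / N - e * e') • (1 : Matrix (Fin n) (Fin n) ℂ)) ∧
      e' = (N : ℂ)⁻¹ * (T * (e • T +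
        ((n : ℂ) / N - e * e') • (1 : Matrix (Fin n) (Fin n) ℂ))⁻¹).trace) ↔
      e' = normTrace n (T * Ring.inverse (cumulantPencil T (-((N : ℂ) / n) * e) e')) := by
  have hN' : (N : ℂ) ≠ 0 := by exact_mod_cast hN.ne'
  have hn' : (n : ℂ) ≠ 0 := by exact_mod_cast hn.ne'
  have hc : (n : ℂ) / N ≠ 0 := div_ne_zero hn' hN'
  rw [classical_second_eq hN hn, Matrix.nonsing_inv_eq_ringInverse, (inverse_smul hc hu).2,
    and_iff_right (inverse_smul hc hu).1, mul_smul_comm, Matrix.trace_smul, smul_eq_mul,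
    normTrace_apply, ← mul_assoc, show (N : ℂ)⁻¹ * (n / N : ℂ)⁻¹ = (n : ℂ)⁻¹ by field_simp]

theorem solvesClassicalSystem_iff (hN : 0 < N) (hn : ∀ i, 0 < n i)
    (H : (i : Fin k) → Matrix (Fin N) (Fin (n i)) ℂ)
    (T : (i : Fin k) → Matrix (Fin (n i)) (Fin (n i)) ℂ) (K : ℝ) :
    ∃ δ > (0 : ℝ), ∀ (z : ℂ) (e e' : Fin k → ℂ),
      (∀ j, ‖-((N : ℂ) / (n j : ℂ)) * e j‖ < δ) → (∀ j, ‖e' j‖ < K) →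
      (SolvesClassicalSystem H T z e e' ↔
        SolvesSystem H T z (fun j => -((N : ℂ) / (n j : ℂ)) * e j) ∧
        ∀ j, e' j = rTransform (T j) (-((N : ℂ) / (n j : ℂ)) * e j)) := by
  have h := fun i => eq_rSeries_iff (normTrace_one (hn i)) (T i) K
  choose δ hδ h using h
  obtain ⟨ε, hε, hεδ⟩ := exists_pos_forall_le hδ
  refine ⟨ε, hε, fun z e e' he he' => ?_⟩
  have hsecond : ∀ j, (IsUnit (e j • T j +
      ((n j : ℂ) / N - e j * e' j) • (1 : Matrix (Fin (n j)) (Fin (n j)) ℂ)) ∧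
      e' j = (N : ℂ)⁻¹ * (T j * (e j • T j +
        ((n j : ℂ) / N - e j * e' j) • (1 : Matrix (Fin (n j)) (Fin (n j)) ℂ))⁻¹).trace) ↔
      e' j = rTransform (T j) (-((N : ℂ) / (n j : ℂ)) * e j) := by
    intro j
    obtain ⟨h1, h2⟩ := h j _ (e' j) ((he j).trans_le (hεδ j)) (he' j)
    rw [classical_second_iff hN (hn j) (T j) _ _ h1, h2, rTransform_eq_rSeries]
  have hfirst : (IsUnit ((∑ i, e' i • (H i * (H i)ᴴ)) - z • (1 : Matrix (Fin N) (Fin N) ℂ)) ∧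
      ∀ j, e j = (N : ℂ)⁻¹ * ((H j * (H j)ᴴ) *
        ((∑ i, e' i • (H i * (H i)ᴴ)) - z • (1 : Matrix (Fin N) (Fin N) ℂ))⁻¹).trace) ↔
      (IsUnit (equivMatrix H e' z) ∧ ∀ j, -((N : ℂ) / (n j : ℂ)) * e j =
        (n j : ℂ)⁻¹ * ((equivMatrix H e' z)⁻¹ * (H j * (H j)ᴴ)).trace) := by
    rw [classical_resolvent_eq_neg, IsUnit.neg_iff, Matrix.nonsing_inv_eq_ringInverse,
      Matrix.nonsing_inv_eq_ringInverse, inverse_neg_eq]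
    refine and_congr_right fun _ => forall_congr' fun j => ?_
    have hnj : (n j : ℂ) ≠ 0 := by exact_mod_cast (hn j).ne'
    rw [mul_neg, Matrix.trace_neg, Matrix.trace_mul_comm]
    constructor
    · intro h
      rw [h]
      field_simp
    · intro h
      have : e j = -((n j : ℂ) / N) * (-((N : ℂ) / (n j : ℂ)) * e j) := by field_simp
      rw [this, h]
      field_simp
  rw [SolvesClassicalSystem, ← and_assoc, hfirst, forall_congr' hsecond, SolvesSystem]
  refine and_congr_left fun h => ?_
  rw [← funext h]

end MatrixEquations

end FreeDetEquiv

namespace FreeDetEquiv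

/-! ### Rectangular probability spaces: continuity and closures -/

section Rectangular

variable {A : Type*} [CStarAlgebra A]

/-- Positive functionals on a C*-algebra are automatically continuous. The spectral order is
introduced only to invoke this. -/
theorem IsTracialState.continuous {τ : A →ₗ[ℂ] ℂ} (h : IsTracialState τ) : Continuous τ := by
  let _ := CStarAlgebra.spectralOrder A
  let _ := CStarAlgebra.spectralOrderedRing A
  let f : A →ₚ[ℂ] ℂ := PositiveLinearMap.mk₀ τ (fun x hx => by
    obtain ⟨y, rfl⟩ := CStarAlgebra.nonneg_iff_eq_star_mul_self.1 hx
    exact h.nonneg y)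
  exact map_continuous f

variable {ι : Type*} [Fintype ι] {τ : A →ₗ[ℂ] ℂ} {p : ι → A}

theorem IsRectangularSpace.mul_self (hR : IsRectangularSpace τ p) (i : ι) : p i * p i = p i :=
  (hR.proj i).isIdempotentElem

theorem IsRectangularSpace.star_eq (hR : IsRectangularSpace τ p) (i : ι) : star (p i) = p i :=
  (hR.proj i).isSelfAdjoint

theorem condExp_add (a b : A) : condExp τ p (a + b) = condExp τ p a + condExp τ p b := by
  simp only [condExp, mul_add, map_add, add_smul, Finset.sum_add_distrib]

theorem condExp_sub (a b : A) : condExp τ p (a - b) = condExp τ p a - condExp τ p b := by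
  simp only [condExp, mul_sub, map_sub, sub_smul, Finset.sum_sub_distrib]

theorem condExp_sum {κ : Type*} (s : Finset κ) (a : κ → A) :
    condExp τ p (∑ j ∈ s, a j) = ∑ j ∈ s, condExp τ p (a j) := by
  classical
  induction s using Finset.induction_on with
  | empty => simp [condExp]
  | insert j s hj ih => rw [Finset.sum_insert hj, Finset.sum_insert hj, condExp_add, ih]

theorem IsRectangularSpace.continuous_condExp (hR : IsRectangularSpace τ p) :
    Continuous (condExp τ p) := by
  have := hR.tracial.continuous
  unfold condExp
  fun_prop

theorem IsRectangularSpace.proj_mul_condExp (hR : IsRectangularSpace τ p) (i : ι) (a : A) :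
    p i * condExp τ p a = ((τ (p i))⁻¹ * τ (p i * a)) • p i := by
  classical
  rw [condExp, Finset.mul_sum, Finset.sum_eq_single i]
  · rw [mul_smul_comm, hR.mul_self]
  · intro j _ hj
    rw [mul_smul_comm, hR.orthogonal i j hj.symm, smul_zero]
  · simp

theorem IsRectangularSpace.condExp_eq_zero_iff (hR : IsRectangularSpace τ p)
    (hp : ∀ i, τ (p i) ≠ 0) {a : A} : condExp τ p a = 0 ↔ ∀ i, τ (p i * a) = 0 := by
  constructor
  · intro h i
    have h1 := hR.proj_mul_condExp i a
    rw [h, mul_zero] at h1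
    have h2 := (smul_eq_zero.1 h1.symm).resolve_right (hR.ne_zero i)
    exact (mul_eq_zero.1 h2).resolve_left (inv_ne_zero (hp i))
  · intro h
    simp [condExp, h]

theorem IsRectangularSpace.condExp_condExp (hR : IsRectangularSpace τ p)
    (hp : ∀ i, τ (p i) ≠ 0) (a : A) : condExp τ p (condExp τ p a) = condExp τ p a := by
  rw [condExp, condExp]
  refine Finset.sum_congr rfl fun i _ => ?_
  rw [← condExp, hR.proj_mul_condExp, map_smul, smul_eq_mul]
  congr 1
  field_simp [hp i]

theorem IsRectangularSpace.trace_eq_sum (hR : IsRectangularSpace τ p) (a : A) :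
    τ a = ∑ i, τ (p i * a) := by
  rw [← map_sum, ← Finset.sum_mul, hR.sum_eq_one, one_mul]

theorem IsRectangularSpace.trace_eq_zero (hR : IsRectangularSpace τ p)
    (hp : ∀ i, τ (p i) ≠ 0) {a : A} (h : condExp τ p a = 0) : τ a = 0 := by
  rw [hR.trace_eq_sum]
  exact Finset.sum_eq_zero fun i _ => (hR.condExp_eq_zero_iff hp).1 h i

theorem condExp_mem {S : Subalgebra ℂ A} (h : ∀ i, p i ∈ S) (a : A) : condExp τ p a ∈ S :=
  sum_mem fun i _ => S.smul_mem (h i) _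

/-- Freeness with amalgamation extends to the closures of the algebras. -/
theorem IsRectangularSpace.free_closure (hR : IsRectangularSpace τ p) (hp : ∀ i, τ (p i) ≠ 0)
    {κ : Type*} {S : κ → Subalgebra ℂ A} (hS : ∀ j i, p i ∈ S j)
    (hfree : IsFreeWithAmalgamation (condExp τ p) S) :
    IsFreeWithAmalgamation (condExp τ p) fun j => (S j).topologicalClosure := by
  -- The letters of l₁ range over the closures and those of l₂ over the algebras themselves.
  -- Induction on l₁ moves its last letter across.
  have key : ∀ l₁ l₂ : List (κ × A), l₁ ++ l₂ ≠ [] →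
      (∀ x ∈ l₁, x.2 ∈ (S x.1).topologicalClosure ∧ condExp τ p x.2 = 0) →
      (∀ x ∈ l₂, x.2 ∈ S x.1 ∧ condExp τ p x.2 = 0) →
      ((l₁ ++ l₂).map Prod.fst).IsChain (· ≠ ·) →
      condExp τ p ((l₁ ++ l₂).map Prod.snd).prod = 0 := by
    intro l₁
    induction l₁ using List.reverseRecOn with
    | nil =>
      intro l₂ hne _ h2 hc
      rw [List.isChain_map] at hc
      exact hfree l₂ hne h2 hc
    | append_singleton l x ih =>
      intro l₂ _ h1 h2 hc
      have hx := h1 x (by simp)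
      -- A letter of the algebra near x need not be centred. Subtracting its expectation, which
      -- stays in the algebra because the projections do, repairs this and changes nothing at x.
      have hclosed : IsClosed {y : A | condExp τ p ((l.map Prod.snd).prod *
          ((y - condExp τ p y) * (l₂.map Prod.snd).prod)) = 0} := by
        have hF := hR.continuous_condExp
        refine isClosed_eq (hF.comp ?_) continuous_const
        exact continuous_const.mul ((continuous_id.sub hF).mul continuous_const)
      have hsub : (S x.1 : Set A) ⊆ {y : A | condExp τ p ((l.map Prod.snd).prod *
          ((y - condExp τ p y) * (l₂.map Prod.snd).prod)) = 0} := by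
        intro y hy
        have := ih ((x.1, y - condExp τ p y) :: l₂) (by simp)
          (fun u hu => h1 u (List.mem_append_left _ hu))
          (by
            intro u hu
            rcases List.mem_cons.1 hu with rfl | hu
            · exact ⟨(S x.1).sub_mem hy (condExp_mem (hS x.1) y), by
                rw [condExp_sub, hR.condExp_condExp hp, sub_self]⟩
            · exact h2 u hu)
          (by simpa using hc)
        simpa using this
      have hmem := hclosed.closure_subset_iff.2 hsub hx.1
      rw [Set.mem_ofPred_eq, hx.2, sub_zero] at hmem
      simpa using hmem
  intro l hne hl hc
  have := key l [] (by simpa using hne) hl (by simp) (by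
    rw [List.append_nil, List.isChain_map]; exact hc)
  simpa using this

/-- The trace of an alternating product whose letters, apart from the first one, are centered. -/
theorem IsRectangularSpace.trace_alternating (hR : IsRectangularSpace τ p)
    (hp : ∀ i, τ (p i) ≠ 0) {k : ℕ} {S : Option (Fin k) → Subalgebra ℂ A}
    (hS : ∀ i, p i ∈ S none) (hfree : IsFreeWithAmalgamation (condExp τ p) S)
    {b y : A} {d : Fin k → A} (hb : b ∈ S none) (hb0 : condExp τ p b = 0)
    (hd : ∀ i, d i ∈ S (some i)) (hd0 : ∀ i, condExp τ p (d i) = 0) (hy : y ∈ S none) (m : ℕ) :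
    τ (y * (((∑ i, d i) * b) ^ m * ∑ i, d i)) = 0 := by
  -- Prefixes ending in `none` make the induction work: each power contributes two letters d_i and
  -- b, and d_i never shares its algebra with its neighbours, even when the same index recurs.
  have key : ∀ (m : ℕ) (l : List (Option (Fin k) × A)),
      (∀ x ∈ l, x.2 ∈ S x.1 ∧ condExp τ p x.2 = 0) → l.IsChain (fun x y => x.1 ≠ y.1) →
      (∀ x ∈ l.getLast?, x.1 = none) →
      condExp τ p ((l.map Prod.snd).prod * (((∑ i, d i) * b) ^ m * ∑ i, d i)) = 0 := by
    intro m
    induction m with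
    | zero =>
      intro l hl hc hlast
      rw [pow_zero, one_mul, Finset.mul_sum, condExp_sum]
      refine Finset.sum_eq_zero fun i _ => ?_
      have := hfree (l ++ [(some i, d i)]) (by simp) (by
          intro x hx
          rcases List.mem_append.1 hx with hx | hx
          · exact hl x hx
          · rw [List.mem_singleton] at hx
            subst hx
            exact ⟨hd i, hd0 i⟩)
        (List.IsChain.append hc (List.isChain_singleton _) (by
          intro x hx u hu
          rw [hlast x hx]
          simp at hu
          simp [← hu]))
      simpa using this
    | succ m ih =>
      intro l hl hc hlast
      have hexp : (l.map Prod.snd).prod * (((∑ i, d i) * b) ^ (m + 1) * ∑ i, d i) =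
          ∑ i, ((l ++ [(some i, d i), (none, b)]).map Prod.snd).prod *
            (((∑ i, d i) * b) ^ m * ∑ i, d i) := by
        rw [← Finset.sum_mul]
        have : ∑ i, ((l ++ [(some i, d i), (none, b)]).map Prod.snd).prod =
            (l.map Prod.snd).prod * ((∑ i, d i) * b) := by
          rw [Finset.sum_mul, Finset.mul_sum]
          exact Finset.sum_congr rfl fun i _ => by simp
        rw [this, pow_succ']
        simp only [mul_assoc]
      rw [hexp, condExp_sum]
      refine Finset.sum_eq_zero fun i _ => ih _ ?_ ?_ ?_
      · intro x hx
        rcases List.mem_append.1 hx with hx | hx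
        · exact hl x hx
        · rcases List.mem_cons.1 hx with rfl | hx
          · exact ⟨hd i, hd0 i⟩
          · rw [List.mem_singleton] at hx
            subst hx
            exact ⟨hb, hb0⟩
      · refine List.IsChain.append hc (by simp) ?_
        intro x hx u hu
        rw [hlast x hx]
        simp at hu
        simp [← hu]
      · intro x hx
        simp at hx
        simp [← hx]
  set v := ((∑ i, d i) * b) ^ m * ∑ i, d i with hv
  -- The centred part of y is one more letter of the word. The rest of y is a combination of the
  -- p_i, which is handled by the centredness of v alone.
  have h0 : condExp τ p v = 0 := by simpa using key m [] (by simp) (by simp) (by simp)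
  have h1 : condExp τ p ((y - condExp τ p y) * v) = 0 := by
    have := key m [(none, y - condExp τ p y)] (by
      intro x hx
      rw [List.mem_singleton] at hx
      subst hx
      exact ⟨(S none).sub_mem hy (condExp_mem hS y), by
        rw [condExp_sub, hR.condExp_condExp hp, sub_self]⟩) (by simp) (by simp)
    simpa using this
  have h2 : τ (condExp τ p y * v) = 0 := by
    rw [condExp, Finset.sum_mul, map_sum]
    refine Finset.sum_eq_zero fun i _ => ?_
    rw [smul_mul_assoc, map_smul, (hR.condExp_eq_zero_iff hp).1 h0 i, smul_zero]
  have h3 := hR.trace_eq_zero hp h1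
  rw [sub_mul, map_sub, h2, sub_zero] at h3
  exact h3

end Rectangular

/-! ### Functionals that agree on generated algebras -/

section Pairs

variable {A B : Type*} [NormedRing A] [NormedAlgebra ℂ A] [NormedRing B] [NormedAlgebra ℂ B]

/-- Agreement on words extends to the span by linearity and to the closure by continuity. Pairs in
the product algebra record that both entries arise from the same expression, including limits such
as resolvents. -/
theorem eq_on_closure_adjoin {φ : A → ℂ} {ψ : B → ℂ} (hφ : IsLinearMap ℂ φ) (hψ : IsLinearMap ℂ ψ)
    (hφc : Continuous φ) (hψc : Continuous ψ) {S : Set (A × B)}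
    (h : ∀ l : List (A × B), (∀ x ∈ l, x ∈ S) → φ l.prod.1 = ψ l.prod.2) {x : A × B}
    (hx : x ∈ (Algebra.adjoin ℂ S).topologicalClosure) : φ x.1 = ψ x.2 := by
  have hclosed : IsClosed {x : A × B | φ x.1 = ψ x.2} :=
    isClosed_eq (hφc.comp continuous_fst) (hψc.comp continuous_snd)
  refine hclosed.closure_subset_iff.2 ?_ hx
  intro y hy
  replace hy : y ∈ Subalgebra.toSubmodule (Algebra.adjoin ℂ S) := hy
  rw [Algebra.adjoin_eq_span] at hy
  induction hy using Submodule.span_induction with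
  | mem y hy =>
    obtain ⟨l, hl, rfl⟩ := Submonoid.exists_list_of_mem_closure hy
    exact h l hl
  | zero => simp [hφ.map_zero, hψ.map_zero]
  | add y z _ _ hy hz =>
    rw [Set.mem_ofPred_eq] at hy hz ⊢
    rw [Prod.fst_add, Prod.snd_add, hφ.map_add, hψ.map_add, hy, hz]
  | smul c y _ hy =>
    rw [Set.mem_ofPred_eq] at hy ⊢
    rw [Prod.smul_fst, Prod.smul_snd, hφ.map_smul, hψ.map_smul, hy]

theorem inverse_eq_of_mul_eq_one {R : Type*} [MonoidWithZero R] {x y : R} (h₁ : x * y = 1)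
    (h₂ : y * x = 1) : Ring.inverse x = y :=
  Ring.inverse_unit (⟨x, y, h₁, h₂⟩ : Rˣ)

theorem inverse_prod {R S : Type*} [MonoidWithZero R] [MonoidWithZero S] {x : R × S}
    (hx : IsUnit x) : Ring.inverse x = (Ring.inverse x.1, Ring.inverse x.2) := by
  have h1 := Ring.mul_inverse_cancel x hx
  have h2 := Ring.inverse_mul_cancel x hx
  rw [Prod.ext_iff] at h1 h2
  exact Prod.ext (inverse_eq_of_mul_eq_one h1.1 h2.1).symm
    (inverse_eq_of_mul_eq_one h1.2 h2.2).symm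

theorem inverse_one_sub_mem_closure [CompleteSpace A] {S : Subalgebra ℂ A} {x : A} (hx : x ∈ S)
    (h : ‖x‖ ≤ 1 / 2) : Ring.inverse (1 - x) ∈ S.topologicalClosure := by
  have hx1 : ‖x‖ < 1 := by linarith
  rw [NormedRing.inverse_one_sub x hx1]
  exact S.isClosed_topologicalClosure.mem_of_tendsto
    (summable_geometric_of_norm_lt_one hx1).hasSum.tendsto_sum_nat
    (Filter.Eventually.of_forall fun m => sum_mem fun i _ =>
      S.le_topologicalClosure (pow_mem hx i))

theorem inverse_smul_one_sub_mem_closure [CompleteSpace A] {S : Subalgebra ℂ A} {z : ℂ} {X : A}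
    (hz : z ≠ 0) (hX : X ∈ S) (h : 2 * ‖X‖ ≤ ‖z‖) :
    Ring.inverse (z • (1 : A) - X) ∈ S.topologicalClosure := by
  have hn : ‖z⁻¹ • X‖ ≤ 1 / 2 := by
    rw [norm_smul, norm_inv, inv_mul_le_iff₀ (norm_pos_iff.2 hz)]
    linarith
  have hrw : z • (1 : A) - X = z • (1 - z⁻¹ • X) := by
    rw [smul_sub, smul_smul, mul_inv_cancel₀ hz, one_smul]
  rw [hrw, (inverse_smul hz (isUnit_one_sub_of_norm_le_half hn).1).2]
  exact Subalgebra.smul_mem _ (inverse_one_sub_mem_closure (S.smul_mem hX _) hn) _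

end Pairs

end FreeDetEquiv

namespace FreeDetEquiv

/-! ### The resolvent of the free deterministic equivalent -/

section Model

open Matrix

attribute [local instance] Matrix.linftyOpNormedRing Matrix.linftyOpNormedAlgebra
attribute [local instance] matrixTopology

/-- Centring h' Q h by F is compensated by replacing a with d = (1 - a F)⁻¹ a, because 1 - a h' Q h
= (1 - a F)(1 - d b). The rest is the usual Woodbury computation, and only a right inverse is
claimed. -/
theorem woodbury_identity {R : Type*} [Ring R] {Z Q h a h' F d b X : R} (hZ : Z * Q = 1)
    (hd : (1 - a * F) * d = a) (hb : b = h' * Q * h - F) (hX : (1 - d * b) * X = 1) :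
    (Z - h * a * h') * (Q + Q * h * X * d * h' * Q) = 1 := by
  have h1 : (1 - a * F) * (1 - d * b) = 1 - a * F - a * b := by
    rw [mul_sub, mul_one, ← mul_assoc, hd]
  have h2 : (1 - a * F - a * b) * (X * d) = a := by
    rw [← h1, mul_assoc, ← mul_assoc (1 - d * b), hX, one_mul, hd]
  have h3 : a * (h' * Q * h) = a * b + a * F := by rw [hb]; noncomm_ring
  calc (Z - h * a * h') * (Q + Q * h * X * d * h' * Q)
      = Z * Q + Z * Q * h * X * d * h' * Q - h * a * h' * Q -
          h * (a * (h' * Q * h)) * X * d * h' * Q := by noncomm_ring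
    _ = 1 + h * ((1 - a * F - a * b) * (X * d) - a) * h' * Q := by rw [h3, hZ]; noncomm_ring
    _ = 1 := by rw [h2]; noncomm_ring

theorem inverse_commute {R : Type*} [Ring R] {x q : R} (hx : IsUnit x) (h : q * x = x * q) :
    q * Ring.inverse x = Ring.inverse x * q := by
  calc q * Ring.inverse x = Ring.inverse x * x * q * Ring.inverse x := by
        rw [Ring.inverse_mul_cancel _ hx, one_mul]
    _ = Ring.inverse x * (q * x) * Ring.inverse x := by rw [mul_assoc (Ring.inverse x) x q, h]
    _ = Ring.inverse x * q * (x * Ring.inverse x) := by noncomm_ring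
    _ = Ring.inverse x * q := by rw [Ring.mul_inverse_cancel _ hx, mul_one]

variable {k N : ℕ} {n : Fin k → ℕ} {H : (i : Fin k) → Matrix (Fin N) (Fin (n i)) ℂ}
  {T : (i : Fin k) → Matrix (Fin (n i)) (Fin (n i)) ℂ}
  {A : Type*} [CStarAlgebra A] {τ : A →ₗ[ℂ] ℂ} {p : Fin (k + 1) → A} {h t : Fin k → A}

/-- The algebra generated by the pairs `(h_i h_i*, H_i H_i*)`. -/
def momentPairs (H : (i : Fin k) → Matrix (Fin N) (Fin (n i)) ℂ) (h : Fin k → A) :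
    Subalgebra ℂ (A × Matrix (Fin N) (Fin N) ℂ) :=
  Algebra.adjoin ℂ (Set.range fun i => (h i * star (h i), H i * (H i)ᴴ))

theorem momentPair_mem (H : (i : Fin k) → Matrix (Fin N) (Fin (n i)) ℂ) (h : Fin k → A)
    (i : Fin k) : (h i * star (h i), H i * (H i)ᴴ) ∈ momentPairs H h :=
  Algebra.subset_adjoin ⟨i, rfl⟩

/-- The element `(1 - g (t - r))⁻¹ (t - r) q`. -/
noncomputable def centeredPart (q t : A) (g r : ℂ) : A :=
  Ring.inverse (1 - g • (t - r • (1 : A))) * ((t - r • (1 : A)) * q)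

namespace IsFreeDeterministicEquivalent

theorem proj_mul_h (hΦ : IsFreeDeterministicEquivalent H T τ p h t) (i : Fin k) :
    p 0 * h i = h i := by
  rw [← hΦ.h_simple i, ← mul_assoc, ← mul_assoc, hΦ.rectangular.mul_self]

theorem h_mul_proj (hΦ : IsFreeDeterministicEquivalent H T τ p h t) (i : Fin k) :
    h i * p i.succ = h i := by
  rw [← hΦ.h_simple i, mul_assoc, hΦ.rectangular.mul_self]

theorem proj_mul_t (hΦ : IsFreeDeterministicEquivalent H T τ p h t) (i : Fin k) :
    p i.succ * t i = t i := by
  rw [← hΦ.t_simple i, ← mul_assoc, ← mul_assoc, hΦ.rectangular.mul_self]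

theorem t_mul_proj (hΦ : IsFreeDeterministicEquivalent H T τ p h t) (i : Fin k) :
    t i * p i.succ = t i := by
  rw [← hΦ.t_simple i, mul_assoc, hΦ.rectangular.mul_self]

theorem proj_mul_star (hΦ : IsFreeDeterministicEquivalent H T τ p h t) (i : Fin k) :
    p i.succ * star (h i) = star (h i) := by
  have := congrArg star (hΦ.h_mul_proj i)
  rwa [star_mul, hΦ.rectangular.star_eq] at this

theorem star_mul_proj (hΦ : IsFreeDeterministicEquivalent H T τ p h t) (i : Fin k) :
    star (h i) * p 0 = star (h i) := by
  have := congrArg star (hΦ.proj_mul_h i)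
  rwa [star_mul, hΦ.rectangular.star_eq] at this

theorem proj_mul_freeModel (hΦ : IsFreeDeterministicEquivalent H T τ p h t) :
    p 0 * freeModel h t = freeModel h t := by
  rw [freeModel, Finset.mul_sum]
  exact Finset.sum_congr rfl fun i _ => by rw [← mul_assoc, ← mul_assoc, hΦ.proj_mul_h]

theorem freeModel_mul_proj (hΦ : IsFreeDeterministicEquivalent H T τ p h t) :
    freeModel h t * p 0 = freeModel h t := by
  rw [freeModel, Finset.sum_mul]
  exact Finset.sum_congr rfl fun i _ => by rw [mul_assoc, hΦ.star_mul_proj]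

theorem dim_ne_zero (hN : 0 < N) : (N : ℂ) + ∑ j, (n j : ℂ) ≠ 0 := by
  have : ((N + ∑ j, n j : ℕ) : ℂ) ≠ 0 := by
    exact_mod_cast (Nat.add_pos_left hN _).ne'
  push_cast at this
  exact this

/-- The hypotheses fix the other weights, and the projections sum to one. -/
theorem trace_proj_zero (hΦ : IsFreeDeterministicEquivalent H T τ p h t) (hN : 0 < N) :
    τ (p 0) = (N : ℂ) / ((N : ℂ) + ∑ j, (n j : ℂ)) := by
  have h1 := congrArg τ hΦ.rectangular.sum_eq_one
  rw [Fin.sum_univ_succ, map_add, map_sum, hΦ.rectangular.tracial.map_one] at h1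
  simp only [hΦ.trace_proj] at h1
  rw [← Finset.sum_div] at h1
  have h2 := dim_ne_zero (n := n) hN
  rw [eq_div_iff h2]
  have h3 : (∑ i, (n i : ℂ)) / ((N : ℂ) + ∑ j, (n j : ℂ)) * ((N : ℂ) + ∑ j, (n j : ℂ)) =
    ∑ i, (n i : ℂ) := div_mul_cancel₀ _ h2
  linear_combination ((N : ℂ) + ∑ j, (n j : ℂ)) * h1 - h3

theorem trace_proj_ne_zero (hΦ : IsFreeDeterministicEquivalent H T τ p h t) (hN : 0 < N)
    (hn : ∀ i, 0 < n i) (i : Fin (k + 1)) : τ (p i) ≠ 0 := by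
  have h2 := dim_ne_zero (n := n) hN
  refine Fin.cases ?_ (fun j => ?_) i
  · rw [hΦ.trace_proj_zero hN]
    exact div_ne_zero (by exact_mod_cast hN.ne') h2
  · rw [hΦ.trace_proj]
    exact div_ne_zero (by exact_mod_cast (hn j).ne') h2

theorem proj_mem (i : Fin (k + 1)) (j : Option (Fin k)) : p i ∈ modelSubalgebras p h t j := by
  rcases j with _ | j
  · exact Algebra.subset_adjoin (Or.inl (Or.inl ⟨i, rfl⟩))
  · exact Algebra.subset_adjoin (Or.inl ⟨i, rfl⟩)

theorem h_mem (i : Fin k) : h i ∈ modelSubalgebras p h t none :=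
  Algebra.subset_adjoin (Or.inl (Or.inr ⟨i, rfl⟩))

theorem star_mem (i : Fin k) : star (h i) ∈ modelSubalgebras p h t none :=
  Algebra.subset_adjoin (Or.inr ⟨i, rfl⟩)

theorem t_mem (i : Fin k) : t i ∈ modelSubalgebras p h t (some i) :=
  Algebra.subset_adjoin (Or.inr rfl)

theorem isLinearMap_compressedTrace (τ : A →ₗ[ℂ] ℂ) (q : A) :
    IsLinearMap ℂ fun a => compressedTrace τ q (q * a) :=
  ⟨fun a b => by simp only [compressedTrace, mul_add, map_add], fun c a => by
    simp only [compressedTrace, mul_smul_comm, map_smul, smul_eq_mul]; ring⟩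

theorem continuous_compressedTrace (hΦ : IsFreeDeterministicEquivalent H T τ p h t) (q : A) :
    Continuous fun a => compressedTrace τ q (q * a) := by
  have := hΦ.rectangular.tracial.continuous
  unfold compressedTrace
  fun_prop

/-- The factor p 0 takes care of the empty word: the unit of A compresses to the unit of the corner.
It does not affect non-empty words. -/
theorem compressedTrace_h (hΦ : IsFreeDeterministicEquivalent H T τ p h t) (hN : 0 < N)
    (hn : ∀ i, 0 < n i) {x : A × Matrix (Fin N) (Fin N) ℂ}
    (hx : x ∈ (momentPairs H h).topologicalClosure) :
    compressedTrace τ (p 0) (p 0 * x.1) = normTrace N x.2 := by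
  refine eq_on_closure_adjoin (isLinearMap_compressedTrace τ (p 0)) (normTrace N).toLinearMap.isLinear
    (hΦ.continuous_compressedTrace _) (normTrace N).continuous (fun l hl => ?_) hx
  obtain ⟨l, rfl⟩ : l ∈ Set.range (List.map fun i => (h i * star (h i), H i * (H i)ᴴ)) := by
    rw [Set.range_list_map]
    exact hl
  have h1 : ((l.map fun i => (h i * star (h i), H i * (H i)ᴴ)).prod).1 =
      (l.map fun i => h i * star (h i)).prod := by
    have := map_list_prod (MonoidHom.fst A (Matrix (Fin N) (Fin N) ℂ))
      (l.map fun i => (h i * star (h i), H i * (H i)ᴴ))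
    rw [List.map_map] at this
    exact this
  have h2 : ((l.map fun i => (h i * star (h i), H i * (H i)ᴴ)).prod).2 =
      (l.map fun i => H i * (H i)ᴴ).prod := by
    have := map_list_prod (MonoidHom.snd A (Matrix (Fin N) (Fin N) ℂ))
      (l.map fun i => (h i * star (h i), H i * (H i)ᴴ))
    rw [List.map_map] at this
    exact this
  rw [h1, h2]
  rcases l with _ | ⟨i, l⟩
  · rw [List.map_nil, List.map_nil, List.prod_nil, List.prod_nil, mul_one, compressedTrace,
      inv_mul_cancel₀ (hΦ.trace_proj_ne_zero hN hn 0)]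
    exact (normTrace_one hN).symm
  · have h3 := hΦ.h_moments (i :: l) (by simp)
    have h4 : p 0 * ((i :: l).map fun i => h i * star (h i)).prod =
        ((i :: l).map fun i => h i * star (h i)).prod := by
      rw [List.map_cons, List.prod_cons, ← mul_assoc, ← mul_assoc, hΦ.proj_mul_h]
    rw [h4, h3]
    rfl

theorem compressedTrace_t (hΦ : IsFreeDeterministicEquivalent H T τ p h t) (hN : 0 < N)
    (hn : ∀ i, 0 < n i) (i : Fin k) {x : A × Matrix (Fin (n i)) (Fin (n i)) ℂ}
    (hx : x ∈ (Algebra.adjoin ℂ {(t i, T i)}).topologicalClosure) :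
    compressedTrace τ (p i.succ) (p i.succ * x.1) = normTrace (n i) x.2 := by
  refine eq_on_closure_adjoin (isLinearMap_compressedTrace τ (p i.succ))
    (normTrace (n i)).toLinearMap.isLinear
    (hΦ.continuous_compressedTrace _) (normTrace (n i)).continuous (fun l hl => ?_) hx
  rw [List.eq_replicate_of_mem hl, List.prod_replicate, Prod.pow_fst, Prod.pow_snd]
  rcases l.length with _ | m
  · rw [pow_zero, pow_zero, mul_one, compressedTrace,
      inv_mul_cancel₀ (hΦ.trace_proj_ne_zero hN hn i.succ)]
    exact (normTrace_one (hn i)).symm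
  · have h3 := hΦ.t_moments i (m + 1) (by omega)
    have h4 : p i.succ * t i ^ (m + 1) = t i ^ (m + 1) := by
      rw [pow_succ', ← mul_assoc, hΦ.proj_mul_t]
    dsimp only
    rw [h4, h3]
    rfl

end IsFreeDeterministicEquivalent

end Model

end FreeDetEquiv

namespace FreeDetEquiv

/-! ### Centred letters and the trace of the resolvent -/

section Model

open Matrix

attribute [local instance] Matrix.linftyOpNormedRing Matrix.linftyOpNormedAlgebra
attribute [local instance] matrixTopology

variable {k N : ℕ} {n : Fin k → ℕ} {H : (i : Fin k) → Matrix (Fin N) (Fin (n i)) ℂ}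
  {T : (i : Fin k) → Matrix (Fin (n i)) (Fin (n i)) ℂ}
  {A : Type*} [CStarAlgebra A] {τ : A →ₗ[ℂ] ℂ} {p : Fin (k + 1) → A} {h t : Fin k → A}

namespace IsFreeDeterministicEquivalent

theorem centeredPart_eq (hΦ : IsFreeDeterministicEquivalent H T τ p h t) (i : Fin k) {g r : ℂ}
    (hu : IsUnit (1 - g • (t i - r • (1 : A)))) :
    p i.succ * centeredPart (p i.succ) (t i) g r = centeredPart (p i.succ) (t i) g r ∧
      centeredPart (p i.succ) (t i) g r * p i.succ = centeredPart (p i.succ) (t i) g r ∧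
      centeredPart (p i.succ) (t i) g r -
        g • (((t i - r • (1 : A)) * p i.succ) * centeredPart (p i.succ) (t i) g r) =
        (t i - r • (1 : A)) * p i.succ := by
  have hpp := hΦ.rectangular.mul_self i.succ
  have hcomm : p i.succ * (t i - r • (1 : A)) = (t i - r • (1 : A)) * p i.succ := by
    rw [mul_sub, sub_mul, hΦ.proj_mul_t, hΦ.t_mul_proj, mul_smul_comm, smul_mul_assoc, mul_one,
      one_mul]
  have hcomm' : p i.succ * (1 - g • (t i - r • (1 : A))) =
      (1 - g • (t i - r • (1 : A))) * p i.succ := by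
    rw [mul_sub, sub_mul, mul_smul_comm, smul_mul_assoc, hcomm, mul_one, one_mul]
  have hinv := inverse_commute hu hcomm'
  have h1 : p i.succ * centeredPart (p i.succ) (t i) g r = centeredPart (p i.succ) (t i) g r := by
    rw [centeredPart, ← mul_assoc, hinv, mul_assoc, ← mul_assoc (p i.succ), hcomm, mul_assoc _ (p _),
      hpp]
  refine ⟨h1, ?_, ?_⟩
  · rw [centeredPart, mul_assoc, mul_assoc _ (p _), hpp]
  · rw [mul_assoc, h1, ← smul_mul_assoc]
    calc centeredPart (p i.succ) (t i) g r -
          (g • (t i - r • (1 : A))) * centeredPart (p i.succ) (t i) g r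
        = (1 - g • (t i - r • (1 : A))) * centeredPart (p i.succ) (t i) g r := by
          rw [sub_mul, one_mul]
      _ = _ := by
          rw [centeredPart, ← mul_assoc, Ring.mul_inverse_cancel _ hu, one_mul]

/-- On the matrix side tr(X (T - r)) = tr(X T) - r tr X = r - r = 0, where X is the inverse of the
pencil. Moments transfer this to t_i. The components at the other projections vanish by
orthogonality. -/
theorem trace_centeredPart (hΦ : IsFreeDeterministicEquivalent H T τ p h t) (hN : 0 < N)
    (hn : ∀ i, 0 < n i) (i : Fin k) {g r : ℂ}
    (h1 : normTrace (n i) (T i * Ring.inverse (cumulantPencil (T i) g r)) = r)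
    (h2 : normTrace (n i) (Ring.inverse (cumulantPencil (T i) g r)) = 1)
    (hs : ‖g • ((t i, T i) - r • (1 : A × Matrix (Fin (n i)) (Fin (n i)) ℂ))‖ ≤ 1 / 2) :
    condExp τ p (centeredPart (p i.succ) (t i) g r) = 0 := by
  have hR := hΦ.rectangular
  set x : A × Matrix (Fin (n i)) (Fin (n i)) ℂ := (t i, T i) - r • 1 with hx
  have hx1 : x.1 = t i - r • (1 : A) := rfl
  have hx2 : x.2 = T i - r • (1 : Matrix (Fin (n i)) (Fin (n i)) ℂ) := rfl
  have hxm : x ∈ Algebra.adjoin ℂ {(t i, T i)} :=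
    sub_mem (Algebra.subset_adjoin rfl) (Subalgebra.smul_mem _ (one_mem _) _)
  have hux := (isUnit_one_sub_of_norm_le_half hs).1
  have hprod := inverse_prod hux
  have e1 : (1 - g • x).1 = 1 - g • (t i - r • (1 : A)) := rfl
  have e2 : (1 - g • x).2 = cumulantPencil (T i) g r := by
    rw [Prod.snd_sub, Prod.smul_snd, hx2, cumulantPencil, Prod.snd_one]
    module
  rw [e1, e2] at hprod
  have hu1 : IsUnit (1 - g • (t i - r • (1 : A))) := e1 ▸ hux.map (MonoidHom.fst A _)
  obtain ⟨hp1, hp2, -⟩ := hΦ.centeredPart_eq i hu1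
  rw [hR.condExp_eq_zero_iff (hΦ.trace_proj_ne_zero hN hn)]
  intro j
  by_cases hj : j = i.succ
  · subst hj
    have hmem : Ring.inverse (1 - g • x) * x ∈ (Algebra.adjoin ℂ {(t i, T i)}).topologicalClosure :=
      mul_mem (inverse_one_sub_mem_closure (Subalgebra.smul_mem _ hxm g) hs)
        (Subalgebra.le_topologicalClosure _ hxm)
    have hm := hΦ.compressedTrace_t hN hn i hmem
    rw [hprod, Prod.fst_mul, Prod.snd_mul, hx1, hx2] at hm
    dsimp only at hm
    have hz : normTrace (n i) (Ring.inverse (cumulantPencil (T i) g r) *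
        (T i - r • (1 : Matrix (Fin (n i)) (Fin (n i)) ℂ))) = 0 := by
      rw [mul_sub, map_sub, mul_smul_comm, mul_one, map_smul, h2, smul_eq_mul, mul_one,
        normTrace_apply, Matrix.trace_mul_comm, ← normTrace_apply, h1, sub_self]
    rw [hz, compressedTrace] at hm
    have hm' := (mul_eq_zero.1 hm).resolve_left
      (inv_ne_zero (hΦ.trace_proj_ne_zero hN hn i.succ))
    rw [centeredPart, ← mul_assoc, ← mul_assoc, hR.tracial.trace, ← mul_assoc, ← mul_assoc,
      hR.mul_self, mul_assoc]
    exact hm'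
  · rw [← hp1, ← mul_assoc, hR.orthogonal j i.succ hj, zero_mul, map_zero]

theorem centeredPart_mem (i : Fin k) {g r : ℂ} (hs : ‖g • (t i - r • (1 : A))‖ ≤ 1 / 2) :
    centeredPart (p i.succ) (t i) g r ∈ (modelSubalgebras p h t (some i)).topologicalClosure := by
  have hm : t i - r • (1 : A) ∈ modelSubalgebras p h t (some i) :=
    sub_mem (t_mem i) (Subalgebra.smul_mem _ (one_mem _) _)
  exact mul_mem (inverse_one_sub_mem_closure (Subalgebra.smul_mem _ hm g) hs)
    (Subalgebra.le_topologicalClosure _ (mul_mem hm (proj_mem i.succ (some i))))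

theorem norm_centeredPart_le (i : Fin k) {g r : ℂ} {K : ℝ} (hr : ‖r‖ ≤ K)
    (hs : ‖g • (t i - r • (1 : A))‖ ≤ 1 / 2) :
    ‖centeredPart (p i.succ) (t i) g r‖ ≤
      (‖(1 : A)‖ + 1) * ((‖t i‖ + K * ‖(1 : A)‖) * ‖p i.succ‖) := by
  refine (norm_mul_le _ _).trans ?_
  gcongr
  · exact (isUnit_one_sub_of_norm_le_half hs).2
  · refine (norm_mul_le _ _).trans ?_
    gcongr
    refine (norm_sub_le _ _).trans ?_
    rw [norm_smul]
    gcongr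

/-- The sums of the h_i and of their adjoints act as a block row and a block column. The projections
recover the single blocks. -/
theorem proj_mul_sum_star (hΦ : IsFreeDeterministicEquivalent H T τ p h t) (j : Fin k) :
    p j.succ * ∑ i, star (h i) = star (h j) := by
  rw [Finset.mul_sum, Finset.sum_eq_single j, hΦ.proj_mul_star]
  · intro i _ hij
    rw [← hΦ.proj_mul_star, ← mul_assoc, hΦ.rectangular.orthogonal _ _ (by simpa using hij.symm),
      zero_mul]
  · simp

theorem sum_h_mul_proj (hΦ : IsFreeDeterministicEquivalent H T τ p h t) (j : Fin k) :
    (∑ i, h i) * p j.succ = h j := by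
  rw [Finset.sum_mul, Finset.sum_eq_single j, hΦ.h_mul_proj]
  · intro i _ hij
    rw [← hΦ.h_mul_proj, mul_assoc, hΦ.rectangular.orthogonal _ _ (by simpa using hij), mul_zero]
  · simp

theorem proj_zero_mul_sum_star (hΦ : IsFreeDeterministicEquivalent H T τ p h t) :
    p 0 * ∑ i, star (h i) = 0 := by
  rw [Finset.mul_sum]
  refine Finset.sum_eq_zero fun i _ => ?_
  rw [← hΦ.proj_mul_star, ← mul_assoc, hΦ.rectangular.orthogonal _ _ (Fin.succ_ne_zero i).symm,
    zero_mul]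

/-- The resolvent of the free deterministic equivalent, compared with the matrix resolvent. -/
theorem resolvent_trace (hΦ : IsFreeDeterministicEquivalent H T τ p h t) (hN : 0 < N)
    (hn : ∀ i, 0 < n i) {z : ℂ} {g r : Fin k → ℂ} {K : ℝ} (hz : z ≠ 0)
    (hg : ∀ j, g j = (n j : ℂ)⁻¹ * ((equivMatrix H r z)⁻¹ * (H j * (H j)ᴴ)).trace)
    (hr : ∀ i, ‖r i‖ ≤ K)
    (h1 : ∀ i, normTrace (n i) (T i * Ring.inverse (cumulantPencil (T i) (g i) (r i))) = r i)
    (h2 : ∀ i, normTrace (n i) (Ring.inverse (cumulantPencil (T i) (g i) (r i))) = 1)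
    (hs1 : 2 * ‖∑ i, r i • (h i * star (h i), H i * (H i)ᴴ)‖ ≤ ‖z‖)
    (hs2 : ∀ i, ‖g i • ((t i, T i) - r i • (1 : A × Matrix (Fin (n i)) (Fin (n i)) ℂ))‖ ≤ 1 / 2)
    (hs3 : (∑ i, (‖(1 : A)‖ + 1) * ((‖t i‖ + K * ‖(1 : A)‖) * ‖p i.succ‖)) *
      (‖∑ i, star (h i)‖ * ((‖(1 : A)‖ + 1) / ‖z‖) * ‖∑ i, h i‖ + ∑ i, ‖g i‖ * ‖p i.succ‖) < 1)
    (hs4 : 2 * ‖freeModel h t‖ ≤ ‖z‖) {x : A × Matrix (Fin N) (Fin N) ℂ}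
    (hx : x ∈ momentPairs H h) :
    compressedTrace τ (p 0) (p 0 * (Ring.inverse (z • (1 : A) - freeModel h t) * x.1)) =
      normTrace N ((equivMatrix H r z)⁻¹ * x.2) := by
  have hR := hΦ.rectangular
  have hp := hΦ.trace_proj_ne_zero hN hn
  have hfree := hR.free_closure hp (fun j i => proj_mem i j) hΦ.free
  set S := fun j => (modelSubalgebras p h t j).topologicalClosure with hS
  -- the resolvent of the subordinated element
  set Y := ∑ i, r i • (h i * star (h i), H i * (H i)ᴴ) with hY
  have hYm : Y ∈ momentPairs H h :=
    sum_mem fun i _ => Subalgebra.smul_mem _ (momentPair_mem H h i) _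
  have hY1 : Y.1 = ∑ i, r i • (h i * star (h i)) := by
    rw [hY, Prod.fst_sum]; rfl
  have hY2 : Y.2 = ∑ i, r i • (H i * (H i)ᴴ) := by
    rw [hY, Prod.snd_sum]; rfl
  have hYinv := inverse_smul_one_sub_mem_closure hz hYm hs1
  have hYprod := inverse_prod (isUnit_smul_one_sub hz hs1).1
  have e1 : (z • (1 : A × Matrix (Fin N) (Fin N) ℂ) - Y).1 = z • (1 : A) - Y.1 := rfl
  have e2 : (z • (1 : A × Matrix (Fin N) (Fin N) ℂ) - Y).2 = equivMatrix H r z := by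
    rw [Prod.snd_sub, hY2]; rfl
  rw [e1, e2, ← Matrix.nonsing_inv_eq_ringInverse] at hYprod
  set Z := z • (1 : A) - Y.1 with hZ
  set Q := Ring.inverse Z with hQ
  have hs1' : 2 * ‖Y.1‖ ≤ ‖z‖ := le_trans (by gcongr; exact norm_fst_le Y) hs1
  obtain ⟨hZu, hQn⟩ := isUnit_smul_one_sub hz hs1'
  have hmoment : ∀ y ∈ momentPairs H h, compressedTrace τ (p 0) (p 0 * (Q * y.1)) =
      normTrace N ((equivMatrix H r z)⁻¹ * y.2) := by
    intro y hy
    have := hΦ.compressedTrace_h hN hn (mul_mem hYinv (Subalgebra.le_topologicalClosure _ hy))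
    rw [hYprod, Prod.fst_mul, Prod.snd_mul] at this
    exact this
  have hfst : ∀ y ∈ momentPairs H h, y.1 ∈ modelSubalgebras p h t none := by
    intro y hy
    have : momentPairs H h ≤ (modelSubalgebras p h t none).comap (AlgHom.fst ℂ A _) := by
      refine Algebra.adjoin_le ?_
      rintro _ ⟨i, rfl⟩
      exact mul_mem (h_mem (t := t) i) (star_mem (t := t) i)
    exact this hy
  have hQm : Q ∈ S none := inverse_smul_one_sub_mem_closure hz (hfst Y hYm) hs1'
  -- the letters of the expansion
  set hh := ∑ i, h i with hhh
  set hs := ∑ i, star (h i) with hhs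
  set F := ∑ i, g i • p i.succ with hF
  set a : Fin k → A := fun i => (t i - r i • (1 : A)) * p i.succ with ha
  set d : Fin k → A := fun i => centeredPart (p i.succ) (t i) (g i) (r i) with hd
  have hs2' : ∀ i, ‖g i • (t i - r i • (1 : A))‖ ≤ 1 / 2 := fun i =>
    le_trans (norm_fst_le (g i • ((t i, T i) - r i • (1 : A × Matrix (Fin (n i)) (Fin (n i)) ℂ))))
      (hs2 i)
  have hdu := fun i => (isUnit_one_sub_of_norm_le_half (hs2' i)).1
  have hdp := fun i => hΦ.centeredPart_eq i (hdu i)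
  have hd0 : ∀ i, condExp τ p (d i) = 0 := fun i =>
    hΦ.trace_centeredPart hN hn i (h1 i) (h2 i) (hs2 i)
  have hdm : ∀ i, d i ∈ S (some i) := fun i => centeredPart_mem i (hs2' i)
  set b := hs * Q * hh - F with hb
  have hhm : hh ∈ S none :=
    Subalgebra.le_topologicalClosure _ (sum_mem fun i _ => h_mem i)
  have hsm : hs ∈ S none :=
    Subalgebra.le_topologicalClosure _ (sum_mem fun i _ => star_mem i)
  have hFm : F ∈ S none := Subalgebra.le_topologicalClosure _
    (sum_mem fun i _ => Subalgebra.smul_mem _ (proj_mem i.succ none) _)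
  have hbm : b ∈ S none := sub_mem (mul_mem (mul_mem hsm hQm) hhm) hFm
  have hpF : ∀ j : Fin k, p j.succ * F = g j • p j.succ := by
    intro j
    rw [hF, Finset.mul_sum, Finset.sum_eq_single j]
    · rw [mul_smul_comm, hR.mul_self]
    · intro i _ hij
      rw [mul_smul_comm, hR.orthogonal _ _ (by simpa using hij.symm), smul_zero]
    · simp
  -- This is the system for g: with M the total dimension, τ(h_j* Q h_j) = (1/M) Tr(… H_j H_j*) =
  -- (n_j/M) g_j = g_j τ(p_j). Off-diagonal blocks of b do not contribute to τ(p_j b).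
  have hb0 : condExp τ p b = 0 := by
    rw [hR.condExp_eq_zero_iff hp]
    refine fun i => Fin.cases ?_ (fun j => ?_) i
    · rw [hb, mul_sub, ← mul_assoc, ← mul_assoc, hΦ.proj_zero_mul_sum_star, zero_mul, zero_mul,
        zero_sub, hF, Finset.mul_sum]
      rw [Finset.sum_eq_zero, neg_zero, map_zero]
      intro i _
      rw [mul_smul_comm, hR.orthogonal _ _ (Fin.succ_ne_zero i).symm, smul_zero]
    · have e3 : τ (p j.succ * (hs * Q * hh)) = τ (star (h j) * Q * h j) := by
        rw [← hR.mul_self j.succ, mul_assoc, hR.tracial.trace, ← mul_assoc, ← mul_assoc,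
          hΦ.proj_mul_sum_star, mul_assoc (star (h j) * Q), hΦ.sum_h_mul_proj]
      have e4 : τ (star (h j) * Q * h j) = τ (p 0 * (Q * (h j * star (h j)))) := by
        rw [mul_assoc, hR.tracial.trace, hR.tracial.trace (p 0)]
        simp only [mul_assoc, hΦ.star_mul_proj]
      have e5 := hmoment _ (momentPair_mem H h j)
      dsimp only at e5
      have hN' : (N : ℂ) ≠ 0 := by exact_mod_cast hN.ne'
      have hnj : (n j : ℂ) ≠ 0 := by exact_mod_cast (hn j).ne'
      have hM := dim_ne_zero (n := n) hN
      rw [compressedTrace, inv_mul_eq_iff_eq_mul₀ (hp 0), normTrace_apply] at e5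
      have e6 : ((equivMatrix H r z)⁻¹ * (H j * (H j)ᴴ)).trace = n j * g j := by
        rw [hg j, ← mul_assoc, mul_inv_cancel₀ hnj, one_mul]
      rw [hb, mul_sub, map_sub, e3, e4, e5, e6, hpF, map_smul, hΦ.trace_proj_zero hN,
        hΦ.trace_proj, smul_eq_mul]
      field_simp
      ring
  -- the expansion of the resolvent
  have had : ∀ i j, i ≠ j → a i * d j = 0 := by
    intro i j hij
    rw [show d j = p j.succ * d j from (hdp j).1.symm, ← mul_assoc, mul_assoc _ (p i.succ),
      hR.orthogonal _ _ (by simpa using hij), mul_zero, zero_mul]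
  have haF : ∀ i, a i * F = g i • a i := by
    intro i
    rw [ha]
    dsimp only
    rw [mul_assoc, hpF, mul_smul_comm]
  have hda : (1 - (∑ i, a i) * F) * ∑ i, d i = ∑ i, a i := by
    have : (∑ i, a i) * F * ∑ i, d i = ∑ i, g i • (a i * d i) := by
      rw [Finset.sum_mul, Finset.sum_mul]
      refine Finset.sum_congr rfl fun i _ => ?_
      rw [haF, Finset.mul_sum, Finset.sum_eq_single i, smul_mul_assoc]
      · intro j _ hj
        rw [smul_mul_assoc, had i j hj.symm, smul_zero]
      · simp
    rw [sub_mul, one_mul, this, ← Finset.sum_sub_distrib]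
    exact Finset.sum_congr rfl fun i _ => (hdp i).2.2
  have hZΦ : Z - hh * (∑ i, a i) * hs = z • (1 : A) - freeModel h t := by
    have hha : ∀ i, hh * a i * hs = h i * t i * star (h i) - r i • (h i * star (h i)) := by
      intro i
      have hcomm : a i = p i.succ * (t i - r i • (1 : A)) := by
        rw [ha]
        dsimp only
        rw [sub_mul, mul_sub, hΦ.t_mul_proj, hΦ.proj_mul_t, mul_smul_comm, smul_mul_assoc, mul_one,
          one_mul]
      have haa : a i = p i.succ * a i := by
        rw [hcomm, ← mul_assoc, hR.mul_self]
      have hap : a i * hs = (t i - r i • (1 : A)) * star (h i) := by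
        rw [ha]
        dsimp only
        rw [mul_assoc, hΦ.proj_mul_sum_star]
      rw [haa, ← mul_assoc, hΦ.sum_h_mul_proj, mul_assoc, hap, sub_mul, mul_sub, smul_mul_assoc,
        one_mul, mul_smul_comm, mul_assoc]
    rw [Finset.mul_sum Finset.univ a hh, Finset.sum_mul, Finset.sum_congr rfl fun i _ => hha i,
      Finset.sum_sub_distrib, hZ, hY1, freeModel]
    abel
  have hdn : ‖∑ i, d i‖ ≤ ∑ i, (‖(1 : A)‖ + 1) * ((‖t i‖ + K * ‖(1 : A)‖) * ‖p i.succ‖) :=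
    (norm_sum_le _ _).trans (Finset.sum_le_sum fun i _ => norm_centeredPart_le i (hr i) (hs2' i))
  have hbn : ‖b‖ ≤ ‖hs‖ * ((‖(1 : A)‖ + 1) / ‖z‖) * ‖hh‖ + ∑ i, ‖g i‖ * ‖p i.succ‖ := by
    refine (norm_sub_le _ _).trans (add_le_add ?_ ?_)
    · exact norm_mul₃_le.trans (by gcongr)
    · refine (norm_sum_le _ _).trans (Finset.sum_le_sum fun i _ => ?_)
      rw [norm_smul]
  have hdb : ‖(∑ i, d i) * b‖ < 1 := by
    refine lt_of_le_of_lt ((norm_mul_le _ _).trans ?_) hs3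
    exact mul_le_mul hdn hbn (norm_nonneg _) ((norm_nonneg _).trans hdn)
  set X := Ring.inverse (1 - (∑ i, d i) * b) with hX
  have hXu : (1 - (∑ i, d i) * b) * X = 1 :=
    Ring.mul_inverse_cancel _ (Units.oneSub _ hdb).isUnit
  have hwood := woodbury_identity (h := hh) (h' := hs) (Ring.mul_inverse_cancel Z hZu) hda hb hXu
  rw [hZΦ] at hwood
  have hΦu := (isUnit_smul_one_sub hz hs4).1
  -- Invertibility is already known from the size of z, so the Woodbury right inverse is the
  -- inverse.
  have hres : Ring.inverse (z • (1 : A) - freeModel h t) =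
      Q + Q * hh * X * (∑ i, d i) * hs * Q := by
    exact (left_inv_eq_right_inv (Ring.inverse_mul_cancel _ hΦu) hwood)
  have hsum : HasSum (fun m : ℕ => ((∑ i, d i) * b) ^ m) X := by
    rw [hX, NormedRing.inverse_one_sub _ hdb]
    exact (summable_geometric_of_norm_lt_one hdb).hasSum
  -- By traciality everything outside X d is gathered into a single element of the closed algebra of
  -- the h_i.
  set y := hs * Q * x.1 * p 0 * Q * hh with hy
  have hym : y ∈ S none := by
    have hx1 : x.1 ∈ S none := Subalgebra.le_topologicalClosure _ (hfst x hx)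
    have hp0 : p 0 ∈ S none := Subalgebra.le_topologicalClosure _ (proj_mem 0 none)
    exact mul_mem (mul_mem (mul_mem (mul_mem (mul_mem hsm hQm) hx1) hp0) hQm) hhm
  have hzero : τ (y * (X * ∑ i, d i)) = 0 := by
    have hcont := hR.tracial.continuous
    have hs5 : HasSum (fun m : ℕ => τ (y * (((∑ i, d i) * b) ^ m * ∑ i, d i)))
        (τ (y * (X * ∑ i, d i))) :=
      ((hsum.mul_right _).mul_left y).map τ hcont
    have hs6 : (fun m : ℕ => τ (y * (((∑ i, d i) * b) ^ m * ∑ i, d i))) = fun _ => 0 :=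
      funext fun m => hR.trace_alternating hp (fun i =>
        Subalgebra.le_topologicalClosure _ (proj_mem i none)) hfree hbm hb0 hdm hd0 hym m
    rw [hs6] at hs5
    exact hs5.unique hasSum_zero
  have hsplit : τ (p 0 * (Ring.inverse (z • (1 : A) - freeModel h t) * x.1)) =
      τ (p 0 * (Q * x.1)) := by
    rw [hres, add_mul, mul_add, map_add]
    have : τ (p 0 * (Q * hh * X * (∑ i, d i) * hs * Q * x.1)) = τ (y * (X * ∑ i, d i)) := by
      rw [hy, show p 0 * (Q * hh * X * (∑ i, d i) * hs * Q * x.1) =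
        (p 0 * Q * hh * (X * ∑ i, d i)) * (hs * Q * x.1) by noncomm_ring, hR.tracial.trace]
      congr 1
      noncomm_ring
    rw [this, hzero, add_zero]
  rw [← hmoment x hx, compressedTrace, compressedTrace, hsplit]

end IsFreeDeterministicEquivalent

end Model

end FreeDetEquiv

namespace FreeDetEquiv

/-! ### The resolvent in the corner and the equations near infinity -/

section Model

open Matrix

attribute [local instance] Matrix.linftyOpNormedRing Matrix.linftyOpNormedAlgebra
attribute [local instance] matrixTopology

theorem cornerInv_eq {A : Type*} [CStarAlgebra A] {q x y : A} (hq : q * q = q)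
    (hy : IsCornerInv q x y) : cornerInv q x = y := by
  have hex : ∃ y, IsCornerInv q x y := ⟨y, hy⟩
  rw [cornerInv, dif_pos hex]
  exact IsCornerInv.unique hq hex.choose_spec hy

variable {k N : ℕ} {n : Fin k → ℕ} {H : (i : Fin k) → Matrix (Fin N) (Fin (n i)) ℂ}
  {T : (i : Fin k) → Matrix (Fin (n i)) (Fin (n i)) ℂ}
  {A : Type*} [CStarAlgebra A] {τ : A →ₗ[ℂ] ℂ} {p : Fin (k + 1) → A} {h t : Fin k → A}

namespace IsFreeDeterministicEquivalent

theorem isCornerInv_of_isUnit (hΦ : IsFreeDeterministicEquivalent H T τ p h t) {z : ℂ}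
    (hu : IsUnit (z • (1 : A) - freeModel h t)) :
    IsCornerInv (p 0) (z • p 0 - freeModel h t)
      (p 0 * Ring.inverse (z • (1 : A) - freeModel h t)) := by
  have hpp := hΦ.rectangular.mul_self 0
  have e1 : z • p 0 - freeModel h t = p 0 * (z • (1 : A) - freeModel h t) := by
    rw [mul_sub, mul_smul_comm, mul_one, hΦ.proj_mul_freeModel]
  have e2 : z • p 0 - freeModel h t = (z • (1 : A) - freeModel h t) * p 0 := by
    rw [sub_mul, smul_mul_assoc, one_mul, hΦ.freeModel_mul_proj]
  have hc := inverse_commute hu (e1.symm.trans e2)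
  refine ⟨?_, ?_, ?_⟩
  · rw [mul_assoc, mul_assoc, ← hc, ← mul_assoc, ← mul_assoc, hpp, hpp]
  · rw [e1, hc, mul_assoc (p 0), ← mul_assoc _ _ (p 0), Ring.mul_inverse_cancel _ hu, one_mul, hpp]
  · rw [e2, mul_assoc, ← mul_assoc (Ring.inverse _), Ring.inverse_mul_cancel _ hu, one_mul, hpp]

/-- Adding 1 - p 0 completes the corner block by the identity. Using z - Φ in A instead would lose
the point z = 0, where it is not invertible unless p 0 = 1. -/
theorem isUnit_of_mem_resolventSet (hΦ : IsFreeDeterministicEquivalent H T τ p h t) {z : ℂ}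
    (hz : z ∈ cornerResolventSet (p 0) (freeModel h t)) :
    IsUnit (z • p 0 - freeModel h t + (1 - p 0)) ∧
      cornerInv (p 0) (z • p 0 - freeModel h t) =
        p 0 * Ring.inverse (z • p 0 - freeModel h t + (1 - p 0)) := by
  have hpp := hΦ.rectangular.mul_self 0
  obtain ⟨y, hy⟩ := hz
  rw [cornerInv_eq hpp hy]
  obtain ⟨h1, h2, h3⟩ := hy
  have e1 : p 0 * y = y := by rw [← h1, ← mul_assoc, ← mul_assoc, hpp]
  have e2 : y * p 0 = y := by rw [← h1, mul_assoc, hpp]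
  have e3 : (z • p 0 - freeModel h t) * p 0 = z • p 0 - freeModel h t := by
    rw [sub_mul, smul_mul_assoc, hpp, hΦ.freeModel_mul_proj]
  have e4 : p 0 * (z • p 0 - freeModel h t) = z • p 0 - freeModel h t := by
    rw [mul_sub, mul_smul_comm, hpp, hΦ.proj_mul_freeModel]
  have hr : (z • p 0 - freeModel h t + (1 - p 0)) * (y + (1 - p 0)) = 1 := by
    rw [add_mul, mul_add, mul_add, h2, mul_sub, mul_one, e3, sub_self, sub_mul, one_mul, e1,
      sub_self, mul_sub, mul_one, sub_mul, one_mul, hpp]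
    abel
  have hl : (y + (1 - p 0)) * (z • p 0 - freeModel h t + (1 - p 0)) = 1 := by
    rw [add_mul, mul_add, mul_add, h3, mul_sub, mul_one, e2, sub_self, sub_mul, one_mul, e4,
      sub_self, mul_sub, mul_one, sub_mul, one_mul, hpp]
    abel
  refine ⟨(⟨_, _, hr, hl⟩ : Aˣ).isUnit, ?_⟩
  rw [inverse_eq_of_mul_eq_one hr hl, mul_add, e1, mul_sub, mul_one, hpp, sub_self, add_zero]

theorem resolvent_trace_eventually (hΦ : IsFreeDeterministicEquivalent H T τ p h t) (hN : 0 < N)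
    (hn : ∀ i, 0 < n i) {K δ : ℝ} (hK : 0 ≤ K) (hδ : 0 < δ)
    (hR : ∀ i, ∀ f : ℂ, ‖f‖ < δ → ‖rTransform (T i) f‖ ≤ K ∧
      normTrace (n i) (T i * Ring.inverse (cumulantPencil (T i) f (rTransform (T i) f))) =
        rTransform (T i) f ∧
      normTrace (n i) (Ring.inverse (cumulantPencil (T i) f (rTransform (T i) f))) = 1) :
    ∃ ε > (0 : ℝ), ε < δ ∧ ∃ ρ > (0 : ℝ), ∀ z : ℂ, ρ < ‖z‖ →
      IsUnit (z • (1 : A) - freeModel h t) ∧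
      ∀ g : Fin k → ℂ, (∀ j, ‖g j‖ ≤ ε) → SolvesSystem H T z g → ∀ x ∈ momentPairs H h,
        compressedTrace τ (p 0) (p 0 * (Ring.inverse (z • (1 : A) - freeModel h t) * x.1)) =
          normTrace N ((equivMatrix H (fun i => rTransform (T i) (g i)) z)⁻¹ * x.2) := by
  set E : ℝ := ‖(1 : A)‖ + 1 with hE
  set V : ℝ := ∑ i, (‖(t i, T i)‖ + K * ‖(1 : A × Matrix (Fin (n i)) (Fin (n i)) ℂ)‖) with hV
  have hV0 : 0 ≤ V := Finset.sum_nonneg fun i _ => by positivity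
  set D : ℝ := ∑ i, E * ((‖t i‖ + K * ‖(1 : A)‖) * ‖p i.succ‖) with hD
  have hD0 : 0 ≤ D := Finset.sum_nonneg fun i _ => by positivity
  set P : ℝ := ∑ i : Fin k, ‖p i.succ‖ with hP
  have hP0 : 0 ≤ P := Finset.sum_nonneg fun i _ => by positivity
  set C : ℝ := ∑ i, ‖(h i * star (h i), H i * (H i)ᴴ)‖ with hC
  have hC0 : 0 ≤ C := Finset.sum_nonneg fun i _ => norm_nonneg _
  set W : ℝ := ‖∑ i, star (h i)‖ * E * ‖∑ i, h i‖ with hW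
  have hW0 : 0 ≤ W := by positivity
  -- The three bounds give ε < δ, the Neumann condition for the letters d_i, and a contribution of
  -- at most 1/4 from F to ‖d b‖.
  set ε := min (δ / 2) (min (1 / (2 * (V + 1))) (1 / (4 * ((D + 1) * (P + 1))))) with hε
  have hε0 : 0 < ε := by positivity
  have hεV : ε * (2 * (V + 1)) ≤ 1 := by
    have : ε ≤ 1 / (2 * (V + 1)) := (min_le_right _ _).trans (min_le_left _ _)
    rwa [le_div_iff₀ (by positivity)] at this
  have hεD : ε * (4 * ((D + 1) * (P + 1))) ≤ 1 := by
    have : ε ≤ 1 / (4 * ((D + 1) * (P + 1))) := (min_le_right _ _).trans (min_le_right _ _)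
    rwa [le_div_iff₀ (by positivity)] at this
  have hεδ : ε < δ := lt_of_le_of_lt (min_le_left _ _) (by linarith)
  -- The term 4 D W makes the contribution of h* Q h to ‖d b‖ at most 1/4. The other terms give ‖z‖
  -- > 1 and the Neumann series for Q and for the resolvent of Φ.
  refine ⟨ε, hε0, hεδ, 1 + 2 * (K * C) + 4 * (D * W) + 2 * ‖freeModel h t‖, by positivity,
    fun z hz => ?_⟩
  have p1 : 0 ≤ K * C := by positivity
  have p2 : 0 ≤ D * W := by positivity
  have p3 := norm_nonneg (freeModel h t)
  have hz1 : 1 < ‖z‖ := by linarith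
  have hz0 : z ≠ 0 := norm_pos_iff.1 (by linarith)
  have hs4 : 2 * ‖freeModel h t‖ ≤ ‖z‖ := by linarith
  refine ⟨(isUnit_smul_one_sub hz0 hs4).1, fun g hg hsol x hx => ?_⟩
  have hgδ := fun i => (hg i).trans_lt hεδ
  refine hΦ.resolvent_trace hN hn hz0 hsol.2 (fun i => (hR i _ (hgδ i)).1)
    (fun i => (hR i _ (hgδ i)).2.1) (fun i => (hR i _ (hgδ i)).2.2) ?_ (fun i => ?_) ?_ hs4 hx
  · have : ‖∑ i, rTransform (T i) (g i) • (h i * star (h i), H i * (H i)ᴴ)‖ ≤ K * C := by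
      refine (norm_sum_le _ _).trans ?_
      rw [hC, Finset.mul_sum]
      refine Finset.sum_le_sum fun i _ => ?_
      rw [norm_smul]
      exact mul_le_mul_of_nonneg_right (hR i _ (hgδ i)).1 (norm_nonneg _)
    linarith
  · rw [norm_smul]
    have h1 : ‖(t i, T i) - rTransform (T i) (g i) • (1 : A × Matrix (Fin (n i)) (Fin (n i)) ℂ)‖ ≤
        V := by
      refine (norm_sub_le _ _).trans ?_
      rw [norm_smul]
      refine le_trans ?_ (Finset.single_le_sum (f := fun i => ‖(t i, T i)‖ +
        K * ‖(1 : A × Matrix (Fin (n i)) (Fin (n i)) ℂ)‖) (fun i _ => by positivity)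
        (Finset.mem_univ i))
      have := mul_le_mul_of_nonneg_right (hR i _ (hgδ i)).1
        (norm_nonneg (1 : A × Matrix (Fin (n i)) (Fin (n i)) ℂ))
      linarith
    have h2 := mul_le_mul (hg i) h1 (norm_nonneg _) hε0.le
    linarith
  · have h1 : ∑ i : Fin k, ‖g i‖ * ‖p i.succ‖ ≤ ε * P := by
      rw [hP, Finset.mul_sum]
      exact Finset.sum_le_sum fun i _ => mul_le_mul_of_nonneg_right (hg i) (norm_nonneg _)
    have h2 : ‖∑ i, star (h i)‖ * (E / ‖z‖) * ‖∑ i, h i‖ = W / ‖z‖ := by rw [hW]; ring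
    rw [h2]
    have h3 : D * (W / ‖z‖) ≤ 1 / 4 := by
      rw [← mul_div_assoc, div_le_iff₀ (by linarith)]
      linarith
    have h4 : D * (∑ i : Fin k, ‖g i‖ * ‖p i.succ‖) ≤ 1 / 4 := by
      have h5 : D * (∑ i : Fin k, ‖g i‖ * ‖p i.succ‖) ≤ D * (ε * P) := by gcongr
      have h6 : D * (ε * P) ≤ ε * ((D + 1) * (P + 1)) := by
        nlinarith [mul_nonneg hε0.le hD0, mul_nonneg hε0.le hP0]
      linarith
    rw [mul_add]
    linarith

/-- The functions `z ↦ τ⁽⁰⁾((z - Φ)⁻¹ x)`. -/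
noncomputable def resolventTrace (τ : A →ₗ[ℂ] ℂ) (p : Fin (k + 1) → A) (h t : Fin k → A) (x : A) (z : ℂ) : ℂ :=
  compressedTrace τ (p 0) (cornerInv (p 0) (z • p 0 - freeModel h t) * x)

theorem fTransform_eq (j : Fin k) (z : ℂ) : fTransform N n τ p h t j z =
    (N : ℂ) / (n j : ℂ) * resolventTrace τ p h t (h j * star (h j)) z := rfl

theorem cauchyTransform_eq (z : ℂ) : cauchyTransform τ (p 0) (freeModel h t) z =
    resolventTrace τ p h t 1 z := by
  rw [resolventTrace, mul_one, cauchyTransform]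

/-- The equations near infinity. -/
theorem equations_near_infinity (hΦ : IsFreeDeterministicEquivalent H T τ p h t) (hN : 0 < N)
    (hn : ∀ i, 0 < n i) {K δ L : ℝ} (hK : 0 ≤ K) (hδ : 0 < δ) (hL : 0 ≤ L)
    (hR : ∀ i, ∀ f : ℂ, ‖f‖ < δ → ‖rTransform (T i) f‖ ≤ K ∧
      normTrace (n i) (T i * Ring.inverse (cumulantPencil (T i) f (rTransform (T i) f))) =
        rTransform (T i) f ∧
      normTrace (n i) (Ring.inverse (cumulantPencil (T i) f (rTransform (T i) f))) = 1 ∧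
      ∀ f' : ℂ, ‖f'‖ < δ → ‖rTransform (T i) f - rTransform (T i) f'‖ ≤ L * ‖f - f'‖) :
    ∃ ρ > (0 : ℝ), ∀ z : ℂ, ρ < ‖z‖ →
      z ∈ cornerResolventSet (p 0) (freeModel h t) ∧
      (∀ j, ‖fTransform N n τ p h t j z‖ < δ) ∧
      SolvesSystem H T z (fun j => fTransform N n τ p h t j z) ∧
      (∀ g : Fin k → ℂ, (∀ j, ‖g j‖ < δ) → SolvesSystem H T z g →
        g = fun j => fTransform N n τ p h t j z) ∧
      ∀ x ∈ momentPairs H h, resolventTrace τ p h t x.1 z = normTrace N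
        ((equivMatrix H (fun i => rTransform (T i) (fTransform N n τ p h t i z)) z)⁻¹ * x.2) := by
  obtain ⟨ε, hε, hεδ, ρ₁, hρ₁, h₁⟩ := hΦ.resolvent_trace_eventually hN hn hK hδ
    (fun i f hf => ⟨(hR i f hf).1, (hR i f hf).2.1, (hR i f hf).2.2.1⟩)
  obtain ⟨ρ₂, hρ₂, h₂⟩ := exists_unique_solution H T hK hL
    (fun i f hf => ⟨(hR i f hf).1, (hR i f hf).2.2.2⟩) hε hεδ
  refine ⟨max ρ₁ ρ₂, lt_max_of_lt_left hρ₁, fun z hz => ?_⟩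
  obtain ⟨hu, htr⟩ := h₁ z ((le_max_left _ _).trans_lt hz)
  obtain ⟨⟨g, hgε, hg⟩, huniq⟩ := h₂ z ((le_max_right _ _).trans_lt hz)
  have hgδ := fun j => (hgε j).trans_lt hεδ
  have hcorner := hΦ.isCornerInv_of_isUnit hu
  have htrace : ∀ x ∈ momentPairs H h, resolventTrace τ p h t x.1 z =
      normTrace N ((equivMatrix H (fun i => rTransform (T i) (g i)) z)⁻¹ * x.2) := by
    intro x hx
    rw [← htr g hgε hg x hx, resolventTrace, cornerInv_eq (hΦ.rectangular.mul_self 0) hcorner,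
      mul_assoc]
  -- The trace identity on h_j h_j* turns the system for g_j into the definition of f_j, so the
  -- solution found by contraction is f.
  have hgf : g = fun j => fTransform N n τ p h t j z := by
    funext j
    have hN' : (N : ℂ) ≠ 0 := by exact_mod_cast hN.ne'
    have h3 := htrace _ (momentPair_mem H h j)
    rw [fTransform_eq, h3, hg.2 j, normTrace_apply]
    field_simp
  refine ⟨⟨_, hcorner⟩, ?_, ?_, ?_, ?_⟩
  · intro j
    have := hgδ j
    rwa [hgf] at this
  · rwa [← hgf]
  · intro g' hg' hs'
    rw [← hgf]
    exact huniq g' g hg' hgδ hs' hg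
  · intro x hx
    rw [htrace x hx, hgf]

theorem differentiableOn_resolventTrace (hΦ : IsFreeDeterministicEquivalent H T τ p h t) {Ω : Set ℂ}
    (hΩ : Ω ⊆ cornerResolventSet (p 0) (freeModel h t)) (x : A) :
    DifferentiableOn ℂ (resolventTrace τ p h t x) Ω := by
  have hd : DifferentiableOn ℂ (fun z : ℂ => compressedTrace τ (p 0)
      (p 0 * Ring.inverse (z • p 0 - freeModel h t + (1 - p 0)) * x)) Ω := by
    intro z hz
    have hu := (hΦ.isUnit_of_mem_resolventSet (hΩ hz)).1
    have h1 : DifferentiableAt ℂ (fun z : ℂ => z • p 0 - freeModel h t + (1 - p 0)) z := by fun_prop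
    have h2 : DifferentiableAt ℂ (fun z : ℂ =>
        Ring.inverse (z • p 0 - freeModel h t + (1 - p 0))) z := by
      exact (differentiableAt_inverse hu).comp z h1
    have h4 : DifferentiableAt ℂ (fun z : ℂ =>
        p 0 * Ring.inverse (z • p 0 - freeModel h t + (1 - p 0)) * x) z :=
      ((differentiableAt_const _).mul h2).mul (differentiableAt_const _)
    let τ' : A →L[ℂ] ℂ := ⟨τ, hΦ.rectangular.tracial.continuous⟩
    have h5 := (τ'.differentiableAt.comp z h4).const_mul ((τ (p 0))⁻¹)
    exact h5.differentiableWithinAt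
  refine hd.congr fun z hz => ?_
  rw [resolventTrace, (hΦ.isUnit_of_mem_resolventSet (hΩ hz)).2]

end IsFreeDeterministicEquivalent

/-! ### The algebra generated by the matrices `H_i H_i*` -/

/-- The generators are self-adjoint. Closure under adjoints makes the trace form on the matrix
algebra non-degenerate. -/
theorem star_mem_momentPairs (H : (i : Fin k) → Matrix (Fin N) (Fin (n i)) ℂ) (h : Fin k → A)
    {y : A × Matrix (Fin N) (Fin N) ℂ} (hy : y ∈ momentPairs H h) :
    (star y.1, (y.2)ᴴ) ∈ momentPairs H h := by
  induction hy using Algebra.adjoin_induction with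
  | mem y hy =>
    obtain ⟨i, rfl⟩ := hy
    simpa using momentPair_mem H h i
  | algebraMap c =>
    have : (star (algebraMap ℂ (A × Matrix (Fin N) (Fin N) ℂ) c).1,
        ((algebraMap ℂ (A × Matrix (Fin N) (Fin N) ℂ) c).2)ᴴ) =
        algebraMap ℂ (A × Matrix (Fin N) (Fin N) ℂ) (star c) := by
      refine Prod.ext ?_ ?_
      · exact (algebraMap_star_comm c).symm
      · exact (algebraMap_star_comm (A := Matrix (Fin N) (Fin N) ℂ) c).symm
    rw [this]
    exact Subalgebra.algebraMap_mem _ _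
  | add y z _ _ hy hz =>
    have := add_mem hy hz
    simpa using this
  | mul y z _ _ hy hz =>
    have := mul_mem hz hy
    simpa using this

/-- The functional `X ↦ Tr(X E)` is represented on the generated algebra by an element of it. -/
theorem exists_trace_represent (H : (i : Fin k) → Matrix (Fin N) (Fin (n i)) ℂ) (h : Fin k → A)
    (E : Matrix (Fin N) (Fin N) ℂ) : ∃ q ∈ momentPairs H h, ∀ y ∈ momentPairs H h,
      (y.2 * E).trace = (y.2 * q.2).trace := by
  set B : Subalgebra ℂ (Matrix (Fin N) (Fin N) ℂ) :=
    (momentPairs H h).map (AlgHom.snd ℂ A (Matrix (Fin N) (Fin N) ℂ)) with hB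
  let tr : Matrix (Fin N) (Fin N) ℂ →ₗ[ℂ] ℂ := Matrix.traceLinearMap (Fin N) ℂ ℂ
  let Λ : B →ₗ[ℂ] Module.Dual ℂ B :=
    LinearMap.mk₂ ℂ (fun x y : B => ((y : Matrix (Fin N) (Fin N) ℂ) * x).trace)
      (fun x x' y => by simp [mul_add]) (fun c x y => by simp)
      (fun x y y' => by simp [add_mul]) (fun c x y => by simp)
  -- For x in the kernel, pairing with xᴴ gives Tr(xᴴ x) = 0, so x = 0. In finite dimension the
  -- trace form then represents every functional.
  have hinj : Function.Injective Λ := by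
    rw [injective_iff_map_eq_zero]
    intro x hx
    obtain ⟨y, hy, hyx⟩ := x.2
    have hstar : (x : Matrix (Fin N) (Fin N) ℂ)ᴴ ∈ B := by
      rw [← hyx]
      exact ⟨_, star_mem_momentPairs H h hy, rfl⟩
    have h1 : Λ x ⟨_, hstar⟩ = 0 := by rw [hx]; rfl
    have h2 : ((x : Matrix (Fin N) (Fin N) ℂ)ᴴ * x).trace = 0 := h1
    rw [Matrix.trace_conjTranspose_mul_self_eq_zero_iff] at h2
    exact Subtype.ext h2
  have hsurj : Function.Surjective Λ :=
    (LinearMap.injective_iff_surjective_of_finrank_eq_finrank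
      (Subspace.dual_finrank_eq (K := ℂ) (V := B)).symm).1 hinj
  obtain ⟨x, hx⟩ := hsurj ((tr ∘ₗ LinearMap.mulRight ℂ E) ∘ₗ B.val.toLinearMap)
  obtain ⟨q, hq, hqx⟩ := x.2
  refine ⟨q, hq, fun y hy => ?_⟩
  have h1 := LinearMap.congr_fun hx ⟨y.2, y, hy, rfl⟩
  have h2 : (y.2 * (x : Matrix (Fin N) (Fin N) ℂ)).trace = (y.2 * E).trace := h1
  rw [← h2, ← hqx]
  rfl

/-- Left multiplication by the invertible matrix is injective on the finite-dimensional algebra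
containing it, hence surjective, so 1 is attained. -/
theorem inv_mem_momentPairs (H : (i : Fin k) → Matrix (Fin N) (Fin (n i)) ℂ) (h : Fin k → A)
    {r : Fin k → ℂ} {z : ℂ} (hu : IsUnit (equivMatrix H r z)) :
    ∃ y ∈ momentPairs H h, y.2 = (equivMatrix H r z)⁻¹ := by
  set B : Subalgebra ℂ (Matrix (Fin N) (Fin N) ℂ) :=
    (momentPairs H h).map (AlgHom.snd ℂ A (Matrix (Fin N) (Fin N) ℂ)) with hB
  have hmem : equivMatrix H r z ∈ B :=
    sub_mem (Subalgebra.smul_mem _ (one_mem _) _)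
      (sum_mem fun i _ => Subalgebra.smul_mem B
        (show H i * (H i)ᴴ ∈ B from ⟨_, momentPair_mem H h i, rfl⟩) _)
  have hinj : Function.Injective (LinearMap.mulLeft ℂ (⟨_, hmem⟩ : B)) := by
    intro x y hxy
    have h1 : equivMatrix H r z * (x : Matrix (Fin N) (Fin N) ℂ) = equivMatrix H r z * y :=
      congrArg Subtype.val hxy
    exact Subtype.ext (hu.mul_left_cancel h1)
  obtain ⟨x, hx⟩ := LinearMap.injective_iff_surjective.1 hinj 1
  have h1 : equivMatrix H r z * (x : Matrix (Fin N) (Fin N) ℂ) = 1 := congrArg Subtype.val hx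
  obtain ⟨y, hy, hyx⟩ := x.2
  refine ⟨y, hy, ?_⟩
  rw [Matrix.inv_eq_right_inv h1, ← hyx]
  rfl

namespace IsFreeDeterministicEquivalent

/-- The analytic continuation of the equations. -/
theorem equations_continuation (hΦ : IsFreeDeterministicEquivalent H T τ p h t) (hN : 0 < N)
    {Ω : Set ℂ} {ρ : ℝ} {r : Fin k → ℂ → ℂ} (hΩo : IsOpen Ω) (hΩc : IsPreconnected Ω)
    (hΩ : Ω ⊆ cornerResolventSet (p 0) (freeModel h t)) (hρ : {z : ℂ | ρ < ‖z‖} ⊆ Ω)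
    (hr : ∀ i, DifferentiableOn ℂ (r i) Ω)
    (heq : ∀ z : ℂ, ρ < ‖z‖ → IsUnit (equivMatrix H (fun i => r i z) z) ∧
      ∀ x ∈ momentPairs H h, resolventTrace τ p h t x.1 z =
        normTrace N ((equivMatrix H (fun i => r i z) z)⁻¹ * x.2)) {z : ℂ} (hz : z ∈ Ω) :
    IsUnit (equivMatrix H (fun i => r i z) z) ∧
      ∀ x ∈ momentPairs H h, resolventTrace τ p h t x.1 z =
        normTrace N ((equivMatrix H (fun i => r i z) z)⁻¹ * x.2) := by
  have hN' : (N : ℂ) ≠ 0 := by exact_mod_cast hN.ne'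
  -- two holomorphic functions that agree near infinity agree on `Ω`
  have hident : ∀ u v : ℂ → ℂ, DifferentiableOn ℂ u Ω → DifferentiableOn ℂ v Ω →
      (∀ w : ℂ, ρ < ‖w‖ → u w = v w) → Set.EqOn u v Ω := by
    intro u v hu hv huv
    have hz₀ : ρ < ‖((|ρ| + 1 : ℝ) : ℂ)‖ := by
      rw [Complex.norm_real, Real.norm_eq_abs, abs_of_pos (by positivity)]
      linarith [le_abs_self ρ]
    refine (hu.analyticOnNhd hΩo).eqOn_of_preconnected_of_eventuallyEq (hv.analyticOnNhd hΩo) hΩc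
      (hρ hz₀) ?_
    have hopen : IsOpen {w : ℂ | ρ < ‖w‖} := isOpen_lt continuous_const continuous_norm
    filter_upwards [hopen.mem_nhds hz₀] with w hw using huv w hw
  -- Pairing with this matrix unit reads off the (a, b) entry. The representing elements do not
  -- depend on z, so Y is defined and holomorphic on all of Ω.
  choose q hq hqtr using fun a b : Fin N => exists_trace_represent H h (Matrix.single b a (1 : ℂ))
  set Y : ℂ → Matrix (Fin N) (Fin N) ℂ := fun w =>
    Matrix.of fun a b => (N : ℂ) * resolventTrace τ p h t (q a b).1 w with hY
  have hYd : ∀ a b, DifferentiableOn ℂ (fun w => Y w a b) Ω := fun a b =>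
    (hΦ.differentiableOn_resolventTrace hΩ _).const_mul _
  have hYinv : ∀ w : ℂ, ρ < ‖w‖ → Y w = (equivMatrix H (fun i => r i w) w)⁻¹ := by
    intro w hw
    obtain ⟨hu, htr⟩ := heq w hw
    obtain ⟨y, hy, hyw⟩ := inv_mem_momentPairs H h hu
    ext a b
    have h1 := htr _ (hq a b)
    have h2 := hqtr a b y hy
    rw [← hyw] at h1 ⊢
    rw [show Y w a b = (N : ℂ) * resolventTrace τ p h t (q a b).1 w from rfl, h1, normTrace_apply, ← h2, Matrix.trace_mul_single]
    field_simp
    simp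
  have hZd : ∀ a b, DifferentiableOn ℂ (fun w => equivMatrix H (fun i => r i w) w a b) Ω := by
    intro a b
    have : (fun w => equivMatrix H (fun i => r i w) w a b) = fun w =>
        w * (1 : Matrix (Fin N) (Fin N) ℂ) a b - ∑ i, r i w * (H i * (H i)ᴴ) a b := by
      funext w
      simp [equivMatrix, Matrix.sum_apply]
    rw [this]
    refine (differentiableOn_id.mul_const _).sub (DifferentiableOn.fun_sum fun i _ => ?_)
    exact (hr i).mul_const _
  -- Invertibility is not assumed away from infinity. The polynomial identity Y Z = 1 between
  -- holomorphic entries persists and yields it.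
  have hprod : Y z * equivMatrix H (fun i => r i z) z = 1 := by
    ext a b
    refine hident (fun w => (Y w * equivMatrix H (fun i => r i w) w) a b)
      (fun _ => (1 : Matrix (Fin N) (Fin N) ℂ) a b) ?_ (differentiableOn_const _) ?_ hz
    · simp only [Matrix.mul_apply]
      exact DifferentiableOn.fun_sum fun c _ => (hYd a c).mul (hZd c b)
    · intro w hw
      have hu := (heq w hw).1
      rw [hYinv w hw, Matrix.nonsing_inv_mul _ ((Matrix.isUnit_iff_isUnit_det _).1 hu)]
  have hinv : (equivMatrix H (fun i => r i z) z)⁻¹ = Y z := Matrix.inv_eq_left_inv hprod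
  refine ⟨IsUnit.of_mul_eq_one_right _ hprod, fun x hx => ?_⟩
  rw [hinv]
  refine hident (resolventTrace τ p h t x.1) (fun w => normTrace N (Y w * x.2))
    (hΦ.differentiableOn_resolventTrace hΩ _) ?_ ?_ hz
  · simp only [normTrace_apply, Matrix.trace, Matrix.diag_apply, Matrix.mul_apply]
    refine DifferentiableOn.const_mul (DifferentiableOn.fun_sum fun a _ =>
      DifferentiableOn.fun_sum fun b _ => (hYd a b).mul_const _) _
  · intro w hw
    rw [hYinv w hw, (heq w hw).2 x hx]

end IsFreeDeterministicEquivalent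

end Model

end FreeDetEquiv

/-! ### The main theorem -/

open FreeDetEquiv Matrix in
theorem mainTheorem5 {k : ℕ} (N : ℕ) (n : Fin k → ℕ) (hN : 0 < N) (hn : ∀ i, 0 < n i)
    (H : (i : Fin k) → Matrix (Fin N) (Fin (n i)) ℂ)
    (T : (i : Fin k) → Matrix (Fin (n i)) (Fin (n i)) ℂ)
    {A : Type*} [CStarAlgebra A] (τ : A →ₗ[ℂ] ℂ) (p : Fin (k + 1) → A) (h t : Fin k → A)
    (hΦ : IsFreeDeterministicEquivalent H T τ p h t) :
    let G : ℂ → ℂ := cauchyTransform τ (p 0) (freeModel h t)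
    let f : Fin k → ℂ → ℂ := fTransform N n τ p h t
    -- the equations in a neighbourhood of infinity
    (∃ ρ > (0 : ℝ), ∃ δ > (0 : ℝ),
      (∀ i, ∀ w : ℂ, ‖w‖ < δ → Summable fun m => rCoeff (T i) m * w ^ m) ∧
      ∀ z : ℂ, ρ < ‖z‖ →
        z ∈ cornerResolventSet (p 0) (freeModel h t) ∧
        (∀ j, ‖f j z‖ < δ) ∧
        SolvesSystem H T z (fun j => f j z) ∧
        (∀ g : Fin k → ℂ, (∀ j, ‖g j‖ < δ) → SolvesSystem H T z g → g = fun j => f j z) ∧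
        G z = (N : ℂ)⁻¹ *
          ((equivMatrix H (fun i => rTransform (T i) (f i z)) z)⁻¹).trace ∧
        SolvesClassicalSystem H T z (fun j => -((n j : ℂ) / (N : ℂ)) * f j z)
          (fun j => rTransform (T j) (f j z)) ∧
        G z = -((N : ℂ)⁻¹ * (((∑ i, rTransform (T i) (f i z) • (H i * (H i)ᴴ)) -
          z • (1 : Matrix (Fin N) (Fin N) ℂ))⁻¹).trace)) ∧
    -- their analytic continuation
    (∀ (Ω : Set ℂ) (ρ : ℝ) (r : Fin k → ℂ → ℂ), IsOpen Ω → IsPreconnected Ω →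
      Ω ⊆ cornerResolventSet (p 0) (freeModel h t) → {z : ℂ | ρ < ‖z‖} ⊆ Ω →
      (∀ i, DifferentiableOn ℂ (r i) Ω) →
      (∀ z : ℂ, ρ < ‖z‖ → ∀ i, r i z = rTransform (T i) (f i z)) →
      ∀ z ∈ Ω,
        IsUnit (equivMatrix H (fun i => r i z) z) ∧
        G z = (N : ℂ)⁻¹ * ((equivMatrix H (fun i => r i z) z)⁻¹).trace ∧
        ∀ j, f j z = (n j : ℂ)⁻¹ *
          ((equivMatrix H (fun i => r i z) z)⁻¹ * (H j * (H j)ᴴ)).trace) ∧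
    -- equivalence with the system that does not use R-transforms
    (∀ K > (0 : ℝ), ∃ δ > (0 : ℝ), ∀ (z : ℂ) (e e' : Fin k → ℂ),
      (∀ j, ‖e j‖ < δ) → (∀ j, ‖e' j‖ < K) →
      (SolvesClassicalSystem H T z e e' ↔
        SolvesSystem H T z (fun j => -((N : ℂ) / (n j : ℂ)) * e j) ∧
        ∀ j, e' j = rTransform (T j) (-((N : ℂ) / (n j : ℂ)) * e j))) := by
  intro G f
  have hN' : (N : ℂ) ≠ 0 := by exact_mod_cast hN.ne'
  obtain ⟨K, hK, δ₁, hδ₁, L, hL, hR⟩ := rTransform_spec hn T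
  -- The equivalence needs a strict bound on e', whereas the R-transforms are only known to be at
  -- most K.
  obtain ⟨δ₂, hδ₂, hclassical⟩ := solvesClassicalSystem_iff hN hn H T (K + 1)
  have hδ : 0 < min δ₁ δ₂ := lt_min hδ₁ hδ₂
  obtain ⟨ρ, hρ, hmain⟩ := hΦ.equations_near_infinity hN hn hK hδ hL (fun i w hw => by
    obtain ⟨-, h2, -, h4, h5, h6⟩ := hR i w (hw.trans_le (min_le_left _ _))
    exact ⟨h2, h4, h5, fun w' hw' => h6 w' (hw'.trans_le (min_le_left _ _))⟩)
  have hG : ∀ {r : Fin k → ℂ} {z : ℂ}, (∀ x ∈ momentPairs H h,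
      IsFreeDeterministicEquivalent.resolventTrace τ p h t x.1 z =
        normTrace N ((equivMatrix H r z)⁻¹ * x.2)) →
      G z = (N : ℂ)⁻¹ * ((equivMatrix H r z)⁻¹).trace := by
    intro r z hx
    have h1 := hx 1 (one_mem _)
    rw [Prod.fst_one, Prod.snd_one, mul_one, normTrace_apply] at h1
    exact (IsFreeDeterministicEquivalent.cauchyTransform_eq z).trans h1
  have hf : ∀ {r : Fin k → ℂ} {z : ℂ}, (∀ x ∈ momentPairs H h,
      IsFreeDeterministicEquivalent.resolventTrace τ p h t x.1 z =
        normTrace N ((equivMatrix H r z)⁻¹ * x.2)) →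
      ∀ j, f j z = (n j : ℂ)⁻¹ * ((equivMatrix H r z)⁻¹ * (H j * (H j)ᴴ)).trace := by
    intro r z hx j
    have h1 := hx _ (momentPair_mem H h j)
    rw [normTrace_apply] at h1
    refine (IsFreeDeterministicEquivalent.fTransform_eq j z).trans ?_
    rw [h1]
    field_simp
  refine ⟨⟨ρ, hρ, min δ₁ δ₂, hδ, fun i w hw => (hR i w (hw.trans_le (min_le_left _ _))).1,
    fun z hz => ?_⟩, ?_, ?_⟩
  · obtain ⟨h1, h2, h3, h4, h5⟩ := hmain z hz
    have hGz := hG h5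
    refine ⟨h1, h2, h3, h4, hGz, ?_, ?_⟩
    · have he : ∀ j, -((N : ℂ) / (n j : ℂ)) * (-((n j : ℂ) / (N : ℂ)) * f j z) = f j z := by
        intro j
        have hnj : (n j : ℂ) ≠ 0 := by exact_mod_cast (hn j).ne'
        field_simp
      refine (hclassical z _ _ (fun j => ?_) (fun j => ?_)).2 ⟨?_, fun j => ?_⟩
      · rw [he]
        exact (h2 j).trans_le (min_le_right _ _)
      · exact lt_of_le_of_lt (hR j _ ((h2 j).trans_le (min_le_left _ _))).2.1 (by linarith)
      · simp only [he]
        exact h3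
      · rw [he]
    · rw [hGz, classical_resolvent_eq_neg, Matrix.nonsing_inv_eq_ringInverse,
        Matrix.nonsing_inv_eq_ringInverse, inverse_neg_eq, Matrix.trace_neg, mul_neg, neg_neg]
  · intro Ω ρ' r hΩo hΩc hΩ hρ' hr hreq z hz
    obtain ⟨h1, h2⟩ := hΦ.equations_continuation hN (ρ := max ρ' ρ) hΩo hΩc hΩ
      (fun w (hw : _ < ‖w‖) => hρ' (show ρ' < ‖w‖ from (le_max_left _ _).trans_lt hw)) hr (fun w hw => by
        obtain ⟨-, -, h3, -, h5⟩ := hmain w ((le_max_right _ _).trans_lt hw)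
        have h6 : (fun i => r i w) = fun i => rTransform (T i) (f i w) :=
          funext fun i => hreq w ((le_max_left _ _).trans_lt hw) i
        rw [h6]
        exact ⟨h3.1, h5⟩) hz
    exact ⟨h1, hG h2, hf h2⟩
  · intro K' hK'
    obtain ⟨δ, hδ', hiff⟩ := solvesClassicalSystem_iff hN hn H T K'
    have hN0 : (0 : ℝ) < N := by exact_mod_cast hN
    -- Since n_j ≥ 1, the rescaled unknown satisfies |(N/n_j) e_j| ≤ N |e_j|.
    refine ⟨δ / N, by positivity, fun z e e' he he' => hiff z e e' (fun j => ?_) he'⟩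
    have hnj : (1 : ℝ) ≤ n j := by exact_mod_cast hn j
    have hej := he j
    rw [lt_div_iff₀ hN0] at hej
    rw [norm_mul, norm_neg, norm_div, Complex.norm_natCast, Complex.norm_natCast]
    have : (N : ℝ) / n j ≤ N := div_le_self hN0.le hnj
    have := mul_le_mul_of_nonneg_right this (norm_nonneg (e j))
    linarith
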